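/- **Formulas.** Fix a set of atoms. Formulas of $L(U,S)$ are built from atoms with $\neg$, $\wedge$ and the binary connectives $U$, $S$; the *length* of a formula is the number of occurrences of atoms and connectives in it. In a structure $(\mathbb R,<,h)$, where $h(p)\subseteq\mathbb R$ for each atom $p$, truth at a point is defined as usual for atoms, $\neg$, $\wedge$; $U(\alpha,\beta)$ holds at $x$ iff there is $y>x$ at which $\alpha$ holds such that $\beta$ holds at all $z$ with $x<z<y$; $S(\alpha,\beta)$ is defined as the mirror image. "Mirror image" always means that $U$ and $S$, and earlier and later, are exchanged. A formula is *$\mathbb R$-satisfiable* if it is true at some point of some such structure. Let $\mathrm{Cl}\,\phi=\{\chi,\neg\chi : \chi \text{ a subformula of }\phi\}$, and let $\sim\!\alpha$ be $\beta$ if $\alpha=\neg\beta$, and $\neg\alpha$ otherwise. A set $X$ of formulas is *propositionally consistent* if no formula $\neg(\alpha_1\wedge\dots\wedge\alpha_n)$ with all $\alpha_i\in X$, $n\ge 1$, is a substitution instance of a classical propositional tautology. *MPC* means maximal among the propositionally consistent subsets of $\mathrm{Cl}\,\phi$. **Mosaics.** A *$\phi$-mosaic* is a triple $(A,B,C)$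 (start, cover, end) of subsets of $\mathrm{Cl}\,\phi$ such that $A$ and $C$ are MPC; for all $\beta\in\mathrm{Cl}\,\phi$ with $\neg\beta\in\mathrm{Cl}\,\phi$, $\neg\beta\in B$ iff $\sim\!\beta\in B$; and - if $\neg U(\alpha,\beta)\in A$ and $\beta\in B$, then $\neg\alpha\in C$, and $\neg\beta\in C$ or $\neg U(\alpha,\beta)\in C$, and $\neg\alpha,\neg U(\alpha,\beta)\in B$; - if $U(\alpha,\beta)\in A$ and $\neg\alpha\in B$, then $\alpha\in C$ or $\beta,U(\alpha,\beta)\in C$; and $\beta,U(\alpha,\beta)\in B$; - the mirror images of these two conditions (with $A$ and $C$ exchanged). $(A',B',C')$ and $(A'',B'',C'')$ *compose* iff $C'=A''$, their composition being $(A',B'\cap C'\cap B'',C'')$. This extends to non-empty finite sequences; the composition of a sequence of length one is its member. A finite sequence of mosaics $(A_i,B_i,C_i)_{1\le i\le n}$, $n\ge1$, composing to $m=(A,B,C)$ is a *full decomposition* of $m$ (we say that it *fully decomposes* $m$) iff 1. for all $U(\alpha,\beta)\in A$, either $\beta\in B$ and ($\beta,U(\alpha,\beta)\in C$ or $\alpha\in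 C$), or there is $1\le i<n$ with $\alpha\in C_i$, $\beta\in B_j$ for all $j\le i$, and $\beta\in C_j$ for all $j<i$; 2. the mirror image of 1 holds; 3. for each $\beta\in\mathrm{Cl}\,\phi$ with $\sim\!\beta\notin B$ there is $1\le i<n$ with $\beta\in C_i$. **Tactics.** Write $^\wedge$ for concatenation. For a non-empty sequence $\sigma$ of $\phi$-mosaics, $m$ is fully decomposed by $\mathrm{lead}(\sigma)$ (by $\mathrm{trail}(\sigma)$) iff $\langle m\rangle{}^\wedge\sigma$ (resp. $\sigma^\wedge\langle m\rangle$) is a full decomposition of $m$. Let $s,r\ge0$, let $P_0,\dots,P_s$ be MPC sets, and let $\lambda_1,\dots,\lambda_r$ be non-empty composing sequences of $\phi$-mosaics, $A_i$ being the start of the first and $C_i$ the end of the last mosaic of $\lambda_i$. For a mosaic $o=(A,B,C)$ put $m'=(A,B,P_0)$, $m''=(P_0,B,C)$, $y_i=(P_i,B,P_{i+1})$ for $i<s$, $y_s=(P_s,B,P_0)$, $\mu=\langle y_0,\dots,y_s\rangle$. If $r=0$ let $\lambda$ be the empty sequence; if $r>0$ let $x_0=(P_0,B,A_1)$, $x_i=(C_i,B,A_{i+1})$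 for $0<i<r$, $x_r=(C_r,B,P_0)$ and $\lambda=\langle x_0\rangle^\wedge\lambda_1{}^\wedge\langle x_1\rangle^\wedge\cdots{}^\wedge\lambda_r{}^\wedge\langle x_r\rangle$. Then $o$ is fully decomposed by $\mathrm{shuffle}(\langle P_0,\dots,P_s\rangle,\langle\lambda_1,\dots,\lambda_r\rangle)$ iff $m'$, $m''$, all $y_i$ and all $x_i$ are mosaics and - $\langle m'\rangle^\wedge\lambda^\wedge\mu^\wedge\langle m''\rangle$ fully decomposes $o$; - if $r>0$, $\lambda^\wedge\mu^\wedge\langle x_0\rangle$ fully decomposes $x_0$; - for $0<i<r$, $\langle x_i\rangle^\wedge\lambda_{i+1}{}^\wedge\langle x_{i+1}\rangle^\wedge\cdots{}^\wedge\lambda_r{}^\wedge\langle x_r\rangle^\wedge\mu^\wedge\langle x_0\rangle^\wedge\lambda_1{}^\wedge\langle x_1\rangle^\wedge\cdots{}^\wedge\lambda_i{}^\wedge\langle x_i\rangle$ fully decomposes $x_i$; - if $r>0$, $\langle x_r\rangle^\wedge\mu^\wedge\lambda$ fully decomposes $x_r$; - for $0\le i<s$, $\langle y_i,\dots,y_s\rangle^\wedge\lambda^\wedge\langle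 y_0,\dots,y_i\rangle$ fully decomposes $y_i$; - $\langle y_s\rangle^\wedge\lambda^\wedge\mu$ fully decomposes $y_s$. **Real mosaic systems.** Let $\mathcal S$ be a set of $\phi$-mosaics and $n\ge0$. There are no level $0^-$ members of $\mathcal S$. A mosaic $m\in\mathcal S$ is a *level $n$ member* of $\mathcal S$ iff it is the composition of a sequence of mosaics each of which is a level $n^-$ member or is fully decomposed by some $\mathrm{shuffle}(\langle P_0,\dots,P_s\rangle,\langle\lambda_1,\dots,\lambda_r\rangle)$ with every mosaic in every $\lambda_i$ a level $n^-$ member. A $\phi$-mosaic (not necessarily in $\mathcal S$) is a *level $n^+$ member* (resp. *level $(n+1)^-$ member*) of $\mathcal S$ iff it is the composition of a sequence of mosaics each of which is a level $n$ (resp. level $n^+$) member or is fully decomposed by $\mathrm{lead}(\sigma)$ or $\mathrm{trail}(\sigma)$ with every mosaic in $\sigma$ a level $n$ (resp. level $n^+$) member. $\mathcal S$ is a *real mosaic system* of $\phi$-mosaics iff every $m\in\mathcal S$ is a level $n$ member of $\mathcal S$ for some $n$. $RMS(\psi)$ is the set of all $\psi$-mosaics which belong to some real mosaic system of $\psi$-mosaics.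 **Relativization.** For an atom $q$, define $*_q$ by $*p=p\wedge q$ for atoms $p$, $*\neg\alpha=\neg(*\alpha)\wedge q$, $*(\alpha\wedge\beta)=(*\alpha\wedge *\beta)\wedge q$, $*U(\alpha,\beta)=U(*\alpha,*\beta)\wedge q$, $*S(\alpha,\beta)=S(*\alpha,*\beta)\wedge q$. A $*_q(\phi)$-mosaic $(A,B,C)$ is *$(\phi,q)$-relativized* iff $\neg q\in A$ and no $S(\alpha,\beta)$ is in $A$; $q\in B$ and $\neg *_q(\phi)\notin B$; $\neg q\in C$ and no $U(\alpha,\beta)$ is in $C$. **Theorem.** Let $\phi$ be a formula of $L(U,S)$, let $q$ be an atom not appearing in $\phi$, and let $\psi=*_q(\phi)$ have length $N$. The following are equivalent: 1. $\phi$ is $\mathbb R$-satisfiable; 2. there is a $(\phi,q)$-relativized $\psi$-mosaic which belongs to some real mosaic system of $\psi$-mosaics; 3. there is a $(\phi,q)$-relativized $\psi$-mosaic which is a level $2N$ member of $RMS(\psi)$. -/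

import Mathlib

namespace RTL

/-! ### Formulas of `L(U,S)` and their semantics -/

/-- Formulas of the temporal language with until `U` and since `S`. -/
inductive Formula (Atom : Type*) where
  | atom : Atom → Formula Atom
  | neg : Formula Atom → Formula Atom
  | and : Formula Atom → Formula Atom → Formula Atom
  | U : Formula Atom → Formula Atom → Formula Atom
  | S : Formula Atom → Formula Atom → Formula Atom

namespace Formula

variable {Atom : Type*}

/-- The length of a formula: the number of occurrences of atoms and connectives in it. -/
def length : Formula Atom → ℕ
  | atom _ => 1
  | neg α => α.length + 1
  | and α β => α.length + β.length + 1
  | U α β => α.length + β.length + 1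
  | S α β => α.length + β.length + 1

/-- The set of atoms appearing in a formula. -/
def atoms : Formula Atom → Set Atom
  | atom p => {p}
  | neg α => α.atoms
  | and α β => α.atoms ∪ β.atoms
  | U α β => α.atoms ∪ β.atoms
  | S α β => α.atoms ∪ β.atoms

/-- The set of subformulas of a formula (the formula itself included). -/
def subformulas : Formula Atom → Set (Formula Atom)
  | atom p => {atom p}
  | neg α => {neg α} ∪ α.subformulas
  | and α β => {and α β} ∪ (α.subformulas ∪ β.subformulas)
  | U α β => {U α β} ∪ (α.subformulas ∪ β.subformulas)
  | S α β => {S α β} ∪ (α.subformulas ∪ β.subformulas)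

/-- The closure `Cl φ = {χ, ¬χ | χ a subformula of φ}`. -/
def Cl (φ : Formula Atom) : Set (Formula Atom) :=
  {χ | ∃ α ∈ φ.subformulas, χ = α ∨ χ = neg α}

/-- `∼α`: it is `β` if `α = ¬β`, and `¬α` otherwise. -/
def sim : Formula Atom → Formula Atom
  | neg β => β
  | atom p => neg (atom p)
  | and α β => neg (and α β)
  | U α β => neg (U α β)
  | S α β => neg (S α β)

/-- Truth of a formula at a point of the structure `(T, <, h)`. Until and since are strict. -/
def Sat {T : Type*} [LinearOrder T] (h : Atom → Set T) : T → Formula Atom → Prop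
  | x, atom p => x ∈ h p
  | x, neg α => ¬ Sat h x α
  | x, and α β => Sat h x α ∧ Sat h x β
  | x, U α β => ∃ y, x < y ∧ Sat h y α ∧ ∀ z, x < z → z < y → Sat h z β
  | x, S α β => ∃ y, y < x ∧ Sat h y α ∧ ∀ z, y < z → z < x → Sat h z β

/-- `φ` is true at some point of some structure whose flow of time is the real line. -/
def RealSatisfiable (φ : Formula Atom) : Prop :=
  ∃ (h : Atom → Set ℝ) (x : ℝ), Sat h x φ

/-- The relativizing translation `*_q`. -/
def star (q : Atom) : Formula Atom → Formula Atom
  | atom p => and (atom p) (atom q)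
  | neg α => and (neg (star q α)) (atom q)
  | and α β => and (and (star q α) (star q β)) (atom q)
  | U α β => and (U (star q α) (star q β)) (atom q)
  | S α β => and (S (star q α) (star q β)) (atom q)

/-- The conjunction `α₁ ∧ (α₂ ∧ (⋯ ∧ αₙ))` of the non-empty sequence `α₁, l = α₂, …, αₙ`. -/
def conj : Formula Atom → List (Formula Atom) → Formula Atom
  | α, [] => α
  | α, β :: l => and α (conj β l)

end Formula

/-! ### Classical propositional logic -/

/-- Formulas of classical propositional logic over the set `V` of propositional variables. -/
inductive PropForm (V : Type*) where
  | var : V → PropForm V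
  | neg : PropForm V → PropForm V
  | and : PropForm V → PropForm V → PropForm V

namespace PropForm

variable {V : Type*} {Atom : Type*}

def eval (v : V → Prop) : PropForm V → Prop
  | var p => v p
  | neg a => ¬ eval v a
  | and a b => eval v a ∧ eval v b

def IsTautology (t : PropForm V) : Prop := ∀ v : V → Prop, t.eval v

/-- Substitution of temporal formulas for propositional variables. -/
def subst (f : V → Formula Atom) : PropForm V → Formula Atom
  | var p => f p
  | neg a => .neg (subst f a)
  | and a b => .and (subst f a) (subst f b)

end PropForm

variable {Atom : Type*}

/-- `χ` is a substitution instance of a tautology of classical propositional logic.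
(Any infinite supply of propositional variables gives the same notion; the type
of temporal formulas is used as the supply.) -/
def IsTautologyInstance (χ : Formula Atom) : Prop :=
  ∃ (t : PropForm (Formula Atom)) (f : Formula Atom → Formula Atom),
    t.IsTautology ∧ t.subst f = χ

/-- Propositional consistency: no `¬(α₁ ∧ ⋯ ∧ αₙ)` with all `αᵢ ∈ X` is a substitution
instance of a tautology. -/
def IsPC (X : Set (Formula Atom)) : Prop :=
  ¬ ∃ (α : Formula Atom) (l : List (Formula Atom)),
    α ∈ X ∧ (∀ β ∈ l, β ∈ X) ∧ IsTautologyInstance (.neg (Formula.conj α l))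

/-- Maximally propositionally consistent subsets of `Cl φ`. -/
def IsMPC (φ : Formula Atom) (X : Set (Formula Atom)) : Prop :=
  Maximal (fun Y : Set (Formula Atom) => Y ⊆ φ.Cl ∧ IsPC Y) X

/-! ### Mosaics, compositions and full decompositions -/

/-- Triples `(A, B, C)` of sets of formulas: `A` is the start, `B` the cover, `C` the end. -/
@[ext]
structure Triple (Atom : Type*) where
  start : Set (Formula Atom)
  cover : Set (Formula Atom)
  finish : Set (Formula Atom)

open Formula in
/-- The triple `m` is a `φ`-mosaic. The fields `c1`–`c4` are the four coherency conditions. -/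
structure IsMosaic (φ : Formula Atom) (m : Triple Atom) : Prop where
  start_mpc : IsMPC φ m.start
  finish_mpc : IsMPC φ m.finish
  cover_subset : m.cover ⊆ φ.Cl
  cover_neg : ∀ β ∈ φ.Cl, neg β ∈ φ.Cl → (neg β ∈ m.cover ↔ sim β ∈ m.cover)
  c1 : ∀ α β, neg (U α β) ∈ m.start → β ∈ m.cover →
    (neg α ∈ m.finish ∧ (neg β ∈ m.finish ∨ neg (U α β) ∈ m.finish)) ∧
    (neg α ∈ m.cover ∧ neg (U α β) ∈ m.cover)
  c2 : ∀ α β, U α β ∈ m.start → neg α ∈ m.cover →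
    (α ∈ m.finish ∨ (β ∈ m.finish ∧ U α β ∈ m.finish)) ∧
    (β ∈ m.cover ∧ U α β ∈ m.cover)
  c3 : ∀ α β, neg (S α β) ∈ m.finish → β ∈ m.cover →
    (neg α ∈ m.start ∧ (neg β ∈ m.start ∨ neg (S α β) ∈ m.start)) ∧
    (neg α ∈ m.cover ∧ neg (S α β) ∈ m.cover)
  c4 : ∀ α β, S α β ∈ m.finish → neg α ∈ m.cover →
    (α ∈ m.start ∨ (β ∈ m.start ∧ S α β ∈ m.start)) ∧
    (β ∈ m.cover ∧ S α β ∈ m.cover)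

/-- The composition of two triples (used when `m.finish = m'.start`). -/
def Triple.comp (m m' : Triple Atom) : Triple Atom :=
  ⟨m.start, m.cover ∩ m.finish ∩ m'.cover, m'.finish⟩

/-- The non-empty sequence `l` composes, and its composition is `m`. -/
inductive ComposesTo : List (Triple Atom) → Triple Atom → Prop
  | single (m : Triple Atom) : ComposesTo [m] m
  | cons (m : Triple Atom) (l : List (Triple Atom)) (k : Triple Atom) :
      ComposesTo l k → m.finish = k.start → ComposesTo (m :: l) (m.comp k)

open Formula in
/-- The fullness condition on a decomposition `l` of `m`. Splitting `l` as `l₁ ++ c :: l₂` with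
`l₂` non-empty singles out a non-last member `c` of the sequence, and with `l₁` non-empty a
non-first one. -/
structure IsFull (φ : Formula Atom) (l : List (Triple Atom)) (m : Triple Atom) : Prop where
  until_cured : ∀ α β, U α β ∈ m.start →
    (β ∈ m.cover ∧ ((β ∈ m.finish ∧ U α β ∈ m.finish) ∨ α ∈ m.finish)) ∨
    ∃ l₁ c l₂, l = l₁ ++ c :: l₂ ∧ l₂ ≠ [] ∧ α ∈ c.finish ∧ β ∈ c.cover ∧
      ∀ x ∈ l₁, β ∈ x.cover ∧ β ∈ x.finish
  since_cured : ∀ α β, S α β ∈ m.finish →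
    (β ∈ m.cover ∧ ((β ∈ m.start ∧ S α β ∈ m.start) ∨ α ∈ m.start)) ∨
    ∃ l₁ c l₂, l = l₁ ++ c :: l₂ ∧ l₁ ≠ [] ∧ α ∈ c.start ∧ β ∈ c.cover ∧
      ∀ x ∈ l₂, β ∈ x.cover ∧ β ∈ x.start
  cover_cured : ∀ β ∈ φ.Cl, sim β ∉ m.cover →
    ∃ l₁ c l₂, l = l₁ ++ c :: l₂ ∧ l₂ ≠ [] ∧ β ∈ c.finish

/-- The `φ`-mosaic `m` is fully decomposed by the sequence `l` of `φ`-mosaics. -/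
structure IsFullDecomposition (φ : Formula Atom) (l : List (Triple Atom)) (m : Triple Atom) :
    Prop where
  mosaic : IsMosaic φ m
  mosaics : ∀ x ∈ l, IsMosaic φ x
  composes : ComposesTo l m
  full : IsFull φ l m

/-! ### The tactics lead, trail and shuffle -/

/-- `m` is fully decomposed by the tactic `lead(σ)`. -/
def FullyDecomposedByLead (φ : Formula Atom) (σ : List (Triple Atom)) (m : Triple Atom) : Prop :=
  σ ≠ [] ∧ IsFullDecomposition φ (m :: σ) m

/-- `m` is fully decomposed by the tactic `trail(σ)`. -/
def FullyDecomposedByTrail (φ : Formula Atom) (σ : List (Triple Atom)) (m : Triple Atom) : Prop :=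
  σ ≠ [] ∧ IsFullDecomposition φ (σ ++ [m]) m

/-- The data `(⟨P 0, …, P s⟩, ⟨lam 1, …, lam r⟩)` of a shuffle. Values of `P` at indices above `s`,
and of `lam` at `0` and at indices above `r`, are never used. -/
structure Shuffle (Atom : Type*) where
  s : ℕ
  r : ℕ
  P : ℕ → Set (Formula Atom)
  lam : ℕ → List (Triple Atom)

namespace Shuffle

/-- The start of the first mosaic in a (non-empty) sequence. -/
def firstStart : List (Triple Atom) → Set (Formula Atom)
  | [] => ∅
  | m :: _ => m.start

/-- The end of the last mosaic in a (non-empty) sequence. -/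
def lastFinish : List (Triple Atom) → Set (Formula Atom)
  | [] => ∅
  | [m] => m.finish
  | _ :: m :: l => lastFinish (m :: l)

variable (D : Shuffle Atom) (o : Triple Atom)

/-- `m' = (A, B, P₀)`. -/
def m' : Triple Atom := ⟨o.start, o.cover, D.P 0⟩

/-- `m'' = (P₀, B, C)`. -/
def m'' : Triple Atom := ⟨D.P 0, o.cover, o.finish⟩

/-- `yᵢ = (Pᵢ, B, Pᵢ₊₁)` for `i < s`, and `y_s = (P_s, B, P₀)`. -/
def y (i : ℕ) : Triple Atom := ⟨D.P i, o.cover, if i = D.s then D.P 0 else D.P (i + 1)⟩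

/-- For `r > 0`: `x₀ = (P₀, B, A₁)`, `xᵢ = (Cᵢ, B, Aᵢ₊₁)` for `0 < i < r`, and
`x_r = (C_r, B, P₀)`, where `Aᵢ` is the start of the first and `Cᵢ` the end of the last mosaic
of `lam i`. -/
def x (i : ℕ) : Triple Atom :=
  ⟨if i = 0 then D.P 0 else lastFinish (D.lam i), o.cover,
    if i = D.r then D.P 0 else firstStart (D.lam (i + 1))⟩

/-- The sequence `⟨y_a, …, y_{a+n-1}⟩`. -/
def ySeg (a n : ℕ) : List (Triple Atom) := (List.range' a n).map (D.y o)

/-- The sequence `λ_a ^ ⟨x_a⟩ ^ ⋯ ^ λ_{a+n-1} ^ ⟨x_{a+n-1}⟩`. -/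
def lamSeg (a n : ℕ) : List (Triple Atom) :=
  (List.range' a n).flatMap fun k => D.lam k ++ [D.x o k]

/-- `μ = ⟨y₀, …, y_s⟩`. -/
def mu : List (Triple Atom) := D.ySeg o 0 (D.s + 1)

/-- `λ`, which is empty if `r = 0` and `⟨x₀⟩ ^ λ₁ ^ ⟨x₁⟩ ^ ⋯ ^ λ_r ^ ⟨x_r⟩` if `r > 0`. -/
def lambda : List (Triple Atom) := if D.r = 0 then [] else [D.x o 0] ++ D.lamSeg o 1 D.r

/-- `o` is fully decomposed by the tactic `shuffle(⟨P₀, …, P_s⟩, ⟨λ₁, …, λ_r⟩)`. -/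
structure FullyDecomposes (φ : Formula Atom) : Prop where
  mosaic : IsMosaic φ o
  lam_mosaic : ∀ i, 1 ≤ i → i ≤ D.r → ∀ n ∈ D.lam i, IsMosaic φ n
  lam_composing : ∀ i, 1 ≤ i → i ≤ D.r → ∃ k, ComposesTo (D.lam i) k
  P_mpc : ∀ i ≤ D.s, IsMPC φ (D.P i)
  m'_mosaic : IsMosaic φ (D.m' o)
  m''_mosaic : IsMosaic φ (D.m'' o)
  y_mosaic : ∀ i ≤ D.s, IsMosaic φ (D.y o i)
  x_mosaic : 0 < D.r → ∀ i ≤ D.r, IsMosaic φ (D.x o i)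
  f1 : IsFullDecomposition φ ([D.m' o] ++ D.lambda o ++ D.mu o ++ [D.m'' o]) o
  f2 : 0 < D.r → IsFullDecomposition φ (D.lambda o ++ D.mu o ++ [D.x o 0]) (D.x o 0)
  f3 : ∀ i, 0 < i → i < D.r →
    IsFullDecomposition φ
      ([D.x o i] ++ D.lamSeg o (i + 1) (D.r - i) ++ D.mu o ++ [D.x o 0] ++ D.lamSeg o 1 i)
      (D.x o i)
  f4 : 0 < D.r → IsFullDecomposition φ ([D.x o D.r] ++ D.mu o ++ D.lambda o) (D.x o D.r)
  f5 : ∀ i < D.s,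
    IsFullDecomposition φ (D.ySeg o i (D.s + 1 - i) ++ D.lambda o ++ D.ySeg o 0 (i + 1)) (D.y o i)
  f6 : IsFullDecomposition φ ([D.y o D.s] ++ D.lambda o ++ D.mu o) (D.y o D.s)

end Shuffle

/-! ### Real mosaic systems -/

/-- The compositions of (non-empty) sequences of `φ`-mosaics from `X`. -/
def compositionsFrom (φ : Formula Atom) (X : Set (Triple Atom)) : Set (Triple Atom) :=
  {m | ∃ l : List (Triple Atom), (∀ k ∈ l, IsMosaic φ k ∧ k ∈ X) ∧ ComposesTo l m}

/-- Compositions of sequences of mosaics each of which is in `X` or is fully decomposed by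
`lead(σ)` or `trail(σ)` with every mosaic of `σ` in `X`. -/
def leadTrailStep (φ : Formula Atom) (X : Set (Triple Atom)) : Set (Triple Atom) :=
  compositionsFrom φ (X ∪ {m | ∃ σ : List (Triple Atom), (∀ k ∈ σ, k ∈ X) ∧
    (FullyDecomposedByLead φ σ m ∨ FullyDecomposedByTrail φ σ m)})

/-- Members of `S` that are compositions of sequences of mosaics each of which is in `X` or is
fully decomposed by a shuffle all of whose sequences `λᵢ` consist of mosaics in `X`. -/
def shuffleStep (φ : Formula Atom) (S X : Set (Triple Atom)) : Set (Triple Atom) :=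
  {m | m ∈ S ∧ m ∈ compositionsFrom φ (X ∪ {o | ∃ D : Shuffle Atom, D.FullyDecomposes o φ ∧
    ∀ i, 1 ≤ i → i ≤ D.r → ∀ k ∈ D.lam i, k ∈ X})}

/-- The level `n⁻` members of `S`. There are none for `n = 0`, and the level `(n+1)⁻` members
are obtained from the level `n⁺` members; see `levelMinus_succ`. -/
def levelMinus (φ : Formula Atom) (S : Set (Triple Atom)) : ℕ → Set (Triple Atom)
  | 0 => ∅
  | n + 1 => leadTrailStep φ (leadTrailStep φ (shuffleStep φ S (levelMinus φ S n)))

/-- The level `n` members of `S`. -/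
def level (φ : Formula Atom) (S : Set (Triple Atom)) (n : ℕ) : Set (Triple Atom) :=
  shuffleStep φ S (levelMinus φ S n)

/-- The level `n⁺` members of `S`. -/
def levelPlus (φ : Formula Atom) (S : Set (Triple Atom)) (n : ℕ) : Set (Triple Atom) :=
  leadTrailStep φ (level φ S n)

theorem levelMinus_succ (φ : Formula Atom) (S : Set (Triple Atom)) (n : ℕ) :
    levelMinus φ S (n + 1) = leadTrailStep φ (levelPlus φ S n) := rfl

/-- `S` is a real mosaic system of `φ`-mosaics. -/
structure IsRealMosaicSystem (φ : Formula Atom) (S : Set (Triple Atom)) : Prop where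
  mosaic : ∀ m ∈ S, IsMosaic φ m
  exists_level : ∀ m ∈ S, ∃ n, m ∈ level φ S n

/-- `RMS(ψ)`: the set of all `ψ`-mosaics that appear in some real mosaic system. -/
def RMS (ψ : Formula Atom) : Set (Triple Atom) :=
  {m | ∃ S, IsRealMosaicSystem ψ S ∧ m ∈ S}

open Formula in
/-- The `*_q(φ)`-mosaic `m` is `(φ,q)`-relativized. -/
structure IsRelativized (φ : Formula Atom) (q : Atom) (m : Triple Atom) : Prop where
  mosaic : IsMosaic (star q φ) m
  neg_q_start : neg (atom q) ∈ m.start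
  no_since_start : ∀ α β, S α β ∉ m.start
  q_cover : atom q ∈ m.cover
  neg_star_cover : neg (star q φ) ∉ m.cover
  neg_q_finish : neg (atom q) ∈ m.finish
  no_until_finish : ∀ α β, U α β ∉ m.finish

end RTL

/-!
A mosaic `(A, B, C)` describes a closed interval of a real structure: `A` and `C` are the formulas
true at its ends, and `B` those true at all of its interior points. Composition corresponds to
gluing intervals.

From a real mosaic system to a model. A mosaic is *realizable* if some labelling of a real interval
by maximally consistent sets has the given ends and cover and interprets `U` and `S` correctly
inside (`Realizes`). By induction on levels all members of a level are realizable
(`realizable_of_mem_level`). For the tactic lead, a realization of the sequence `σ` is repeated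
infinitely often towards the start (`realizable_of_lead`), and trail is the mirror image. For a
shuffle, the realizations of the sequences `lam i` replace the points of countable dense subsets of
the line, each of them blown up to an interval, and the sets `P i` label the other points, again
densely (`exists_blowUp`, `exists_dense_colouring`, `realizable_of_shuffle`). Fullness says that
every formula missing from the cover (a *defect* of the cover) fails somewhere in the decomposition.
Hence it fails arbitrarily close to every limit point, and there truth of `U` and `S` is governed by the cover
(`reach_of_recurrent`). A realization of a relativized mosaic on `(-1, 1)` yields a model of `φ`,
because `star q` restricts all evaluations to the points where `q` holds.

From a model to level `2N`. The mosaics of intervals of real structures (`satMosaics`) form a real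
mosaic system, and the mosaic of `[x, y]` has level at most the number `j` of formulas in the closure
that are not in its cover (`mos_mem_level`); the closure has at most `2N` members. Let `X` consist
of the mosaics of a smaller level, which include all mosaics of subintervals with larger covers. A
point is right-bad (left-bad) if all intervals that begin (end) there have the same cover as `[x, y]`.
By compactness, an interval without bad points is a composition of mosaics in `X`. If a
left-bad point is not a limit of bad points from the left, there are infinitely many points before
it between which all of the defects of the cover occur, and by the pigeonhole principle two of them
have the same label. The interval between them is a *loop* all of whose subintervals have mosaics in
`X` (`Loop`). A loop serves as the sequence of a trail that ends at any left-bad point, or of a lead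
that begins at any right-bad point, so one step of lead and trail settles intervals that lack
right-bad or left-bad points, and the interval from the first right-bad to the last left-bad point
if there is a loop. If there is no loop, the bad points form a set without isolated points; it is
perfect, hence uncountable, so it has a point that is a limit from both sides and is therefore bad
on both sides (`exists_bilateral_limit`, `Reduction.exists_rBad_lBad`). The labels of such points,
together with gaps between a left-bad and a right-bad point, are the data of a shuffle
(`Reduction.exists_shuffle`); its conditions hold because any right-bad label, the cover and any
left-bad label form a mosaic (`mixed_isMosaic`, `Shuffle.IsFrame.fullyDecomposes`).
-/

namespace RTL

open Formula

variable {Atom : Type*}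

/-! ### Maximally propositionally consistent sets are truth sets -/

namespace Formula

/-- The Boolean extension of a truth assignment `v`: negations and conjunctions are evaluated,
while atoms and formulas with main connective `U` or `S` are treated as propositional variables. -/
def bval (v : Formula Atom → Prop) : Formula Atom → Prop
  | atom p => v (atom p)
  | neg α => ¬ bval v α
  | and α β => bval v α ∧ bval v β
  | U α β => v (U α β)
  | S α β => v (S α β)

/-- The propositional skeleton of a temporal formula. -/
def skeleton : Formula Atom → PropForm (Formula Atom)
  | atom p => .var (atom p)
  | neg α => .neg (skeleton α)
  | and α β => .and (skeleton α) (skeleton β)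
  | U α β => .var (U α β)
  | S α β => .var (S α β)

theorem skeleton_subst (χ : Formula Atom) : (skeleton χ).subst id = χ := by
  induction χ <;> simp_all [skeleton, PropForm.subst]

theorem skeleton_eval (v : Formula Atom → Prop) (χ : Formula Atom) :
    (skeleton χ).eval v ↔ bval v χ := by
  induction χ <;> simp_all [skeleton, PropForm.eval, bval]

theorem bval_subst (v : Formula Atom → Prop) (f : Formula Atom → Formula Atom)
    (t : PropForm (Formula Atom)) :
    bval v (t.subst f) ↔ t.eval (fun p => bval v (f p)) := by
  induction t <;> simp_all [PropForm.subst, PropForm.eval, bval]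

theorem bval_conj (v : Formula Atom → Prop) (α : Formula Atom) (l : List (Formula Atom)) :
    bval v (conj α l) ↔ bval v α ∧ ∀ β ∈ l, bval v β := by
  induction l generalizing α with
  | nil => simp [conj]
  | cons β l ih => simp [conj, bval, ih]

theorem bval_sim (v : Formula Atom → Prop) (χ : Formula Atom) :
    bval v (sim χ) ↔ ¬ bval v χ := by
  cases χ <;> simp [sim, bval]

theorem bval_sat {T : Type*} [LinearOrder T] (h : Atom → Set T) (x : T) (χ : Formula Atom) :
    bval (Sat h x) χ ↔ Sat h x χ := by
  induction χ <;> simp_all [bval, Sat]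

end Formula

/-- Instances of tautologies are the formulas true under all Boolean assignments: a formula is an
instance of its own skeleton. -/
theorem isTautologyInstance_iff (χ : Formula Atom) :
    IsTautologyInstance χ ↔ ∀ v, bval v χ := by
  constructor
  · rintro ⟨t, f, ht, rfl⟩ v
    exact (bval_subst v f t).2 (ht _)
  · intro hχ
    exact ⟨skeleton χ, id, fun v => (skeleton_eval v χ).2 (hχ v), skeleton_subst χ⟩

theorem IsPC.of_bval {X : Set (Formula Atom)} (v : Formula Atom → Prop)
    (hv : ∀ χ ∈ X, bval v χ) : IsPC X := by
  rintro ⟨α, l, hα, hl, ht⟩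
  exact (isTautologyInstance_iff _).1 ht v
    ((bval_conj v α l).2 ⟨hv _ hα, fun β hβ => hv _ (hl β hβ)⟩)

theorem IsPC.exists_bval {X : Set (Formula Atom)} (hX : X.Finite) (h : IsPC X) :
    ∃ v, ∀ χ ∈ X, bval v χ := by
  rcases X.eq_empty_or_nonempty with rfl | ⟨α, hα⟩
  · exact ⟨fun _ => True, by simp⟩
  · by_contra! hv
    refine h ⟨α, hX.toFinset.toList, hα, by simp, (isTautologyInstance_iff _).2 fun v hc => ?_⟩
    obtain ⟨χ, hχ, hn⟩ := hv v
    exact hn (((bval_conj v α _).1 hc).2 χ (by simpa using hχ))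

/-! ### The closure of a formula -/

namespace Formula

theorem mem_subformulas_self (φ : Formula Atom) : φ ∈ φ.subformulas := by
  cases φ <;> simp [subformulas]

theorem subformulas_finite (φ : Formula Atom) : φ.subformulas.Finite := by
  induction φ <;> simp_all [subformulas]

theorem ncard_subformulas_le (φ : Formula Atom) : φ.subformulas.ncard ≤ φ.length := by
  induction φ with
  | atom p => simp [subformulas, length]
  | neg α ih =>
    have := Set.ncard_union_le {neg α} α.subformulas
    simp only [Set.ncard_singleton] at this
    simp only [subformulas, length]
    omega
  | and α β ha hb =>
    have h1 := Set.ncard_union_le {and α β} (α.subformulas ∪ β.subformulas)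
    have h2 := Set.ncard_union_le α.subformulas β.subformulas
    simp only [Set.ncard_singleton] at h1
    simp only [subformulas, length]
    omega
  | U α β ha hb =>
    have h1 := Set.ncard_union_le {U α β} (α.subformulas ∪ β.subformulas)
    have h2 := Set.ncard_union_le α.subformulas β.subformulas
    simp only [Set.ncard_singleton] at h1
    simp only [subformulas, length]
    omega
  | S α β ha hb =>
    have h1 := Set.ncard_union_le {S α β} (α.subformulas ∪ β.subformulas)
    have h2 := Set.ncard_union_le α.subformulas β.subformulas
    simp only [Set.ncard_singleton] at h1
    simp only [subformulas, length]
    omega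

theorem subformulas_trans {φ χ θ : Formula Atom} (h : χ ∈ φ.subformulas)
    (h' : θ ∈ χ.subformulas) : θ ∈ φ.subformulas := by
  induction φ with
  | atom p =>
    simp only [subformulas, Set.mem_singleton_iff] at h
    subst h; exact h'
  | neg α ih =>
    rcases h with h | h
    · rw [Set.mem_singleton_iff] at h; subst h; exact h'
    · exact Or.inr (ih h)
  | and α β ha hb | U α β ha hb | S α β ha hb =>
    rcases h with h | h | h
    · rw [Set.mem_singleton_iff] at h; subst h; exact h'
    · exact Or.inr (Or.inl (ha h))
    · exact Or.inr (Or.inr (hb h))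

theorem Cl_eq (φ : Formula Atom) : φ.Cl = φ.subformulas ∪ neg '' φ.subformulas := by
  ext χ
  simp only [Cl, Set.mem_ofPred_eq, Set.mem_union, Set.mem_image]
  constructor
  · rintro ⟨α, hα, rfl | rfl⟩
    · exact Or.inl hα
    · exact Or.inr ⟨α, hα, rfl⟩
  · rintro (h | ⟨α, hα, rfl⟩)
    · exact ⟨χ, h, Or.inl rfl⟩
    · exact ⟨α, hα, Or.inr rfl⟩

theorem Cl_finite (φ : Formula Atom) : φ.Cl.Finite := by
  rw [Cl_eq]
  exact φ.subformulas_finite.union (φ.subformulas_finite.image _)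

theorem ncard_Cl_le (φ : Formula Atom) : φ.Cl.ncard ≤ 2 * φ.length := by
  rw [Cl_eq]
  have h1 := Set.ncard_union_le φ.subformulas (neg '' φ.subformulas)
  have h2 := Set.ncard_image_le (f := neg) φ.subformulas_finite
  have h3 := φ.ncard_subformulas_le
  omega

theorem mem_Cl_of_mem_subformulas {φ χ : Formula Atom} (h : χ ∈ φ.subformulas) : χ ∈ φ.Cl :=
  ⟨χ, h, Or.inl rfl⟩

theorem neg_mem_Cl_of_mem_subformulas {φ χ : Formula Atom} (h : χ ∈ φ.subformulas) :
    neg χ ∈ φ.Cl :=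
  ⟨χ, h, Or.inr rfl⟩

theorem neg_mem_Cl_iff {φ χ : Formula Atom} : neg χ ∈ φ.Cl ↔ χ ∈ φ.subformulas := by
  refine ⟨?_, neg_mem_Cl_of_mem_subformulas⟩
  rintro ⟨α, hα, rfl | h⟩
  · exact subformulas_trans hα (Or.inr (mem_subformulas_self _))
  · cases h; exact hα

theorem and_mem_Cl {φ α β : Formula Atom} (h : and α β ∈ φ.Cl) :
    α ∈ φ.subformulas ∧ β ∈ φ.subformulas := by
  obtain ⟨γ, hγ, rfl | h⟩ := h
  · exact ⟨subformulas_trans hγ (Or.inr (Or.inl (mem_subformulas_self _))),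
      subformulas_trans hγ (Or.inr (Or.inr (mem_subformulas_self _)))⟩
  · cases h

/-- A binary temporal operator whose occurrences in a closure behave like those of `U` and `S`.
It allows statements about `U` to be transferred to their mirror images. -/
structure IsTemporal (φ : Formula Atom) (Y : Formula Atom → Formula Atom → Formula Atom) :
    Prop where
  self_mem : ∀ {α β}, Y α β ∈ φ.Cl → Y α β ∈ φ.subformulas
  left_mem : ∀ {α β}, Y α β ∈ φ.Cl → α ∈ φ.subformulas
  right_mem : ∀ {α β}, Y α β ∈ φ.Cl → β ∈ φ.subformulas

theorem isTemporal_U (φ : Formula Atom) : IsTemporal φ U := by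
  refine ⟨fun h => ?_, fun h => ?_, fun h => ?_⟩ <;> obtain ⟨γ, hγ, rfl | h⟩ := h
  · exact hγ
  · cases h
  · exact subformulas_trans hγ (Or.inr (Or.inl (mem_subformulas_self _)))
  · cases h
  · exact subformulas_trans hγ (Or.inr (Or.inr (mem_subformulas_self _)))
  · cases h

theorem isTemporal_S (φ : Formula Atom) : IsTemporal φ S := by
  refine ⟨fun h => ?_, fun h => ?_, fun h => ?_⟩ <;> obtain ⟨γ, hγ, rfl | h⟩ := h
  · exact hγ
  · cases h
  · exact subformulas_trans hγ (Or.inr (Or.inl (mem_subformulas_self _)))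
  · cases h
  · exact subformulas_trans hγ (Or.inr (Or.inr (mem_subformulas_self _)))
  · cases h

theorem sim_mem_Cl {φ χ : Formula Atom} (h : χ ∈ φ.Cl) : sim χ ∈ φ.Cl := by
  obtain ⟨α, hα, rfl | rfl⟩ := h
  · cases χ with
    | neg β =>
      exact mem_Cl_of_mem_subformulas (subformulas_trans hα (Or.inr (mem_subformulas_self _)))
    | atom p | and α β | U α β | S α β => exact neg_mem_Cl_of_mem_subformulas hα
  · exact mem_Cl_of_mem_subformulas hα

end Formula

/-! ### Membership in maximally consistent sets -/

/-- Truth sets of Boolean assignments are maximal, since they contain `sim χ` whenever they do not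
contain `χ`. -/
theorem isMPC_bval (φ : Formula Atom) (v : Formula Atom → Prop) :
    IsMPC φ {χ | χ ∈ φ.Cl ∧ bval v χ} := by
  refine ⟨⟨fun χ h => h.1, IsPC.of_bval v fun χ h => h.2⟩, ?_⟩
  rintro Y ⟨hY, hPC⟩ hle χ hχ
  refine ⟨hY hχ, ?_⟩
  by_contra hn
  obtain ⟨w, hw⟩ := IsPC.exists_bval (φ.Cl_finite.subset hY) hPC
  have h1 : sim χ ∈ Y := hle ⟨sim_mem_Cl (hY hχ), (bval_sim v χ).2 hn⟩
  exact (bval_sim w χ).1 (hw _ h1) (hw _ hχ)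

theorem IsMPC.exists_bval {φ : Formula Atom} {A : Set (Formula Atom)} (hA : IsMPC φ A) :
    ∃ v, ∀ χ, χ ∈ A ↔ χ ∈ φ.Cl ∧ bval v χ := by
  obtain ⟨⟨hs, hPC⟩, hmax⟩ := hA
  obtain ⟨v, hv⟩ := IsPC.exists_bval (φ.Cl_finite.subset hs) hPC
  refine ⟨v, fun χ => ⟨fun h => ⟨hs h, hv χ h⟩, fun h => ?_⟩⟩
  exact hmax (isMPC_bval φ v).1 (fun χ h => ⟨hs h, hv χ h⟩) h

theorem IsMPC.subset_Cl {φ : Formula Atom} {A : Set (Formula Atom)} (hA : IsMPC φ A) :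
    A ⊆ φ.Cl := hA.1.1

theorem IsMPC.neg_mem_iff {φ χ : Formula Atom} {A : Set (Formula Atom)} (hA : IsMPC φ A)
    (hχ : χ ∈ φ.subformulas) : neg χ ∈ A ↔ χ ∉ A := by
  obtain ⟨v, hv⟩ := hA.exists_bval
  simp [hv, bval, neg_mem_Cl_of_mem_subformulas hχ, mem_Cl_of_mem_subformulas hχ]

theorem IsMPC.and_mem_iff {φ α β : Formula Atom} {A : Set (Formula Atom)} (hA : IsMPC φ A)
    (h : and α β ∈ φ.Cl) : and α β ∈ A ↔ α ∈ A ∧ β ∈ A := by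
  obtain ⟨v, hv⟩ := hA.exists_bval
  have h1 := mem_Cl_of_mem_subformulas (and_mem_Cl h).1
  have h2 := mem_Cl_of_mem_subformulas (and_mem_Cl h).2
  simp [hv, bval, h, h1, h2]

/-! ### Coherency of mosaics -/

/-- The coherency conditions that relate the formulas `Y α β` and `¬Y α β` of the set `A` to the
cover `B` and to the set `C` at the other end; `Y` is `U` with `A` the start and `C` the end, or
`S` with `A` the end and `C` the start. -/
structure Coh (Y : Formula Atom → Formula Atom → Formula Atom) (A B C : Set (Formula Atom)) :
    Prop where
  neg_mem : ∀ α β, neg (Y α β) ∈ A → β ∈ B →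
    (neg α ∈ C ∧ (neg β ∈ C ∨ neg (Y α β) ∈ C)) ∧ (neg α ∈ B ∧ neg (Y α β) ∈ B)
  mem : ∀ α β, Y α β ∈ A → neg α ∈ B →
    (α ∈ C ∨ (β ∈ C ∧ Y α β ∈ C)) ∧ (β ∈ B ∧ Y α β ∈ B)

theorem IsMosaic.coh_U {φ : Formula Atom} {m : Triple Atom} (h : IsMosaic φ m) :
    Coh U m.start m.cover m.finish := ⟨h.c1, h.c2⟩

theorem IsMosaic.coh_S {φ : Formula Atom} {m : Triple Atom} (h : IsMosaic φ m) :
    Coh S m.finish m.cover m.start := ⟨h.c3, h.c4⟩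

/-- Coherency to an end at which everything in the cover holds: what is passed on to the cover is
passed on to that end. -/
theorem Coh.of_subset {Y : Formula Atom → Formula Atom → Formula Atom}
    {A B C C' : Set (Formula Atom)} (h : Coh Y A B C) (hB : B ⊆ C') : Coh Y A B C' := by
  refine ⟨fun α β h1 h2 => ?_, fun α β h1 h2 => ?_⟩
  · obtain ⟨-, h3, h4⟩ := h.neg_mem α β h1 h2
    exact ⟨⟨hB h3, Or.inr (hB h4)⟩, h3, h4⟩
  · obtain ⟨-, h3, h4⟩ := h.mem α β h1 h2
    exact ⟨Or.inr ⟨hB h3, hB h4⟩, h3, h4⟩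

theorem Coh.trans {Y : Formula Atom → Formula Atom → Formula Atom}
    {A B C P C' : Set (Formula Atom)} (h : Coh Y A B C) (h' : Coh Y P B C') (hB : B ⊆ P) :
    Coh Y A B C' := by
  refine ⟨fun α β h1 h2 => ?_, fun α β h1 h2 => ?_⟩
  · obtain ⟨-, h3, h4⟩ := h.neg_mem α β h1 h2
    exact ⟨(h'.neg_mem α β (hB h4) h2).1, h3, h4⟩
  · obtain ⟨-, h3, h4⟩ := h.mem α β h1 h2
    exact ⟨(h'.mem α β (hB h4) h2).1, h3, h4⟩

/-! ### Composing sequences -/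

/-- The members of the (possibly empty) sequence match up and lead from `A` to `C`. -/
def IsPath : Set (Formula Atom) → List (Triple Atom) → Set (Formula Atom) → Prop
  | A, [], C => A = C
  | A, m :: l, C => m.start = A ∧ IsPath m.finish l C

theorem isPath_append {A C : Set (Formula Atom)} {l l' : List (Triple Atom)} :
    IsPath A (l ++ l') C ↔ ∃ D, IsPath A l D ∧ IsPath D l' C := by
  induction l generalizing A with
  | nil => simp [IsPath]
  | cons m l ih => simp [IsPath, ih, and_assoc]

theorem IsPath.append {A C D : Set (Formula Atom)} {l l' : List (Triple Atom)}
    (h : IsPath A l D) (h' : IsPath D l' C) : IsPath A (l ++ l') C :=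
  isPath_append.2 ⟨D, h, h'⟩

theorem isPath_singleton {A C : Set (Formula Atom)} {m : Triple Atom} :
    IsPath A [m] C ↔ m.start = A ∧ m.finish = C := by
  simp [IsPath]

theorem IsPath.exists_finish_eq_start {A C : Set (Formula Atom)} {l : List (Triple Atom)}
    (h : IsPath A l C) {x : Triple Atom} (hx : x ∈ l.tail) :
    ∃ c ∈ l.dropLast, c.finish = x.start := by
  induction l generalizing A with
  | nil => simp at hx
  | cons m l ih =>
    cases l with
    | nil => simp at hx
    | cons m' l =>
      obtain ⟨h1, h2⟩ := h
      simp only [List.tail_cons, List.mem_cons] at hx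
      rcases hx with rfl | hx
      · exact ⟨m, by simp, h2.1.symm⟩
      · obtain ⟨c, hc, hc'⟩ := ih h2 (by simpa using hx)
        exact ⟨c, by simp [hc], hc'⟩

/-- The composition of a sequence, described without recursion: its cover consists of the
formulas in all covers and in all the ends of non-last members. -/
theorem composesTo_iff {l : List (Triple Atom)} {m : Triple Atom} :
    ComposesTo l m ↔ l ≠ [] ∧ IsPath m.start l m.finish ∧
      ∀ β, β ∈ m.cover ↔ (∀ c ∈ l, β ∈ c.cover) ∧ ∀ c ∈ l.dropLast, β ∈ c.finish := by
  constructor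
  · intro h
    induction h with
    | single m => simp [IsPath]
    | cons m l k h hk ih =>
      obtain ⟨h1, h2, h3⟩ := ih
      refine ⟨by simp, ⟨rfl, hk ▸ h2⟩, fun β => ?_⟩
      simp only [Triple.comp, Set.mem_inter_iff, h3, List.mem_cons, forall_eq_or_imp,
        List.dropLast_cons_of_ne_nil h1]
      tauto
  · induction l generalizing m with
    | nil => simp
    | cons c l ih =>
      rintro ⟨-, ⟨h1, h2⟩, h3⟩
      by_cases hl : l = []
      · subst hl
        have : m = c := by
          ext β
          · rw [h1]
          · simp [h3]
          · rw [show m.finish = c.finish from h2.symm]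
        subst this
        exact .single m
      · have := ComposesTo.cons c l
          ⟨c.finish, {β | (∀ c ∈ l, β ∈ c.cover) ∧ ∀ c ∈ l.dropLast, β ∈ c.finish}, m.finish⟩
          (ih ⟨hl, h2, fun β => Iff.rfl⟩) rfl
        convert this using 1
        ext β
        · simp [Triple.comp, h1]
        · simp only [h3, Triple.comp, Set.mem_inter_iff, Set.mem_ofPred_eq, List.mem_cons,
            forall_eq_or_imp, List.dropLast_cons_of_ne_nil hl]
          tauto
        · rfl

theorem ComposesTo.append {l l' : List (Triple Atom)} {m m' : Triple Atom}
    (h : ComposesTo l m) (h' : ComposesTo l' m') (hm : m.finish = m'.start) :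
    ComposesTo (l ++ l') (m.comp m') := by
  induction h with
  | single m => exact .cons m l' m' h' hm
  | cons m l k h hk ih =>
    have : (m.comp k).comp m' = m.comp (k.comp m') := by
      ext <;> simp [Triple.comp, and_assoc]
    rw [this]
    exact .cons m _ _ (ih hm) hk

/-- A sequence leading from `A` to `C` one of whose covers is the least possible, namely `B`,
composes to `(A, B, C)`. -/
theorem IsPath.composesTo {A B C : Set (Formula Atom)} {l : List (Triple Atom)}
    (h : IsPath A l C) (hc : ∀ c ∈ l, B ⊆ c.cover) (hf : ∀ c ∈ l.dropLast, B ⊆ c.finish)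
    (hB : ∃ c ∈ l, c.cover = B) : ComposesTo l ⟨A, B, C⟩ := by
  obtain ⟨c, hcl, rfl⟩ := hB
  exact composesTo_iff.2 ⟨List.ne_nil_of_mem hcl, h, fun β =>
    ⟨fun hβ => ⟨fun d hd => hc d hd hβ, fun d hd => hf d hd hβ⟩, fun hβ => hβ.1 c hcl⟩⟩

theorem exists_split_of_mem_dropLast {l : List (Triple Atom)} {c : Triple Atom}
    (hc : c ∈ l.dropLast) : ∃ l₁ l₂, l = l₁ ++ c :: l₂ ∧ l₂ ≠ [] := by
  obtain ⟨a, b, hab⟩ := List.append_of_mem hc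
  have hl : l ≠ [] := by rintro rfl; simp at hc
  refine ⟨a, b ++ [l.getLast hl], ?_, by simp⟩
  conv_lhs => rw [← List.dropLast_append_getLast hl, hab]
  simp

/-- A criterion for full decompositions: apart from directly cured formulas `U α β` and `S α β`,
it is enough that every `β` whose negation is not in the cover occurs at an intermediate point
of the sequence. -/
theorem isFullDecomposition_of_visits {φ : Formula Atom} {l : List (Triple Atom)}
    {m : Triple Atom} (hm : IsMosaic φ m) (hl : ∀ x ∈ l, IsMosaic φ x) (hc : ComposesTo l m)
    (hU : ∀ α β, U α β ∈ m.start → β ∈ m.cover ∨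
      ∃ l₁ c l₂, l = l₁ ++ c :: l₂ ∧ l₂ ≠ [] ∧ α ∈ c.finish ∧ β ∈ c.cover ∧
        ∀ x ∈ l₁, β ∈ x.cover ∧ β ∈ x.finish)
    (hS : ∀ α β, S α β ∈ m.finish → β ∈ m.cover ∨
      ∃ l₁ c l₂, l = l₁ ++ c :: l₂ ∧ l₁ ≠ [] ∧ α ∈ c.start ∧ β ∈ c.cover ∧
        ∀ x ∈ l₂, β ∈ x.cover ∧ β ∈ x.start)
    (hv : ∀ β ∈ φ.Cl, sim β ∉ m.cover → ∃ c ∈ l.dropLast, β ∈ c.finish) :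
    IsFullDecomposition φ l m := by
  obtain ⟨hne, hpath, hcov⟩ := composesTo_iff.1 hc
  refine ⟨hm, hl, hc, ⟨fun α β h => ?_, fun α β h => ?_, fun β hβ hβ' => ?_⟩⟩
  · rcases hU α β h with hB | h'
    · have hα : α ∈ φ.subformulas := (isTemporal_U φ).left_mem (hm.start_mpc.subset_Cl h)
      by_cases hs : sim α ∈ m.cover
      · have := (hm.cover_neg α (mem_Cl_of_mem_subformulas hα)
          (neg_mem_Cl_of_mem_subformulas hα)).2 hs
        exact Or.inl ⟨hB, (hm.c2 α β h this).1.symm⟩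
      · obtain ⟨c, hcl, hcα⟩ := hv α (mem_Cl_of_mem_subformulas hα) hs
        obtain ⟨l₁, l₂, rfl, h2⟩ := exists_split_of_mem_dropLast hcl
        refine Or.inr ⟨l₁, c, l₂, rfl, h2, hcα, ((hcov β).1 hB).1 c (by simp), fun x hx =>
          ⟨((hcov β).1 hB).1 x (by simp [hx]), ((hcov β).1 hB).2 x ?_⟩⟩
        rw [List.dropLast_append_of_ne_nil (by simp)]
        simp [hx]
    · exact Or.inr h'
  · rcases hS α β h with hB | h'
    · have hα : α ∈ φ.subformulas := (isTemporal_S φ).left_mem (hm.finish_mpc.subset_Cl h)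
      by_cases hs : sim α ∈ m.cover
      · have := (hm.cover_neg α (mem_Cl_of_mem_subformulas hα)
          (neg_mem_Cl_of_mem_subformulas hα)).2 hs
        exact Or.inl ⟨hB, (hm.c4 α β h this).1.symm⟩
      · obtain ⟨c, hcl, hcα⟩ := hv α (mem_Cl_of_mem_subformulas hα) hs
        obtain ⟨l₁, l₂, rfl, h2⟩ := exists_split_of_mem_dropLast hcl
        obtain ⟨d, l₃, rfl⟩ := List.exists_cons_of_ne_nil h2
        have hd : d.start = c.finish := by
          obtain ⟨D, -, -, h4⟩ := isPath_append.1 hpath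
          exact h4.1
        refine Or.inr ⟨l₁ ++ [c], d, l₃, by simp, by simp, hd ▸ hcα,
          ((hcov β).1 hB).1 d (by simp), fun x hx => ⟨((hcov β).1 hB).1 x (by simp [hx]), ?_⟩⟩
        obtain ⟨e, he, he'⟩ := hpath.exists_finish_eq_start (x := x) (by
          cases l₁ <;> simp [hx])
        exact he' ▸ ((hcov β).1 hB).2 e he
    · exact Or.inr h'
  · obtain ⟨c, hcl, hcβ⟩ := hv β hβ hβ'
    obtain ⟨l₁, l₂, h1, h2⟩ := exists_split_of_mem_dropLast hcl
    exact ⟨l₁, c, l₂, h1, h2, hcβ⟩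

/-! ### Closure properties of the levels -/

theorem subset_compositionsFrom {φ : Formula Atom} {X : Set (Triple Atom)} {m : Triple Atom}
    (hm : IsMosaic φ m) (h : m ∈ X) : m ∈ compositionsFrom φ X :=
  ⟨[m], by simp [hm, h], .single m⟩

theorem compositionsFrom_mono {φ : Formula Atom} {X Y : Set (Triple Atom)} (h : X ⊆ Y) :
    compositionsFrom φ X ⊆ compositionsFrom φ Y := by
  rintro m ⟨l, hl, hc⟩
  exact ⟨l, fun k hk => ⟨(hl k hk).1, h (hl k hk).2⟩, hc⟩

theorem comp_mem_compositionsFrom {φ : Formula Atom} {X : Set (Triple Atom)} {m m' : Triple Atom}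
    (h : m ∈ compositionsFrom φ X) (h' : m' ∈ compositionsFrom φ X) (hm : m.finish = m'.start) :
    m.comp m' ∈ compositionsFrom φ X := by
  obtain ⟨l, hl, hc⟩ := h
  obtain ⟨l', hl', hc'⟩ := h'
  refine ⟨l ++ l', fun k hk => ?_, hc.append hc' hm⟩
  rcases List.mem_append.1 hk with hk | hk
  exacts [hl k hk, hl' k hk]

theorem ComposesTo.mem_compositionsFrom {φ : Formula Atom} {X : Set (Triple Atom)}
    {l : List (Triple Atom)} {m : Triple Atom} (hc : ComposesTo l m)
    (hl : ∀ k ∈ l, k ∈ compositionsFrom φ X) : m ∈ compositionsFrom φ X := by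
  induction hc with
  | single m => exact hl m (by simp)
  | cons m l k h hk ih =>
    exact comp_mem_compositionsFrom (hl m (by simp)) (ih fun k hk => hl k (by simp [hk])) hk

theorem leadTrailStep_mono {φ : Formula Atom} {X Y : Set (Triple Atom)} (h : X ⊆ Y) :
    leadTrailStep φ X ⊆ leadTrailStep φ Y :=
  compositionsFrom_mono (Set.union_subset_union h (by
    rintro m ⟨σ, h1, h2⟩
    exact ⟨σ, fun k hk => h (h1 k hk), h2⟩))

theorem shuffleStep_mono {φ : Formula Atom} {S S' X Y : Set (Triple Atom)} (hS : S ⊆ S')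
    (h : X ⊆ Y) : shuffleStep φ S X ⊆ shuffleStep φ S' Y := fun _ hm =>
  ⟨hS hm.1, compositionsFrom_mono (Set.union_subset_union h (by
    rintro m ⟨D, h1, h2⟩
    exact ⟨D, h1, fun i h3 h4 k hk => h (h2 i h3 h4 k hk)⟩)) hm.2⟩

theorem levelMinus_mono {φ : Formula Atom} {S S' : Set (Triple Atom)} (hS : S ⊆ S') (n : ℕ) :
    levelMinus φ S n ⊆ levelMinus φ S' n := by
  induction n with
  | zero => exact subset_rfl
  | succ n ih => exact leadTrailStep_mono (leadTrailStep_mono (shuffleStep_mono hS ih))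

theorem level_mono {φ : Formula Atom} {S S' : Set (Triple Atom)} (hS : S ⊆ S') (n : ℕ) :
    level φ S n ⊆ level φ S' n :=
  shuffleStep_mono hS (levelMinus_mono hS n)

/-- Within a set of mosaics, the level `n` members are closed under composition. -/
theorem mem_level_of_compositionsFrom {φ : Formula Atom} {S : Set (Triple Atom)} {n : ℕ}
    {m : Triple Atom} (hS : m ∈ S) (h : m ∈ compositionsFrom φ (level φ S n)) :
    m ∈ level φ S n := by
  obtain ⟨l, hl, hc⟩ := h
  exact ⟨hS, hc.mem_compositionsFrom fun k hk => (hl k hk).2.2⟩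

theorem subset_leadTrailStep {φ : Formula Atom} {X : Set (Triple Atom)} {m : Triple Atom}
    (hm : IsMosaic φ m) (h : m ∈ X) : m ∈ leadTrailStep φ X :=
  subset_compositionsFrom hm (Or.inl h)

/-! ### Realizations of triples on intervals -/

/-- The truth condition of `Y α β` at `z`, evaluated in a labelled interval with right end `b`:
either `Y α β` is cured inside the interval, or it is passed on to `b`. -/
def Reach (Y : Formula Atom → Formula Atom → Formula Atom) (μ : ℝ → Set (Formula Atom))
    (α β : Formula Atom) (z b : ℝ) : Prop :=
  (∃ y, z < y ∧ y ≤ b ∧ α ∈ μ y ∧ ∀ w, z < w → w < y → β ∈ μ w) ∨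
    ((∀ w, z < w → w ≤ b → β ∈ μ w) ∧ Y α β ∈ μ b)

/-- All formulas `Y α β` are correctly interpreted to the right in the labelling `μ` of `[a, b]`. -/
def Fwd (φ : Formula Atom) (Y : Formula Atom → Formula Atom → Formula Atom)
    (μ : ℝ → Set (Formula Atom)) (a b : ℝ) : Prop :=
  ∀ α β, Y α β ∈ φ.Cl → ∀ z, a ≤ z → z < b → (Y α β ∈ μ z ↔ Reach Y μ α β z b)

/-- The labelling `μ` of `[a, b]` by maximally consistent sets realizes the triple `m`. The operator
`Y` is interpreted to the right and `Y'` to the left; the latter is expressed on the reflected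
interval, so that exchanging `Y` and `Y'` amounts to a reflection. -/
structure Realizes (φ : Formula Atom) (Y Y' : Formula Atom → Formula Atom → Formula Atom)
    (μ : ℝ → Set (Formula Atom)) (a b : ℝ) (m : Triple Atom) : Prop where
  lt : a < b
  start : μ a = m.start
  finish : μ b = m.finish
  mpc : ∀ z, a ≤ z → z ≤ b → IsMPC φ (μ z)
  cover : ∀ β, β ∈ m.cover ↔ β ∈ φ.Cl ∧ ∀ z, a < z → z < b → β ∈ μ z
  fwd : Fwd φ Y μ a b
  bwd : Fwd φ Y' (fun t => μ (-t)) (-b) (-a)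

/-- The mirror image of a triple. -/
def Triple.rev (m : Triple Atom) : Triple Atom := ⟨m.finish, m.cover, m.start⟩

section Realizes

variable {φ : Formula Atom} {Y Y' : Formula Atom → Formula Atom → Formula Atom}
  {μ : ℝ → Set (Formula Atom)} {a b c d z : ℝ} {m : Triple Atom}

theorem Realizes.rev (h : Realizes φ Y Y' μ a b m) :
    Realizes φ Y' Y (fun t => μ (-t)) (-b) (-a) m.rev where
  lt := neg_lt_neg h.lt
  start := by simp [h.finish, Triple.rev]
  finish := by simp [h.start, Triple.rev]
  mpc z h1 h2 := h.mpc _ (by linarith) (by linarith)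
  cover β := by
    rw [show m.rev.cover = m.cover from rfl, h.cover]
    refine and_congr_right fun _ => ⟨fun H z h1 h2 => H _ (by linarith) (by linarith),
      fun H z h1 h2 => ?_⟩
    simpa using H (-z) (by linarith) (by linarith)
  fwd := h.bwd
  bwd := by simpa using h.fwd

theorem Fwd.transfer {μ' : ℝ → Set (Formula Atom)} {f : ℝ → ℝ} (h : Fwd φ Y μ a b)
    (hf : StrictMonoOn f (Set.Icc c d)) (hc : f c = a) (hd : f d = b)
    (hs : ∀ y, a ≤ y → y ≤ b → ∃ x, c ≤ x ∧ x ≤ d ∧ f x = y)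
    (hμ : ∀ x, c ≤ x → x ≤ d → μ' x = μ (f x)) : Fwd φ Y μ' c d := by
  intro α β hY z hcz hzd
  have hlt : ∀ {x y}, c ≤ x → x ≤ d → c ≤ y → y ≤ d → (f x < f y ↔ x < y) :=
    fun h1 h2 h3 h4 => hf.lt_iff_lt ⟨h1, h2⟩ ⟨h3, h4⟩
  have hle : ∀ {x y}, c ≤ x → x ≤ d → c ≤ y → y ≤ d → (f x ≤ f y ↔ x ≤ y) :=
    fun h1 h2 h3 h4 => hf.le_iff_le ⟨h1, h2⟩ ⟨h3, h4⟩
  have hcd : c ≤ d := hcz.trans hzd.le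
  have haz : a ≤ f z := hc ▸ (hle le_rfl hcd hcz hzd.le).2 hcz
  rw [hμ z hcz hzd.le, h α β hY (f z) haz
    (hd ▸ (hlt hcz hzd.le hcd le_rfl).2 hzd)]
  unfold Reach
  rw [hμ d hcd le_rfl, hd]
  refine or_congr ⟨?_, ?_⟩ (and_congr_left' ⟨?_, ?_⟩)
  · rintro ⟨y, h1, h2, h3, h4⟩
    obtain ⟨x, hx1, hx2, rfl⟩ := hs y (haz.trans h1.le) h2
    refine ⟨x, (hlt hcz hzd.le hx1 hx2).1 h1, hx2, hμ x hx1 hx2 ▸ h3, fun w hw1 hw2 => ?_⟩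
    have hcw := hcz.trans hw1.le
    have hwd := hw2.le.trans hx2
    rw [hμ w hcw hwd]
    exact h4 _ ((hlt hcz hzd.le hcw hwd).2 hw1) ((hlt hcw hwd hx1 hx2).2 hw2)
  · rintro ⟨y, h1, h2, h3, h4⟩
    have hcy := hcz.trans h1.le
    refine ⟨f y, (hlt hcz hzd.le hcy h2).2 h1, hd ▸ (hle hcy h2 hcd le_rfl).2 h2,
      hμ y hcy h2 ▸ h3, fun w hw1 hw2 => ?_⟩
    obtain ⟨x, hx1, hx2, rfl⟩ := hs w (haz.trans hw1.le)
      (hw2.le.trans (hd ▸ (hle hcy h2 hcd le_rfl).2 h2))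
    rw [← hμ x hx1 hx2]
    exact h4 x ((hlt hcz hzd.le hx1 hx2).1 hw1) ((hlt hx1 hx2 hcy h2).1 hw2)
  · intro H w hw1 hw2
    have hcw := hcz.trans hw1.le
    rw [hμ w hcw hw2]
    exact H _ ((hlt hcz hzd.le hcw hw2).2 hw1) (hd ▸ (hle hcw hw2 hcd le_rfl).2 hw2)
  · intro H w hw1 hw2
    obtain ⟨x, hx1, hx2, rfl⟩ := hs w (haz.trans hw1.le) hw2
    rw [← hμ x hx1 hx2]
    exact H x ((hlt hcz hzd.le hx1 hx2).1 hw1) hx2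

theorem Realizes.transfer {μ' : ℝ → Set (Formula Atom)} {f : ℝ → ℝ}
    (h : Realizes φ Y Y' μ a b m) (hcd : c < d)
    (hf : StrictMonoOn f (Set.Icc c d)) (hc : f c = a) (hd : f d = b)
    (hs : ∀ y, a ≤ y → y ≤ b → ∃ x, c ≤ x ∧ x ≤ d ∧ f x = y)
    (hμ : ∀ x, c ≤ x → x ≤ d → μ' x = μ (f x)) : Realizes φ Y Y' μ' c d m where
  lt := hcd
  start := by rw [hμ c le_rfl hcd.le, hc, h.start]
  finish := by rw [hμ d hcd.le le_rfl, hd, h.finish]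
  mpc z h1 h2 := by
    rw [hμ z h1 h2]
    exact h.mpc _ (hc ▸ hf.monotoneOn ⟨le_rfl, hcd.le⟩ ⟨h1, h2⟩ h1)
      (hd ▸ hf.monotoneOn ⟨h1, h2⟩ ⟨hcd.le, le_rfl⟩ h2)
  cover β := by
    rw [h.cover]
    refine and_congr_right fun _ => ⟨fun H z h1 h2 => ?_, fun H z h1 h2 => ?_⟩
    · rw [hμ z h1.le h2.le]
      exact H _ (hc ▸ hf ⟨le_rfl, hcd.le⟩ ⟨h1.le, h2.le⟩ h1)
        (hd ▸ hf ⟨h1.le, h2.le⟩ ⟨hcd.le, le_rfl⟩ h2)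
    · obtain ⟨x, hx1, hx2, rfl⟩ := hs z h1.le h2.le
      rw [← hμ x hx1 hx2]
      refine H x (lt_of_le_of_ne hx1 ?_) (lt_of_le_of_ne hx2 ?_)
      · rintro rfl; exact h1.ne hc.symm
      · rintro rfl; exact h2.ne hd
  fwd := h.fwd.transfer hf hc hd hs hμ
  bwd := by
    refine h.bwd.transfer (f := fun t => -f (-t)) ?_ (by simp [hd]) (by simp [hc]) ?_ ?_
    · intro x hx y hy hxy
      have := hf ⟨by linarith [hy.2], by linarith [hy.1]⟩ ⟨by linarith [hx.2], by linarith [hx.1]⟩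
        (neg_lt_neg hxy)
      simpa using this
    · intro y h1 h2
      obtain ⟨x, hx1, hx2, hx3⟩ := hs (-y) (by linarith) (by linarith)
      exact ⟨-x, by linarith, by linarith, by simp [hx3]⟩
    · intro x h1 h2
      simpa using hμ (-x) (by linarith) (by linarith)

theorem Realizes.congr {μ' : ℝ → Set (Formula Atom)} (h : Realizes φ Y Y' μ a b m)
    (hμ : ∀ x, a ≤ x → x ≤ b → μ' x = μ x) : Realizes φ Y Y' μ' a b m :=
  h.transfer (f := id) h.lt (strictMono_id.strictMonoOn _) rfl rfl
    (fun y h1 h2 => ⟨y, h1, h2, rfl⟩) hμ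

/-- A realization on `[a, b]`, pulled back to `[c, d]` along an affine map. -/
theorem Realizes.affine (h : Realizes φ Y Y' μ a b m) (hcd : c < d) :
    Realizes φ Y Y' (fun x => μ (a + (x - c) / (d - c) * (b - a))) c d m := by
  have h1 := h.lt
  have h2 : (0 : ℝ) < d - c := sub_pos.2 hcd
  have h3 : (0 : ℝ) < b - a := sub_pos.2 h1
  refine h.transfer (f := fun x => a + (x - c) / (d - c) * (b - a)) hcd ?_ (by simp) ?_ ?_
    fun _ _ _ => rfl
  · intro x _ y _ hxy
    have : (x - c) / (d - c) < (y - c) / (d - c) := by gcongr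
    simp only
    gcongr
  · field_simp; ring
  · intro y hy1 hy2
    refine ⟨c + (y - a) / (b - a) * (d - c), ?_, ?_, ?_⟩
    · have : 0 ≤ (y - a) / (b - a) * (d - c) :=
        mul_nonneg (div_nonneg (by linarith) h3.le) h2.le
      linarith
    · have : (y - a) / (b - a) ≤ 1 := (div_le_one h3).2 (by linarith)
      nlinarith
    · field_simp; ring

theorem reach_glue {α β : Formula Atom} (hzc : z < c) (hcb : c < b)
    (h : Y α β ∈ μ c ↔ Reach Y μ α β c b) : Reach Y μ α β z c ↔ Reach Y μ α β z b := by
  constructor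
  · rintro (⟨y, h1, h2, h3, h4⟩ | ⟨h1, h2⟩)
    · exact Or.inl ⟨y, h1, h2.trans hcb.le, h3, h4⟩
    · rcases h.1 h2 with ⟨y, h3, h4, h5, h6⟩ | ⟨h3, h4⟩
      · refine Or.inl ⟨y, hzc.trans h3, h4, h5, fun w hw1 hw2 => ?_⟩
        rcases le_or_gt w c with hw | hw
        exacts [h1 w hw1 hw, h6 w hw hw2]
      · refine Or.inr ⟨fun w hw1 hw2 => ?_, h4⟩
        rcases le_or_gt w c with hw | hw
        exacts [h1 w hw1 hw, h3 w hw hw2]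
  · rintro (⟨y, h1, h2, h3, h4⟩ | ⟨h1, h2⟩)
    · rcases le_or_gt y c with hy | hy
      · exact Or.inl ⟨y, h1, hy, h3, h4⟩
      · exact Or.inr ⟨fun w hw1 hw2 => h4 w hw1 (hw2.trans_lt hy),
          h.2 (Or.inl ⟨y, hy, h2, h3, fun w hw1 hw2 => h4 w (hzc.trans hw1) hw2⟩)⟩
    · exact Or.inr ⟨fun w hw1 hw2 => h1 w hw1 (hw2.trans hcb.le),
        h.2 (Or.inr ⟨fun w hw1 hw2 => h1 w (hzc.trans hw1) hw2, h2⟩)⟩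

theorem Fwd.glue (h : Fwd φ Y μ a c) (h' : Fwd φ Y μ c b) (hcb : c < b) : Fwd φ Y μ a b := by
  intro α β hY z h1 h2
  rcases lt_or_ge z c with hz | hz
  · rw [h α β hY z h1 hz, reach_glue hz hcb (h' α β hY c le_rfl hcb)]
  · exact h' α β hY z hz h2

theorem Realizes.comp {m' : Triple Atom} (h : Realizes φ Y Y' μ a c m)
    (h' : Realizes φ Y Y' μ c b m') : Realizes φ Y Y' μ a b (m.comp m') where
  lt := h.lt.trans h'.lt
  start := h.start
  finish := h'.finish
  mpc z h1 h2 := by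
    rcases le_or_gt z c with hz | hz
    exacts [h.mpc z h1 hz, h'.mpc z hz.le h2]
  cover β := by
    simp only [Triple.comp, Set.mem_inter_iff, h.cover, h'.cover, ← h.finish]
    constructor
    · rintro ⟨⟨⟨h1, h2⟩, h3⟩, -, h4⟩
      refine ⟨h1, fun z hz1 hz2 => ?_⟩
      rcases lt_trichotomy z c with hz | rfl | hz
      exacts [h2 z hz1 hz, h3, h4 z hz hz2]
    · rintro ⟨h1, h2⟩
      exact ⟨⟨⟨h1, fun z hz1 hz2 => h2 z hz1 (hz2.trans h'.lt)⟩, h2 c h.lt h'.lt⟩, h1,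
        fun z hz1 hz2 => h2 z (h.lt.trans hz1) hz2⟩
  fwd := h.fwd.glue h'.fwd h'.lt
  bwd := h'.bwd.glue h.bwd (neg_lt_neg h.lt)

end Realizes

/-- Some labelling of an interval realizes `m`. -/
def Realizable (φ : Formula Atom) (Y Y' : Formula Atom → Formula Atom → Formula Atom)
    (m : Triple Atom) : Prop :=
  ∃ μ a b, Realizes φ Y Y' μ a b m

theorem Realizable.exists_realizes {φ : Formula Atom}
    {Y Y' : Formula Atom → Formula Atom → Formula Atom} {m : Triple Atom}
    (h : Realizable φ Y Y' m) {a b : ℝ} (hab : a < b) : ∃ μ, Realizes φ Y Y' μ a b m := by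
  obtain ⟨μ, c, d, h⟩ := h
  exact ⟨_, h.affine hab⟩

theorem Realizable.rev {φ : Formula Atom}
    {Y Y' : Formula Atom → Formula Atom → Formula Atom} {m : Triple Atom}
    (h : Realizable φ Y Y' m) : Realizable φ Y' Y m.rev := by
  obtain ⟨μ, c, d, h⟩ := h
  exact ⟨_, _, _, h.rev⟩

theorem Realizable.comp {φ : Formula Atom}
    {Y Y' : Formula Atom → Formula Atom → Formula Atom} {m m' : Triple Atom}
    (h : Realizable φ Y Y' m) (h' : Realizable φ Y Y' m') (hm : m.finish = m'.start) :
    Realizable φ Y Y' (m.comp m') := by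
  obtain ⟨μ, h⟩ := h.exists_realizes (show (0 : ℝ) < 1 by norm_num)
  obtain ⟨μ', h'⟩ := h'.exists_realizes (show (1 : ℝ) < 2 by norm_num)
  refine ⟨fun z => if z ≤ 1 then μ z else μ' z, 0, 2, ?_⟩
  refine (h.congr fun x _ hx => by simp [hx]).comp (h'.congr fun x hx _ => ?_)
  rcases hx.eq_or_lt with rfl | hx
  · simp [h.finish, h'.start, hm]
  · simp [hx]

theorem ComposesTo.realizable {φ : Formula Atom}
    {Y Y' : Formula Atom → Formula Atom → Formula Atom} {l : List (Triple Atom)} {m : Triple Atom}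
    (hc : ComposesTo l m) (h : ∀ k ∈ l, Realizable φ Y Y' k) : Realizable φ Y Y' m := by
  induction hc with
  | single m => exact h m (by simp)
  | cons m l k hl hk ih =>
    exact (h m (by simp)).comp (ih fun k hk => h k (by simp [hk])) hk

/-! ### Truth at limit points and at ends of periods -/

/-- Truth of `Y α β` at a point `z` to the right of which all defects of the cover recur. -/
theorem reach_of_recurrent {φ : Formula Atom} {Y : Formula Atom → Formula Atom → Formula Atom}
    (hT : IsTemporal φ Y) {μ : ℝ → Set (Formula Atom)} {z b : ℝ} {B : Set (Formula Atom)}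
    (hzb : z < b) (hmpc : ∀ w, z ≤ w → w ≤ b → IsMPC φ (μ w)) (hcoh : Coh Y (μ z) B (μ b))
    (hY : ∀ α β, Y α β ∈ μ z → β ∈ B) (hB : ∀ β ∈ B, ∀ w, z < w → w < b → β ∈ μ w)
    (hrec : ∀ β ∈ φ.Cl, β ∉ B → ∀ ε, z < ε → ∃ w, z < w ∧ w < ε ∧ w < b ∧ β ∉ μ w)
    {α β : Formula Atom} (h : Y α β ∈ φ.Cl) : Y α β ∈ μ z ↔ Reach Y μ α β z b := by
  have hα := hT.left_mem h
  have hβ := hT.right_mem h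
  constructor
  · intro hz
    have hβB := hY α β hz
    by_cases hn : neg α ∈ B
    · rcases (hcoh.mem α β hz hn).1 with h1 | ⟨h1, h2⟩
      · exact Or.inl ⟨b, hzb, le_rfl, h1, hB β hβB⟩
      · refine Or.inr ⟨fun w hw1 hw2 => ?_, h2⟩
        rcases hw2.eq_or_lt with rfl | hw2
        exacts [h1, hB β hβB w hw1 hw2]
    · obtain ⟨w, h1, -, h2, h3⟩ := hrec _ (neg_mem_Cl_of_mem_subformulas hα) hn b hzb
      rw [(hmpc w h1.le h2.le).neg_mem_iff hα, not_not] at h3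
      exact Or.inl ⟨w, h1, h2.le, h3, fun v hv1 hv2 => hB β hβB v hv1 (hv2.trans h2)⟩
  · intro hr
    by_contra hz
    rw [← (hmpc z le_rfl hzb.le).neg_mem_iff (hT.self_mem h)] at hz
    by_cases hβB : β ∈ B
    · obtain ⟨⟨h1, h2⟩, h3, -⟩ := hcoh.neg_mem α β hz hβB
      have hb := hmpc b hzb.le le_rfl
      rw [hb.neg_mem_iff hα] at h1
      rw [hb.neg_mem_iff hβ, hb.neg_mem_iff (hT.self_mem h)] at h2
      rcases hr with ⟨y, h4, h5, h6, -⟩ | ⟨h4, h5⟩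
      · rcases h5.eq_or_lt with rfl | h5
        · exact h1 h6
        · exact ((hmpc y h4.le h5.le).neg_mem_iff hα).1 (hB _ h3 y h4 h5) h6
      · rcases h2 with h2 | h2
        exacts [h2 (h4 b hzb le_rfl), h2 h5]
    · rcases hr with ⟨y, h4, h5, h6, h7⟩ | ⟨h4, h5⟩
      · obtain ⟨w, h1, h2, -, h3⟩ := hrec β (mem_Cl_of_mem_subformulas hβ) hβB y h4
        exact h3 (h7 w h1 h2)
      · obtain ⟨w, h1, -, h2, h3⟩ := hrec β (mem_Cl_of_mem_subformulas hβ) hβB b hzb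
        exact h3 (h4 w h1 h2.le)

/-- Truth of `Y α β` at the beginning `z` of a period `[z, c]` that contains all defects of the
cover: if the period decides `Y α β` correctly, then so does the whole interval `[z, b]`. -/
theorem reach_of_period {φ : Formula Atom} {Y : Formula Atom → Formula Atom → Formula Atom}
    (hT : IsTemporal φ Y) {μ : ℝ → Set (Formula Atom)} {z c b : ℝ} {B : Set (Formula Atom)}
    (hzc : z < c) (hcb : c < b) (hmpc : ∀ w, z ≤ w → w ≤ b → IsMPC φ (μ w))
    (hcoh : Coh Y (μ z) B (μ b)) (hB : ∀ β ∈ B, ∀ w, z < w → w < b → β ∈ μ w)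
    (hper : ∀ β ∈ φ.Cl, β ∉ B → ∃ w, z < w ∧ w ≤ c ∧ β ∉ μ w)
    {α β : Formula Atom} (h : Y α β ∈ φ.Cl) (hloc : Y α β ∈ μ z ↔ Reach Y μ α β z c) :
    Y α β ∈ μ z ↔ Reach Y μ α β z b := by
  have hα := hT.left_mem h
  have hβ := hT.right_mem h
  have hzb := hzc.trans hcb
  constructor
  · intro hz
    rcases hloc.1 hz with ⟨y, h1, h2, h3, h4⟩ | ⟨h1, h2⟩
    · exact Or.inl ⟨y, h1, h2.trans hcb.le, h3, h4⟩
    · have hβB : β ∈ B := by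
        by_contra hn
        obtain ⟨w, h3, h4, h5⟩ := hper β (mem_Cl_of_mem_subformulas hβ) hn
        exact h5 (h1 w h3 h4)
      by_cases hn : neg α ∈ B
      · rcases (hcoh.mem α β hz hn).1 with h1 | ⟨h1, h2⟩
        · exact Or.inl ⟨b, hzb, le_rfl, h1, hB β hβB⟩
        · refine Or.inr ⟨fun w hw1 hw2 => ?_, h2⟩
          rcases hw2.eq_or_lt with rfl | hw2
          exacts [h1, hB β hβB w hw1 hw2]
      · obtain ⟨w, h1, h2, h3⟩ := hper _ (neg_mem_Cl_of_mem_subformulas hα) hn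
        rw [(hmpc w h1.le (h2.trans hcb.le)).neg_mem_iff hα, not_not] at h3
        exact Or.inl ⟨w, h1, h2.trans hcb.le, h3,
          fun v hv1 hv2 => hB β hβB v hv1 (hv2.trans_le (h2.trans hcb.le))⟩
  · intro hr
    by_contra hz
    have hz' := hz
    rw [← (hmpc z le_rfl hzb.le).neg_mem_iff (hT.self_mem h)] at hz
    by_cases hβB : β ∈ B
    · obtain ⟨⟨h1, h2⟩, h3, -⟩ := hcoh.neg_mem α β hz hβB
      have hb := hmpc b hzb.le le_rfl
      rw [hb.neg_mem_iff hα] at h1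
      rw [hb.neg_mem_iff hβ, hb.neg_mem_iff (hT.self_mem h)] at h2
      rcases hr with ⟨y, h4, h5, h6, -⟩ | ⟨h4, h5⟩
      · rcases h5.eq_or_lt with rfl | h5
        · exact h1 h6
        · exact ((hmpc y h4.le h5.le).neg_mem_iff hα).1 (hB _ h3 y h4 h5) h6
      · rcases h2 with h2 | h2
        exacts [h2 (h4 b hzb le_rfl), h2 h5]
    · obtain ⟨w, h1, h2, h3⟩ := hper β (mem_Cl_of_mem_subformulas hβ) hβB
      rcases hr with ⟨y, h4, h5, h6, h7⟩ | ⟨h4, h5⟩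
      · rcases le_or_gt y w with hy | hy
        · exact hz' (hloc.2 (Or.inl ⟨y, h4, hy.trans h2, h6, h7⟩))
        · exact h3 (h7 w h1 hy)
      · exact h3 (h4 w h1 (h2.trans hcb.le))

/-! ### Soundness of the tactics lead and trail -/

/-- The labelling that repeats a labelling `ν` of `[0, 1]` on each of the intervals
`[1/(n+2), 1/(n+1)]`, and takes the value `A` at points `x ≤ 0`. The map `x ↦ -1/x` makes all these
intervals have length one. -/
def leadLabel (A : Set (Formula Atom)) (ν : ℝ → Set (Formula Atom)) (x : ℝ) :
    Set (Formula Atom) :=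
  open Classical in if x ≤ 0 then A else ν (Int.fract (-1 / x))

theorem leadLabel_eq {A : Set (Formula Atom)} {ν : ℝ → Set (Formula Atom)} (hν : ν 0 = ν 1)
    (n : ℕ) {x : ℝ} (h1 : 1 / ((n : ℝ) + 2) ≤ x) (h2 : x ≤ 1 / ((n : ℝ) + 1)) :
    leadLabel A ν x = ν (-1 / x + (n + 2)) := by
  have hn : (0 : ℝ) < (n : ℝ) + 2 := by positivity
  have hn' : (0 : ℝ) < (n : ℝ) + 1 := by positivity
  have hx : 0 < x := lt_of_lt_of_le (by positivity) h1
  have h3 : (1 : ℝ) / x ≤ n + 2 := by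
    rw [div_le_iff₀ hx]; rw [div_le_iff₀ hn] at h1; linarith
  rw [leadLabel, if_neg (not_le.2 hx)]
  rcases h2.eq_or_lt with rfl | h2
  · have e1 : (-1 : ℝ) / (1 / ((n : ℝ) + 1)) = ((-(n + 1) : ℤ) : ℝ) := by
      push_cast; field_simp
    rw [e1, Int.fract_intCast, hν]
    congr 1
    push_cast; ring
  · have h4 : (n : ℝ) + 1 < 1 / x := by
      rw [lt_div_iff₀ hx]; rw [lt_div_iff₀ hn'] at h2; linarith
    congr 1
    rw [Int.fract_eq_iff]
    refine ⟨?_, ?_, -(n + 2), ?_⟩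
    · rw [neg_div]; linarith
    · rw [neg_div]; linarith
    · push_cast; ring

theorem exists_period {x : ℝ} (h0 : 0 < x) (h1 : x < 1) :
    ∃ n : ℕ, 1 / ((n : ℝ) + 2) ≤ x ∧ x < 1 / ((n : ℝ) + 1) := by
  have h2 : 1 < 1 / x := by rw [lt_div_iff₀ h0]; linarith
  have h3 := Nat.lt_ceil.1 (show ⌈1 / x⌉₊ - 1 < ⌈1 / x⌉₊ by
    have := Nat.ceil_pos.2 (zero_lt_one.trans h2); omega)
  have h4 : 2 ≤ ⌈1 / x⌉₊ := Nat.succ_le_of_lt (Nat.lt_ceil.2 (by simpa using h2))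
  obtain ⟨n, hn⟩ := Nat.exists_eq_add_of_le h4
  have h5 := Nat.le_ceil (1 / x)
  rw [hn] at h3 h5
  refine ⟨n, ?_, ?_⟩
  · rw [div_le_iff₀ (by positivity)]; rw [div_le_iff₀ h0] at h5; push_cast at h5; linarith
  · rw [lt_div_iff₀ (by positivity)]; rw [lt_div_iff₀ h0] at h3
    rw [show 2 + n - 1 = n + 1 by omega] at h3; push_cast at h3; linarith

theorem one_div_lt_period (n : ℕ) : 1 / ((n : ℝ) + 2) < 1 / ((n : ℝ) + 1) :=
  one_div_lt_one_div_of_lt (by positivity) (by linarith)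

theorem Realizes.period {φ : Formula Atom} {Y Y' : Formula Atom → Formula Atom → Formula Atom}
    {A : Set (Formula Atom)} {ν : ℝ → Set (Formula Atom)} {k : Triple Atom}
    (h : Realizes φ Y Y' ν 0 1 k) (hk : k.start = k.finish) (n : ℕ) :
    Realizes φ Y Y' (leadLabel A ν) (1 / ((n : ℝ) + 2)) (1 / ((n : ℝ) + 1)) k := by
  have hn : (0 : ℝ) < (n : ℝ) + 2 := by positivity
  have hn' : (0 : ℝ) < (n : ℝ) + 1 := by positivity
  refine h.transfer (f := fun x => -1 / x + (n + 2)) (one_div_lt_period n) ?_ ?_ ?_ ?_ ?_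
  · intro x hx y _ hxy
    have hx0 : 0 < x := lt_of_lt_of_le (by positivity) hx.1
    have : 1 / y < 1 / x := one_div_lt_one_div_of_lt hx0 hxy
    simp only [neg_div]
    linarith
  · field_simp; ring
  · field_simp; ring
  · intro y h0 h1
    have hy : (0 : ℝ) < n + 2 - y := by linarith
    refine ⟨1 / (n + 2 - y), ?_, ?_, ?_⟩
    · exact one_div_le_one_div_of_le hy (by linarith)
    · exact one_div_le_one_div_of_le hn' (by linarith)
    · field_simp; ring
  · intro x h1 h2
    exact leadLabel_eq (by rw [h.start, h.finish, hk]) n h1 h2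

/-- A triple that absorbs a realizable triple `k` on its right, and whose cover is the least one
allowed by `k`, is realized by repeating `k` infinitely often towards its start. -/
theorem realizable_of_lead {φ : Formula Atom}
    {Y Y' : Formula Atom → Formula Atom → Formula Atom} (hT : IsTemporal φ Y)
    (hT' : IsTemporal φ Y') {k m : Triple Atom} (hk : Realizable φ Y Y' k)
    (hkk : k.start = k.finish) (hmk : m.finish = k.finish) (hA : IsMPC φ m.start)
    (hcoh : Coh Y m.start m.cover m.finish) (hcoh' : Coh Y' m.finish m.cover m.start)
    (hY : ∀ α β, Y α β ∈ m.start → β ∈ m.cover)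
    (hB : ∀ β, β ∈ m.cover ↔ β ∈ k.finish ∧ β ∈ k.cover) : Realizable φ Y Y' m := by
  obtain ⟨ν, hν⟩ := hk.exists_realizes (show (0 : ℝ) < 1 by norm_num)
  set μ := leadLabel m.start ν with hμdef
  have hper : ∀ n : ℕ, Realizes φ Y Y' μ (1 / ((n : ℝ) + 2)) (1 / ((n : ℝ) + 1)) k :=
    fun n => hν.period hkk n
  have hp0 : ∀ n : ℕ, (0 : ℝ) < 1 / ((n : ℝ) + 2) := fun n => by positivity
  have hp1 : ∀ n : ℕ, 1 / ((n : ℝ) + 1) ≤ 1 := fun n =>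
    (div_le_one (by positivity)).2 (by linarith [n.cast_nonneg (α := ℝ)])
  have hμ0 : μ 0 = m.start := by simp [hμdef, leadLabel]
  have hμ1 : μ 1 = m.finish := by
    have := (hper 0).finish
    simp only [Nat.cast_zero, zero_add, div_one] at this
    rw [this, hmk]
  have hmpc : ∀ z, 0 ≤ z → z ≤ 1 → IsMPC φ (μ z) := by
    intro z h0 h1
    rcases h0.eq_or_lt with rfl | h0
    · rwa [hμ0]
    · rcases h1.eq_or_lt with rfl | h1
      · have := (hper 0).mpc 1 (by norm_num) (by norm_num)
        exact this
      · obtain ⟨n, h2, h3⟩ := exists_period h0 h1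
        exact (hper n).mpc z h2 h3.le
  have hin : ∀ β ∈ m.cover, ∀ z, 0 < z → z < 1 → β ∈ μ z := by
    intro β hβ z h0 h1
    obtain ⟨h4, h5⟩ := (hB β).1 hβ
    obtain ⟨n, h2, h3⟩ := exists_period h0 h1
    rcases h2.eq_or_lt with rfl | h2
    · rw [(hper n).start, hkk]; exact h4
    · exact (((hper n).cover β).1 h5).2 z h2 h3
  -- every defect of the cover occurs in each of the half-open periods, at either choice of the end
  have hout : ∀ β ∈ φ.Cl, β ∉ m.cover → ∀ n : ℕ, (∃ w, 1 / ((n : ℝ) + 2) ≤ w ∧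
      w < 1 / ((n : ℝ) + 1) ∧ β ∉ μ w) := by
    intro β hβ hn n
    rw [hB, not_and_or] at hn
    rcases hn with hn | hn
    · exact ⟨_, le_rfl, one_div_lt_period n, by rwa [(hper n).start, hkk]⟩
    · rw [(hper n).cover] at hn
      push Not at hn
      obtain ⟨w, h1, h2, h3⟩ := hn hβ
      exact ⟨w, h1.le, h2, h3⟩
  have hcov : ∀ β, β ∈ m.cover ↔ β ∈ φ.Cl ∧ ∀ z, 0 < z → z < 1 → β ∈ μ z := by
    intro β
    refine ⟨fun h => ⟨?_, hin β h⟩, fun ⟨h, h'⟩ => ?_⟩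
    · exact (((hper 0).cover β).1 ((hB β).1 h).2).1
    · by_contra hn
      obtain ⟨w, h1, h2, h3⟩ := hout β h hn 0
      exact h3 (h' w ((hp0 0).trans_le h1) (h2.trans_le (hp1 0)))
  refine ⟨μ, 0, 1, zero_lt_one, hμ0, hμ1, hmpc, hcov, ?_, ?_⟩
  · intro α β hYC z h0 h1
    rcases h0.eq_or_lt with rfl | h0
    · refine reach_of_recurrent hT (B := m.cover) zero_lt_one hmpc ?_ ?_ hin ?_ hYC
      · rwa [hμ0, hμ1]
      · rwa [hμ0]
      · intro β hβ hn ε hε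
        obtain ⟨n, hn'⟩ := exists_nat_one_div_lt hε
        obtain ⟨w, h2, h3, h4⟩ := hout β hβ hn n
        exact ⟨w, (hp0 n).trans_le h2, h3.trans hn', h3.trans_le (hp1 n), h4⟩
    -- away from the start, finitely many periods have to be glued together
    · have : ∀ n : ℕ, Fwd φ Y μ (1 / ((n : ℝ) + 2)) 1 := by
        intro n
        induction n with
        | zero => simpa using (hper 0).fwd
        | succ n ih =>
          have := (hper (n + 1)).fwd
          push_cast at this ⊢
          rw [show (n : ℝ) + 1 + 1 = n + 2 by ring] at this
          exact this.glue ih ((one_div_lt_period n).trans_le (hp1 n))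
      obtain ⟨n, h2, h3⟩ := exists_period h0 h1
      exact this n α β hYC z h2 h1
  · intro α β hYC z h1 h0
    have hmpc' : ∀ w, -1 ≤ w → w ≤ -0 → IsMPC φ (μ (-w)) := fun w h1 h2 =>
      hmpc (-w) (by linarith) (by linarith)
    -- leftwards, infinitely many periods follow, but one period decides the truth at its right end
    have hend : ∀ n : ℕ, Y' α β ∈ μ (-(-(1 / ((n : ℝ) + 1)))) ↔
        Reach Y' (fun t => μ (-t)) α β (-(1 / ((n : ℝ) + 1))) (-0) := by
      intro n
      refine reach_of_period hT' (μ := fun t => μ (-t)) (c := -(1 / ((n : ℝ) + 2))) (B := m.cover)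
        (neg_lt_neg (one_div_lt_period n)) (neg_lt_neg (hp0 n))
        (fun w hw1 hw2 => hmpc' w (by linarith [hp1 n]) hw2) ?_ ?_ ?_ hYC ?_
      · rw [neg_neg, (hper n).finish, neg_neg, hμ0, ← hmk]
        exact hcoh'
      · exact fun β hβ w h1 h2 => hin β hβ _ (by linarith) (by linarith [hp1 n])
      · intro β hβ hn
        obtain ⟨w, h2, h3, h4⟩ := hout β hβ hn n
        exact ⟨-w, neg_lt_neg h3, neg_le_neg h2, by rwa [neg_neg]⟩
      · exact (hper n).bwd α β hYC _ le_rfl (neg_lt_neg (one_div_lt_period n))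
    rcases h1.eq_or_lt with rfl | h1
    · simpa using hend 0
    · obtain ⟨n, h2, h3⟩ := exists_period (x := -z) (by linarith) (by linarith)
      rcases h2.eq_or_lt with h2 | h2
      · have := hend (n + 1)
        push_cast at this
        rw [show (n : ℝ) + 1 + 1 = n + 2 by ring, h2] at this
        simpa only [neg_neg] using this
      · rw [(hper n).bwd α β hYC z (by linarith) (by linarith)]
        have := hend (n + 1)
        push_cast at this
        rw [show (n : ℝ) + 1 + 1 = n + 2 by ring] at this
        exact reach_glue (by linarith) (by linarith [hp0 n]) this

/-! ### Consequences of fullness -/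

/-- A formula that is not in the cover fails at an intermediate point of a full decomposition. -/
theorem IsFullDecomposition.exists_notMem {φ : Formula Atom} {l : List (Triple Atom)}
    {m : Triple Atom} (h : IsFullDecomposition φ l m) {β : Formula Atom} (hβ : β ∈ φ.Cl)
    (hn : β ∉ m.cover) : ∃ c ∈ l.dropLast, β ∉ c.finish := by
  have key : ∀ γ ∈ φ.Cl, sim γ ∉ m.cover → ∃ c ∈ l.dropLast, γ ∈ c.finish := by
    intro γ h1 h2
    obtain ⟨l₁, c, l₂, rfl, h3, h4⟩ := h.full.cover_cured γ h1 h2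
    refine ⟨c, ?_, h4⟩
    obtain ⟨d, l₃, rfl⟩ := List.exists_cons_of_ne_nil h3
    rw [List.dropLast_append_of_ne_nil (by simp)]
    simp
  have hmpc : ∀ c ∈ l.dropLast, IsMPC φ c.finish := fun c hc =>
    (h.mosaics c (List.mem_of_mem_dropLast hc)).finish_mpc
  obtain ⟨γ, hγ, rfl | rfl⟩ := hβ
  · obtain ⟨c, hc, h1⟩ := key (neg β) (neg_mem_Cl_of_mem_subformulas hγ) (by simpa [sim] using hn)
    exact ⟨c, hc, ((hmpc c hc).neg_mem_iff hγ).1 h1⟩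
  · obtain ⟨c, hc, h1⟩ := key γ (mem_Cl_of_mem_subformulas hγ) (by
      rwa [← h.mosaic.cover_neg γ (mem_Cl_of_mem_subformulas hγ)
        (neg_mem_Cl_of_mem_subformulas hγ)])
    exact ⟨c, hc, fun h2 => ((hmpc c hc).neg_mem_iff hγ).1 h2 h1⟩

/-- If the first member of a full decomposition has the cover of the whole, then the second
arguments of `U`-formulas in the start are in the cover. -/
theorem IsFullDecomposition.mem_cover_of_until {φ : Formula Atom} {l : List (Triple Atom)}
    {c m : Triple Atom} (h : IsFullDecomposition φ (c :: l) m) (hc : c.cover = m.cover)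
    {α β : Formula Atom} (hU : U α β ∈ m.start) : β ∈ m.cover := by
  rcases h.full.until_cured α β hU with ⟨h1, -⟩ | ⟨l₁, d, l₂, h1, -, -, h2, h3⟩
  · exact h1
  · cases l₁ with
    | nil =>
      simp only [List.nil_append, List.cons.injEq] at h1
      rw [← hc, h1.1]; exact h2
    | cons e l₁ =>
      simp only [List.cons_append, List.cons.injEq] at h1
      rw [← hc, h1.1]; exact (h3 e (by simp)).1

theorem IsFullDecomposition.mem_cover_of_since {φ : Formula Atom} {l : List (Triple Atom)}
    {c m : Triple Atom} (h : IsFullDecomposition φ (l ++ [c]) m) (hc : c.cover = m.cover)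
    {α β : Formula Atom} (hS : S α β ∈ m.finish) : β ∈ m.cover := by
  rcases h.full.since_cured α β hS with ⟨h1, -⟩ | ⟨l₁, d, l₂, h1, -, -, h2, h3⟩
  · exact h1
  · rcases List.eq_nil_or_concat' l₂ with rfl | ⟨l₃, e, rfl⟩
    · have := List.append_inj_right' h1 rfl
      simp only [List.cons.injEq, and_true] at this
      rw [← hc, this]; exact h2
    · rw [show l₁ ++ d :: (l₃ ++ [e]) = (l₁ ++ d :: l₃) ++ [e] by simp] at h1
      have := List.append_inj_right' h1 rfl
      simp only [List.cons.injEq, and_true] at this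
      rw [← hc, this]; exact (h3 e (by simp)).1

theorem FullyDecomposedByLead.realizable {φ : Formula Atom} {σ : List (Triple Atom)}
    {m : Triple Atom} (h : FullyDecomposedByLead φ σ m)
    (hσ : ∀ k ∈ σ, Realizable φ U S k) : Realizable φ U S m := by
  obtain ⟨hne, h⟩ := h
  obtain ⟨-, ⟨-, hpath⟩, hcov⟩ := composesTo_iff.1 h.composes
  -- the sequence that is repeated composes to a triple `k` with equal ends
  set k : Triple Atom := ⟨m.finish, {β | (∀ c ∈ σ, β ∈ c.cover) ∧ ∀ c ∈ σ.dropLast, β ∈ c.finish},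
    m.finish⟩ with hkdef
  have hk : ComposesTo σ k := composesTo_iff.2 ⟨hne, hpath, fun β => Iff.rfl⟩
  have hk' := hk.realizable hσ
  refine realizable_of_lead (isTemporal_U φ) (isTemporal_S φ) hk' rfl rfl h.mosaic.start_mpc
    h.mosaic.coh_U h.mosaic.coh_S (fun α β => h.mem_cover_of_until rfl) fun β => ?_
  constructor
  · intro hβ
    obtain ⟨h1, h2⟩ := (hcov β).1 hβ
    rw [List.dropLast_cons_of_ne_nil hne] at h2
    exact ⟨h2 m (by simp), fun c hc => h1 c (by simp [hc]), fun c hc => h2 c (by simp [hc])⟩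
  · rintro ⟨h1, h2⟩
    by_contra hn
    obtain ⟨c, hc, hc'⟩ := h.exists_notMem (h.mosaic.finish_mpc.subset_Cl h1) hn
    rw [List.dropLast_cons_of_ne_nil hne, List.mem_cons] at hc
    rcases hc with rfl | hc
    exacts [hc' h1, hc' (h2.2 c hc)]

theorem FullyDecomposedByTrail.realizable {φ : Formula Atom} {σ : List (Triple Atom)}
    {m : Triple Atom} (h : FullyDecomposedByTrail φ σ m)
    (hσ : ∀ k ∈ σ, Realizable φ U S k) : Realizable φ U S m := by
  obtain ⟨hne, h⟩ := h
  obtain ⟨-, hpath, hcov⟩ := composesTo_iff.1 h.composes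
  obtain ⟨D, hpath, hD, -⟩ := isPath_append.1 hpath
  subst hD
  set k : Triple Atom := ⟨m.start, {β | (∀ c ∈ σ, β ∈ c.cover) ∧ ∀ c ∈ σ.dropLast, β ∈ c.finish},
    m.start⟩ with hkdef
  have hk : ComposesTo σ k := composesTo_iff.2 ⟨hne, hpath, fun β => Iff.rfl⟩
  have hk' := (hk.realizable hσ).rev
  have hlast : (σ.getLast hne).finish = m.start := by
    have : IsPath m.start (σ.dropLast ++ [σ.getLast hne]) m.start := by
      rwa [List.dropLast_append_getLast]
    obtain ⟨D, -, h2⟩ := isPath_append.1 this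
    exact h2.2
  have hmem : ∀ c ∈ σ, c ∈ σ.dropLast ∨ c = σ.getLast hne := by
    intro c hc
    rw [← List.dropLast_append_getLast hne] at hc
    simpa using hc
  suffices Realizable φ S U m.rev from this.rev
  refine realizable_of_lead (isTemporal_S φ) (isTemporal_U φ) hk' rfl rfl h.mosaic.finish_mpc
    h.mosaic.coh_S h.mosaic.coh_U (fun α β => h.mem_cover_of_since rfl) fun β => ?_
  change β ∈ m.cover ↔ β ∈ m.start ∧ (∀ c ∈ σ, β ∈ c.cover) ∧ ∀ c ∈ σ.dropLast, β ∈ c.finish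
  rw [List.dropLast_append_of_ne_nil (by simp)] at hcov
  simp only [List.dropLast_singleton, List.append_nil] at hcov
  constructor
  · intro hβ
    obtain ⟨h1, h2⟩ := (hcov β).1 hβ
    exact ⟨hlast ▸ h2 _ (List.getLast_mem hne), fun c hc => h1 c (by simp [hc]),
      fun c hc => h2 c (List.mem_of_mem_dropLast hc)⟩
  · rintro ⟨h1, h2⟩
    by_contra hn
    obtain ⟨c, hc, hc'⟩ := h.exists_notMem (h.mosaic.start_mpc.subset_Cl h1) hn
    rw [List.dropLast_append_of_ne_nil (by simp)] at hc
    simp only [List.dropLast_singleton, List.append_nil] at hc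
    rcases hmem c hc with hc | rfl
    exacts [hc' (h2.2 c hc), hc' (hlast ▸ h1)]

/-! ### Collapsing maps of the real line and dense colourings -/

open Filter Topology in
/-- Points of the real line can be blown up to closed intervals: for a summable family `w ≥ 0`
there is a strictly increasing `G` such that the intervals `[G x, G x + w x]` are in the same order
as the points `x` and cover the line. -/
theorem exists_blowUp {w : ℝ → ℝ} (hw0 : ∀ x, 0 ≤ w x) (hw : Summable w) :
    ∃ G : ℝ → ℝ, (∀ x x', x < x' → G x + w x < G x') ∧ ∀ y, ∃ x, G x ≤ y ∧ y ≤ G x + w x := by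
  classical
  -- `G x = x + ∑ w d`, the sum being over all `d < x`
  set T : Set ℝ → ℝ := fun s => ∑' d, s.indicator w d with hT
  have hs : ∀ s : Set ℝ, Summable (s.indicator w) := fun s => hw.indicator s
  have hTmono : ∀ s t : Set ℝ, s ⊆ t → T s ≤ T t := fun s t hst =>
    (hs s).tsum_le_tsum (fun d => Set.indicator_le_indicator_of_subset hst (fun x => hw0 x) d)
      (hs t)
  have hT0 : ∀ s, 0 ≤ T s := fun s => tsum_nonneg fun d => Set.indicator_nonneg (fun x _ => hw0 x) d
  have hlim : ∀ (l : Filter ℝ) (s : Set ℝ), (∀ d, ∀ᶠ x in l, (d < x ↔ d ∈ s)) →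
      Tendsto (fun x => T (Set.Iio x)) l (𝓝 (T s)) := by
    intro l s h
    refine tendsto_tsum_of_dominated_convergence hw (fun d => ?_) (Eventually.of_forall ?_)
    · refine tendsto_const_nhds.congr' ?_
      filter_upwards [h d] with x hx
      simp only [Set.indicator, Set.mem_Iio, hx]
    · intro x d
      rw [Real.norm_of_nonneg (Set.indicator_nonneg (fun x _ => hw0 x) d)]
      exact Set.indicator_le_self' (fun x _ => hw0 x) d
  have hT1 : ∀ x, T (Set.Iic x) = T (Set.Iio x) + w x := by
    intro x
    have h1 : (Set.Iic x).indicator w = fun d => (Set.Iio x).indicator w d +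
        ({x} : Set ℝ).indicator w d := by
      rw [← Set.Iio_union_right, Set.indicator_union_of_disjoint (by simp)]
    have h2 : T {x} = w x := by
      have : T {x} = ({x} : Set ℝ).indicator w x := tsum_eq_single x fun d hd => by simp [hd]
      simpa using this
    rw [← h2]
    simp only [hT]
    rw [h1]
    exact (hs _).tsum_add (hs _)
  refine ⟨fun x => x + T (Set.Iio x), fun x x' hx => ?_, fun y => ?_⟩
  · have := hTmono (Set.Iic x) (Set.Iio x') (fun d hd => lt_of_le_of_lt hd hx)
    rw [hT1] at this
    linarith
  -- `y` is in the interval belonging to the supremum of the `x` with `G x ≤ y`, because `G` has the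
  -- one-sided limits `G x` and `G x + w x` at `x`
  · set E : Set ℝ := {x | x + T (Set.Iio x) ≤ y}
    have hmono : ∀ x x', x ≤ x' → x + T (Set.Iio x) ≤ x' + T (Set.Iio x') := fun x x' h =>
      add_le_add h (hTmono _ _ (Set.Iio_subset_Iio h))
    have hne : E.Nonempty := by
      refine ⟨y - T Set.univ, ?_⟩
      have := hTmono (Set.Iio (y - T Set.univ)) _ (Set.subset_univ _)
      change _ ≤ y
      linarith
    have hbdd : BddAbove E := ⟨y, fun x hx => by
      have h1 : x + T (Set.Iio x) ≤ y := hx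
      have := hT0 (Set.Iio x)
      linarith⟩
    refine ⟨sSup E, ?_, ?_⟩
    · have hl : Tendsto (fun x => x + T (Set.Iio x)) (𝓝[<] (sSup E))
          (𝓝 (sSup E + T (Set.Iio (sSup E)))) := by
        refine (tendsto_nhdsWithin_of_tendsto_nhds tendsto_id).add (hlim _ _ fun d => ?_)
        by_cases hd : d < sSup E
        · filter_upwards [mem_nhdsWithin_of_mem_nhds (lt_mem_nhds hd)] with x hx
          simp [hd, hx]
        · filter_upwards [self_mem_nhdsWithin] with x hx
          have : ¬ d < x := fun h => hd (h.trans hx)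
          simp [hd, this]
      refine le_of_tendsto hl ?_
      filter_upwards [self_mem_nhdsWithin] with x hx
      obtain ⟨x', hx', hxx⟩ := exists_lt_of_lt_csSup hne hx
      exact (hmono x x' hxx.le).trans hx'
    · have hl : Tendsto (fun x => x + T (Set.Iio x)) (𝓝[>] (sSup E))
          (𝓝 (sSup E + T (Set.Iic (sSup E)))) := by
        refine (tendsto_nhdsWithin_of_tendsto_nhds tendsto_id).add (hlim _ _ fun d => ?_)
        by_cases hd : d ≤ sSup E
        · filter_upwards [self_mem_nhdsWithin] with x hx
          have : d < x := lt_of_le_of_lt hd hx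
          simp [hd, this]
        · filter_upwards [mem_nhdsWithin_of_mem_nhds (gt_mem_nhds (not_le.1 hd))] with x hx
          simp [hd, hx.le]
      rw [hT1, ← add_assoc] at hl
      refine ge_of_tendsto hl ?_
      filter_upwards [self_mem_nhdsWithin] with x hx
      by_contra h
      exact (not_le.2 hx) (le_csSup hbdd (not_le.1 h).le)

/-- The real line has a colouring with countably many dense colour classes all of which, except
for one, are countable. The classes are the translates `i√2 + ℚ`. -/
theorem exists_dense_colouring : ∃ col : ℝ → ℕ,
    (∀ i a b, a < b → ∃ x, a < x ∧ x < b ∧ col x = i) ∧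
      ∀ i, i ≠ 0 → {x | col x = i}.Countable := by
  classical
  have huniq : ∀ (i j : ℕ) (p r : ℚ), (i : ℝ) * √2 + p = j * √2 + r → i = j := by
    intro i j p r h
    by_contra hij
    have hij' : (i : ℝ) - j ≠ 0 := sub_ne_zero.2 (by exact_mod_cast hij)
    refine irrational_sqrt_two ⟨(r - p) / (i - j), ?_⟩
    push_cast
    rw [div_eq_iff hij']
    linarith
  set col : ℝ → ℕ := fun x =>
    if h : ∃ i : ℕ, ∃ r : ℚ, x = i * √2 + r then h.choose else 0 with hcol
  have hval : ∀ (i : ℕ) (r : ℚ), col (i * √2 + r) = i := by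
    intro i r
    have h : ∃ j : ℕ, ∃ p : ℚ, (i : ℝ) * √2 + r = j * √2 + p := ⟨i, r, rfl⟩
    obtain ⟨p, hp⟩ := h.choose_spec
    simp only [hcol, dif_pos h]
    exact (huniq _ _ _ _ hp).symm
  refine ⟨col, fun i a b hab => ?_, fun i hi => ?_⟩
  · obtain ⟨r, h1, h2⟩ := exists_rat_btwn (show a - i * √2 < b - i * √2 by linarith)
    exact ⟨i * √2 + r, by linarith, by linarith, hval i r⟩
  · refine (Set.countable_range fun r : ℚ => (i : ℝ) * √2 + r).mono fun x hx => ?_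
    have hx' : col x = i := hx
    by_cases h : ∃ j : ℕ, ∃ p : ℚ, x = j * √2 + p
    · obtain ⟨j, p, rfl⟩ := h
      rw [hval] at hx'
      exact ⟨p, by rw [hx']⟩
    · simp only [hcol, dif_neg h] at hx'
      exact absurd hx'.symm hi

/-! ### Soundness of the tactic shuffle -/

/-- If everything not in `B` recurs to the right of each point satisfying `Q`, and from every other
point a correctly labelled interval leads to such a point, then the whole labelling is correct. -/
theorem fwd_of_recurrent {φ : Formula Atom} {Y : Formula Atom → Formula Atom → Formula Atom}
    (hT : IsTemporal φ Y) {μ : ℝ → Set (Formula Atom)} {a b : ℝ} {B : Set (Formula Atom)}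
    (hmpc : ∀ w, a ≤ w → w ≤ b → IsMPC φ (μ w))
    (hB : ∀ β ∈ B, ∀ w, a < w → w < b → β ∈ μ w) (Q : ℝ → Prop)
    (hQ : ∀ z, a ≤ z → z < b → Q z → Coh Y (μ z) B (μ b) ∧ (∀ α β, Y α β ∈ μ z → β ∈ B) ∧
      ∀ β ∈ φ.Cl, β ∉ B → ∀ ε, z < ε → ε ≤ b → ∃ w, z < w ∧ w < ε ∧ β ∉ μ w)
    (hz : ∀ z, a ≤ z → z < b → Q z ∨ ∃ c, z < c ∧ c < b ∧ Q c ∧ Fwd φ Y μ z c) :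
    Fwd φ Y μ a b := by
  have key : ∀ α β, Y α β ∈ φ.Cl → ∀ z, a ≤ z → z < b → Q z →
      (Y α β ∈ μ z ↔ Reach Y μ α β z b) := by
    intro α β hYC z h1 h2 h3
    obtain ⟨h4, h5, h6⟩ := hQ z h1 h2 h3
    refine reach_of_recurrent hT h2 (fun w hw => hmpc w (h1.trans hw)) h4 h5
      (fun β hβ w hw => hB β hβ w (h1.trans_lt hw)) (fun β hβ hn ε hε => ?_) hYC
    obtain ⟨w, hw1, hw2, hw3⟩ := h6 β hβ hn (min ε b) (lt_min hε h2) (min_le_right _ _)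
    exact ⟨w, hw1, hw2.trans_le (min_le_left _ _), hw2.trans_le (min_le_right _ _), hw3⟩
  intro α β hYC z h1 h2
  rcases hz z h1 h2 with h3 | ⟨c, h3, h4, h5, h6⟩
  · exact key α β hYC z h1 h2 h3
  · rw [h6 α β hYC z le_rfl h3]
    exact reach_glue h3 h4 (key α β hYC c (h1.trans h3.le) h4 h5)

/-- A triple `o` is realized by a dense mixture of points labelled `P 0, …, P s` and intervals that
realize `k 1, …, k r`, provided that the labels of points that are limits from the right
satisfy `hR`, and those of points that are limits from the left the mirror image `hL`. -/
theorem realizable_of_shuffle {φ : Formula Atom}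
    {Y Y' : Formula Atom → Formula Atom → Formula Atom} (hT : IsTemporal φ Y)
    (hT' : IsTemporal φ Y') {o : Triple Atom} {s r : ℕ} {P : ℕ → Set (Formula Atom)}
    {k : ℕ → Triple Atom} (hA : IsMPC φ o.start) (hC : IsMPC φ o.finish)
    (hP : ∀ i ≤ s, IsMPC φ (P i)) (hk : ∀ i, 1 ≤ i → i ≤ r → Realizable φ Y Y' (k i))
    (hR : ∀ R, (R = o.start ∨ (∃ i ≤ s, R = P i) ∨ ∃ i, 1 ≤ i ∧ i ≤ r ∧ R = (k i).finish) →
      Coh Y R o.cover o.finish ∧ ∀ α β, Y α β ∈ R → β ∈ o.cover)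
    (hL : ∀ L, (L = o.finish ∨ (∃ i ≤ s, L = P i) ∨ ∃ i, 1 ≤ i ∧ i ≤ r ∧ L = (k i).start) →
      Coh Y' L o.cover o.start ∧ ∀ α β, Y' α β ∈ L → β ∈ o.cover)
    (hB : ∀ β, β ∈ o.cover ↔ β ∈ φ.Cl ∧ (∀ i ≤ s, β ∈ P i) ∧
      ∀ i, 1 ≤ i → i ≤ r → β ∈ (k i).start ∧ β ∈ (k i).cover ∧ β ∈ (k i).finish) :
    Realizable φ Y Y' o := by
  classical
  have hν : ∀ i, ∃ ν, 1 ≤ i → i ≤ r → Realizes φ Y Y' ν 0 1 (k i) := by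
    intro i
    by_cases h : 1 ≤ i ∧ i ≤ r
    · obtain ⟨ν, hν⟩ := (hk i h.1 h.2).exists_realizes (show (0 : ℝ) < 1 by norm_num)
      exact ⟨ν, fun _ _ => hν⟩
    · exact ⟨fun _ => ∅, fun h1 h2 => absurd ⟨h1, h2⟩ h⟩
  choose ν hν using hν
  obtain ⟨col, hcol, hcount⟩ := exists_dense_colouring
  -- the points of `(0, 1)` with colours in `s + 1, …, s + r` are blown up to intervals
  set Λ : Set ℝ := {x | 0 < x ∧ x < 1 ∧ s < col x ∧ col x ≤ s + r} with hΛ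
  have hΛc : Λ.Countable := by
    refine (Set.Countable.biUnion (Set.finite_Icc (s + 1) (s + r)).countable
      (fun i hi => hcount i (by have := hi.1; omega))).mono fun x hx => ?_
    simp only [Set.mem_iUnion]
    exact ⟨col x, ⟨hx.2.2.1, hx.2.2.2⟩, rfl⟩
  obtain ⟨ε, hε, c, hc, -⟩ := hΛc.exists_pos_hasSum_le one_pos
  set w : ℝ → ℝ := Λ.indicator ε with hw
  have hw0 : ∀ x, 0 ≤ w x := fun x => Set.indicator_nonneg (fun x _ => (hε x).le) x
  have hwpos : ∀ x ∈ Λ, 0 < w x := fun x hx => by simp [hw, hx, hε x]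
  have hwz : ∀ x, x ∉ Λ → w x = 0 := fun x hx => by simp [hw, hx]
  obtain ⟨G, hG, hGy⟩ := exists_blowUp hw0 (summable_subtype_iff_indicator.1 hc.summable)
  choose F hF1 hF2 using hGy
  have hFmono : ∀ {y y'}, y ≤ y' → F y ≤ F y' := by
    intro y y' h
    by_contra hlt
    have := hG _ _ (not_le.1 hlt)
    linarith [hF1 y, hF2 y']
  have hFu : ∀ x y, G x ≤ y → y ≤ G x + w x → F y = x := by
    intro x y h1 h2
    rcases lt_trichotomy (F y) x with h | h | h
    · have := hG _ _ h
      linarith [hF1 y, hF2 y]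
    · exact h
    · have := hG _ _ h
      linarith [hF1 y, hF2 y]
  have hGlt : ∀ {x x'}, x < x' → G x < G x' := fun {x x'} h =>
    lt_of_le_of_lt (le_add_of_nonneg_right (hw0 x)) (hG x x' h)
  have h0Λ : (0 : ℝ) ∉ Λ := fun h => lt_irrefl _ h.1
  have h1Λ : (1 : ℝ) ∉ Λ := fun h => lt_irrefl _ h.2.1
  have hFG : ∀ x, F (G x) = x := fun x => hFu x _ le_rfl (le_add_of_nonneg_right (hw0 x))
  have hFpos : ∀ z, G 0 < z → 0 < F z := by
    intro z hz
    refine lt_of_le_of_ne (hFG 0 ▸ hFmono hz.le) fun h => ?_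
    have := hF2 z
    rw [← h, hwz 0 h0Λ] at this
    linarith
  have hFlt : ∀ z, z < G 1 → F z < 1 := by
    intro z hz
    refine lt_of_le_of_ne (hFG 1 ▸ hFmono hz.le) fun h => ?_
    have := hF1 z
    rw [h] at this
    linarith
  have hFeq : ∀ z, F z ∉ Λ → z = G (F z) := by
    intro z hz
    have := hF2 z
    rw [hwz _ hz] at this
    linarith [hF1 z]
  -- `F` collapses the interval of `x` to `x`; all points of `(0, 1)` whose colour is not used get the
  -- label `P 0`
  set μ : ℝ → Set (Formula Atom) := fun y =>
    if F y ≤ 0 then o.start else if 1 ≤ F y then o.finish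
    else if F y ∈ Λ then ν (col (F y) - s) ((y - G (F y)) / w (F y))
    else if col (F y) ≤ s then P (col (F y)) else P 0 with hμ
  have hμ0 : μ (G 0) = o.start := by simp [hμ, hFG]
  have hμ1 : μ (G 1) = o.finish := by simp [hμ, hFG]
  have hfib : ∀ x ∈ Λ, Realizes φ Y Y' μ (G x) (G x + w x) (k (col x - s)) := by
    intro x hx
    have h1 := hν (col x - s) (by have := hx.2.2; omega) (by have := hx.2.2; omega)
    refine (h1.affine (show G x < G x + w x by linarith [hwpos x hx])).congr fun y hy1 hy2 => ?_
    have hFy := hFu x y hy1 hy2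
    simp only [hμ, hFy, if_neg (not_le.2 hx.1), if_neg (not_le.2 hx.2.1), if_pos hx]
    congr 1
    simp
  have hcolΛ : ∀ x ∈ Λ, 1 ≤ col x - s ∧ col x - s ≤ r := fun x hx => by
    have := hx.2.2; omega
  have hpt : ∀ x, 0 < x → x < 1 → x ∉ Λ → ∃ i ≤ s, μ (G x) = P i ∧ (col x ≤ s → i = col x) := by
    intro x h0 h1 hx
    by_cases hs : col x ≤ s
    · exact ⟨col x, hs, by simp [hμ, hFG, not_le.2 h0, not_le.2 h1, hx, hs], fun _ => rfl⟩
    · exact ⟨0, by omega, by simp [hμ, hFG, not_le.2 h0, not_le.2 h1, hx, hs],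
        fun h => absurd h hs⟩
  have h01 : G 0 < G 1 := hGlt one_pos
  have hmpc : ∀ z, G 0 ≤ z → z ≤ G 1 → IsMPC φ (μ z) := by
    intro z h0 h1
    rcases h0.eq_or_lt with rfl | h0
    · rwa [hμ0]
    rcases h1.eq_or_lt with rfl | h1
    · rwa [hμ1]
    by_cases hx : F z ∈ Λ
    · exact (hfib _ hx).mpc z (hF1 z) (hF2 z)
    · obtain ⟨i, hi, h2, -⟩ := hpt _ (hFpos z h0) (hFlt z h1) hx
      rw [hFeq z hx, h2]
      exact hP i hi
  have hin : ∀ β ∈ o.cover, ∀ z, G 0 < z → z < G 1 → β ∈ μ z := by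
    intro β hβ z h0 h1
    obtain ⟨-, h2, h3⟩ := (hB β).1 hβ
    by_cases hx : F z ∈ Λ
    · obtain ⟨h4, h5, h6⟩ := h3 _ (hcolΛ _ hx).1 (hcolΛ _ hx).2
      have hr := hfib _ hx
      rcases (hF1 z).eq_or_lt with h7 | h7
      · rw [← h7, hr.start]; exact h4
      rcases (hF2 z).eq_or_lt with h8 | h8
      · rw [h8, hr.finish]; exact h6
      · exact ((hr.cover β).1 h5).2 z h7 h8
    · obtain ⟨i, hi, h4, -⟩ := hpt _ (hFpos z h0) (hFlt z h1) hx
      rw [hFeq z hx, h4]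
      exact h2 i hi
  -- every defect of the cover occurs at all points of some colour, hence densely
  have hdef : ∀ β ∈ φ.Cl, β ∉ o.cover → ∃ i, ∀ x, 0 < x → x < 1 → col x = i →
      ∃ y, G x ≤ y ∧ y ≤ G x + w x ∧ β ∉ μ y := by
    intro β hβ hn
    rw [hB] at hn
    push Not at hn
    by_cases hi : ∃ i ≤ s, β ∉ P i
    · obtain ⟨i, hi, hi'⟩ := hi
      refine ⟨i, fun x h0 h1 hx => ⟨G x, le_rfl, le_add_of_nonneg_right (hw0 x), ?_⟩⟩
      obtain ⟨j, -, h2, h3⟩ := hpt x h0 h1 (fun h => by have := h.2.2; omega)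
      rwa [h2, h3 (by omega), hx]
    · push Not at hi
      obtain ⟨i, h1, h2, h3⟩ := hn hβ hi
      refine ⟨s + i, fun x h4 h5 hx => ?_⟩
      have hxΛ : x ∈ Λ := ⟨h4, h5, by omega, by omega⟩
      have hr := hfib x hxΛ
      rw [hx, Nat.add_sub_cancel_left] at hr
      by_cases hs : β ∈ (k i).start
      · by_cases hc : β ∈ (k i).cover
        · exact ⟨_, hr.lt.le, le_rfl, by rw [hr.finish]; exact h3 hs hc⟩
        · rw [hr.cover] at hc
          push Not at hc
          obtain ⟨y, h6, h7, h8⟩ := hc hβ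
          exact ⟨y, h6.le, h7.le, h8⟩
      · exact ⟨_, le_rfl, hr.lt.le, by rwa [hr.start]⟩
  have hrec : ∀ β ∈ φ.Cl, β ∉ o.cover → ∀ y y', 0 ≤ F y → F y' ≤ 1 → F y < F y' →
      ∃ v, y < v ∧ v < y' ∧ β ∉ μ v := by
    intro β hβ hn y y' h0 h1 hlt
    obtain ⟨i, hi⟩ := hdef β hβ hn
    obtain ⟨x, h2, h3, h4⟩ := hcol i _ _ hlt
    obtain ⟨v, h5, h6, h7⟩ := hi x (h0.trans_lt h2) (h3.trans_le h1) h4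
    exact ⟨v, by linarith [hF2 y, hG _ _ h2], by linarith [hF1 y', hG _ _ h3], h7⟩
  have hcov : ∀ β, β ∈ o.cover ↔ β ∈ φ.Cl ∧ ∀ z, G 0 < z → z < G 1 → β ∈ μ z := by
    intro β
    refine ⟨fun h => ⟨((hB β).1 h).1, hin β h⟩, fun ⟨h, h'⟩ => ?_⟩
    by_contra hn
    obtain ⟨v, h1, h2, h3⟩ := hrec β h hn (G 0) (G 1) (hFG 0).ge (hFG 1).le
      (by rw [hFG, hFG]; exact one_pos)
    exact h3 (h' v h1 h2)
  refine ⟨μ, G 0, G 1, h01, hμ0, hμ1, hmpc, hcov, ?_, ?_⟩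
  -- limits from the right are the right ends of the collapsed intervals
  · refine fwd_of_recurrent hT hmpc hin (fun z => z = G (F z) + w (F z)) ?_ ?_
    · intro z h0 h1 hz
      rw [hμ1]
      refine (and_assoc.1 ⟨hR _ ?_, fun β hβ hn ε' hε1 hε2 => ?_⟩)
      · rcases h0.eq_or_lt with rfl | h0
        · exact Or.inl hμ0
        · by_cases hx : F z ∈ Λ
          · refine Or.inr (Or.inr ⟨_, (hcolΛ _ hx).1, (hcolΛ _ hx).2, ?_⟩)
            rw [← (hfib _ hx).finish, ← hz]
          · obtain ⟨i, hi, h2, -⟩ := hpt _ (hFpos z h0) (hFlt z h1) hx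
            exact Or.inr (Or.inl ⟨i, hi, by rw [← h2, ← hFeq z hx]⟩)
      · refine hrec β hβ hn z ε' (hFG 0 ▸ hFmono h0) (hFG 1 ▸ hFmono hε2)
          (lt_of_le_of_ne (hFmono hε1.le) fun h => ?_)
        have := hF2 ε'
        rw [← h] at this
        linarith
    · intro z h0 h1
      by_cases hx : F z ∈ Λ
      · rcases (hF2 z).eq_or_lt with h2 | h2
        · exact Or.inl h2
        · have h3 : F (G (F z) + w (F z)) = F z := hFu _ _ (hfib _ hx).lt.le le_rfl
          refine Or.inr ⟨_, h2, hG _ _ hx.2.1, by rw [h3], fun α β hY v hv1 hv2 => ?_⟩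
          exact (hfib _ hx).fwd α β hY v ((hF1 z).trans hv1) hv2
      · refine Or.inl ?_
        rw [hwz _ hx, add_zero]
        exact hFeq z hx
  · refine fwd_of_recurrent hT' (μ := fun t => μ (-t)) (B := o.cover)
      (fun v h1 h2 => hmpc _ (by linarith) (by linarith))
      (fun β hβ v h1 h2 => hin β hβ _ (by linarith) (by linarith))
      (fun z => -z = G (F (-z))) ?_ ?_
    · intro z h0 h1 hz
      have h0' : -z ≤ G 1 := by linarith
      have h1' : G 0 < -z := by linarith
      simp only [neg_neg]
      rw [hμ0]
      refine (and_assoc.1 ⟨hL _ ?_, fun β hβ hn ε' hε1 hε2 => ?_⟩)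
      · rcases h0'.eq_or_lt with h | h0'
        · rw [h]; exact Or.inl hμ1
        · by_cases hx : F (-z) ∈ Λ
          · refine Or.inr (Or.inr ⟨_, (hcolΛ _ hx).1, (hcolΛ _ hx).2, ?_⟩)
            rw [← (hfib _ hx).start, ← hz]
          · obtain ⟨i, hi, h2, -⟩ := hpt _ (hFpos _ h1') (hFlt _ h0') hx
            exact Or.inr (Or.inl ⟨i, hi, by rw [← h2, ← hz]⟩)
      · obtain ⟨v, hv1, hv2, hv3⟩ := hrec β hβ hn (-ε') (-z)
          (hFG 0 ▸ hFmono (show G 0 ≤ -ε' by linarith)) (hFG 1 ▸ hFmono h0')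
          (lt_of_le_of_ne (hFmono (by linarith)) fun h => by
            have := hF1 (-ε')
            rw [h] at this
            linarith)
        exact ⟨-v, by linarith, by linarith, by rwa [neg_neg]⟩
    · intro z h0 h1
      by_cases hx : F (-z) ∈ Λ
      · rcases (hF1 (-z)).eq_or_lt with h2 | h2
        · exact Or.inl h2.symm
        · have hz := hGlt hx.1
          refine Or.inr ⟨-G (F (-z)), by linarith, by linarith, by simp [hFG],
            fun α β hY v hv1 hv2 => ?_⟩
          exact (hfib _ hx).bwd α β hY v (by linarith [hF2 (-z)]) hv2
      · exact Or.inl (hFeq _ hx)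

theorem ComposesTo.firstStart_eq {l : List (Triple Atom)} {m : Triple Atom}
    (h : ComposesTo l m) : Shuffle.firstStart l = m.start := by
  cases h <;> rfl

theorem ComposesTo.lastFinish_eq {l : List (Triple Atom)} {m : Triple Atom}
    (h : ComposesTo l m) : Shuffle.lastFinish l = m.finish := by
  induction h with
  | single m => rfl
  | cons m l k h hk ih =>
    cases l with
    | nil => cases h
    | cons a l => exact ih

theorem ComposesTo.exists_finish_eq {l : List (Triple Atom)} {m : Triple Atom}
    (h : ComposesTo l m) : ∃ c ∈ l, c.finish = m.finish := by
  induction h with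
  | single m => exact ⟨m, by simp, rfl⟩
  | cons m l k h hk ih =>
    obtain ⟨c, hc, hc'⟩ := ih
    exact ⟨c, by simp [hc], hc'⟩

namespace Shuffle

variable (D : Shuffle Atom) (o : Triple Atom)

theorem ySeg_succ (a n : ℕ) : D.ySeg o a (n + 1) = D.y o a :: D.ySeg o (a + 1) n := by
  simp [ySeg, List.range'_succ]

theorem ySeg_concat (a n : ℕ) : D.ySeg o a (n + 1) = D.ySeg o a n ++ [D.y o (a + n)] := by
  simp [ySeg, List.range'_1_concat]

theorem lamSeg_concat (a n : ℕ) :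
    D.lamSeg o a (n + 1) = D.lamSeg o a n ++ D.lam (a + n) ++ [D.x o (a + n)] := by
  simp [lamSeg, List.range'_1_concat]

theorem mem_mu {c : Triple Atom} : c ∈ D.mu o ↔ ∃ i ≤ D.s, c = D.y o i := by
  simp only [mu, ySeg, List.mem_map, List.mem_range'_1]
  constructor
  · rintro ⟨i, hi, rfl⟩; exact ⟨i, by omega, rfl⟩
  · rintro ⟨i, hi, rfl⟩; exact ⟨i, by omega, rfl⟩

theorem mem_lamSeg {c : Triple Atom} {n : ℕ} :
    c ∈ D.lamSeg o 1 n ↔ ∃ i, 1 ≤ i ∧ i ≤ n ∧ (c ∈ D.lam i ∨ c = D.x o i) := by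
  simp only [lamSeg, List.mem_flatMap, List.mem_range'_1, List.mem_append, List.mem_singleton]
  constructor
  · rintro ⟨i, hi, h⟩; exact ⟨i, hi.1, by omega, h⟩
  · rintro ⟨i, h1, h2, h⟩; exact ⟨i, ⟨h1, by omega⟩, h⟩

theorem mem_lambda {c : Triple Atom} :
    c ∈ D.lambda o ↔ 0 < D.r ∧ (c = D.x o 0 ∨
      ∃ i, 1 ≤ i ∧ i ≤ D.r ∧ (c ∈ D.lam i ∨ c = D.x o i)) := by
  rw [lambda]
  split_ifs with h
  · simp [h]
  · rw [List.mem_append, List.mem_singleton, mem_lamSeg]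
    exact ⟨fun h' => ⟨by omega, h'⟩, fun h' => h'.2⟩

variable {D o} in
/-- A shuffle with realizable sequences is realized by a dense mixture of its points and sequences. -/
theorem FullyDecomposes.realizable {φ : Formula Atom} (h : D.FullyDecomposes o φ)
    (hlam : ∀ i, 1 ≤ i → i ≤ D.r → ∀ n ∈ D.lam i, Realizable φ U S n) :
    Realizable φ U S o := by
  have hk : ∀ i, ∃ k, 1 ≤ i → i ≤ D.r → ComposesTo (D.lam i) k := by
    intro i
    by_cases hi : 1 ≤ i ∧ i ≤ D.r
    · obtain ⟨k, hk⟩ := h.lam_composing i hi.1 hi.2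
      exact ⟨k, fun _ _ => hk⟩
    · exact ⟨o, fun h1 h2 => absurd ⟨h1, h2⟩ hi⟩
  choose k hk using hk
  have hdrop : ([D.m' o] ++ D.lambda o ++ D.mu o ++ [D.m'' o]).dropLast =
      D.m' o :: (D.lambda o ++ D.mu o) := by
    rw [List.dropLast_append_of_ne_nil (by simp)]; simp
  obtain ⟨-, -, hcov⟩ := composesTo_iff.1 h.f1.composes
  rw [hdrop] at hcov
  have hystart : ∀ i, (D.y o i).start = D.P i := fun i => rfl
  have hyfin : ∀ i < D.s, (D.y o i).finish = D.P (i + 1) := fun i hi => by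
    simp [y, hi.ne]
  have hysfin : (D.y o D.s).finish = D.P 0 := by simp [y]
  have hxfin : ∀ i < D.r, (D.x o i).finish = (k (i + 1)).start := fun i hi => by
    simp only [x, if_neg hi.ne]
    exact (hk (i + 1) (by omega) hi).firstStart_eq
  have hxstart : ∀ i, 1 ≤ i → i ≤ D.r → (D.x o i).start = (k i).finish := fun i h1 h2 => by
    simp only [x, if_neg (show i ≠ 0 by omega)]
    exact (hk i h1 h2).lastFinish_eq
  have hP : ∀ β ∈ o.cover, ∀ i ≤ D.s, β ∈ D.P i := by
    intro β hβ i hi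
    have h2 := ((hcov β).1 hβ).2
    cases i with
    | zero => exact h2 (D.m' o) (by simp)
    | succ i =>
      rw [← hyfin i (by omega)]
      exact h2 _ (List.mem_cons_of_mem _ (List.mem_append_right _
        ((D.mem_mu o).2 ⟨i, by omega, rfl⟩)))
  -- a label at a limit from the right is the start of one of the mosaics `o`, `y i` and `x i`, whose
  -- full decomposition begins with a mosaic with the same cover
  refine realizable_of_shuffle (isTemporal_U φ) (isTemporal_S φ) (s := D.s) (r := D.r) (P := D.P)
    (k := k) h.mosaic.start_mpc h.mosaic.finish_mpc h.P_mpc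
    (fun i h1 h2 => (hk i h1 h2).realizable (hlam i h1 h2)) ?_ ?_ ?_
  · rintro R (rfl | ⟨i, hi, rfl⟩ | ⟨i, h1, h2, rfl⟩)
    · exact ⟨h.mosaic.coh_U, fun α β => h.f1.mem_cover_of_until rfl⟩
    · refine ⟨(h.y_mosaic i hi).coh_U.trans h.m''_mosaic.coh_U fun β hβ => hP β hβ 0 (by omega),
        fun α β hβ => ?_⟩
      rcases hi.lt_or_eq with hi | rfl
      · have h5 := h.f5 i hi
        rw [show D.s + 1 - i = (D.s - i) + 1 by omega, ySeg_succ] at h5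
        exact h5.mem_cover_of_until rfl hβ
      · exact h.f6.mem_cover_of_until rfl hβ
    · have hr : 0 < D.r := by omega
      rw [← hxstart i h1 h2]
      refine ⟨(h.x_mosaic hr i h2).coh_U.trans h.m''_mosaic.coh_U
        fun β hβ => hP β hβ 0 (by omega), fun α β hβ => ?_⟩
      rcases h2.lt_or_eq with hi | rfl
      · exact (h.f3 i h1 hi).mem_cover_of_until rfl hβ
      · exact (h.f4 hr).mem_cover_of_until rfl hβ
  · rintro R (rfl | ⟨i, hi, rfl⟩ | ⟨i, h1, h2, rfl⟩)
    · exact ⟨h.mosaic.coh_S, fun α β => h.f1.mem_cover_of_since rfl⟩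
    · cases i with
      | zero =>
        rw [← hysfin]
        refine ⟨(h.y_mosaic D.s le_rfl).coh_S.trans h.m'_mosaic.coh_S
          fun β hβ => hP β hβ 0 (by omega), fun α β hβ => ?_⟩
        have h6 := h.f6
        rw [mu, ySeg_concat, ← List.append_assoc, zero_add] at h6
        exact h6.mem_cover_of_since rfl hβ
      | succ i =>
        rw [← hyfin i (by omega)]
        refine ⟨(h.y_mosaic i (by omega)).coh_S.trans h.m'_mosaic.coh_S
          fun β hβ => hP β hβ 0 (by omega), fun α β hβ => ?_⟩
        have h5 := h.f5 i (by omega)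
        rw [D.ySeg_concat o 0 i, ← List.append_assoc, zero_add] at h5
        exact h5.mem_cover_of_since rfl hβ
    · have hr : 0 < D.r := by omega
      obtain ⟨i, rfl⟩ := Nat.exists_eq_add_of_le' h1
      rw [← hxfin i (by omega)]
      refine ⟨(h.x_mosaic hr i (by omega)).coh_S.trans h.m'_mosaic.coh_S
        fun β hβ => hP β hβ 0 (by omega), fun α β hβ => ?_⟩
      cases i with
      | zero => exact (h.f2 hr).mem_cover_of_since rfl hβ
      | succ i =>
        have h3 := h.f3 (i + 1) (by omega) (by omega)
        rw [D.lamSeg_concat o 1 i, ← List.append_assoc, ← List.append_assoc, add_comm 1 i] at h3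
        exact h3.mem_cover_of_since rfl hβ
  · intro β
    constructor
    · intro hβ
      refine ⟨h.mosaic.cover_subset hβ, hP β hβ, fun i h1 h2 => ?_⟩
      have hr : 0 < D.r := by omega
      obtain ⟨h3, h4⟩ := (hcov β).1 hβ
      have hlami : ∀ c ∈ D.lam i, c ∈ D.lambda o := fun c hc =>
        (D.mem_lambda o).2 ⟨hr, Or.inr ⟨i, h1, h2, Or.inl hc⟩⟩
      refine ⟨?_, ?_, ?_⟩
      · obtain ⟨i, rfl⟩ := Nat.exists_eq_add_of_le' h1
        rw [← hxfin i (by omega)]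
        refine h4 _ (List.mem_cons_of_mem _ (List.mem_append_left _ ((D.mem_lambda o).2 ⟨hr, ?_⟩)))
        cases i with
        | zero => exact Or.inl rfl
        | succ i => exact Or.inr ⟨i + 1, by omega, by omega, Or.inr rfl⟩
      · refine ((composesTo_iff.1 (hk i h1 h2)).2.2 β).2 ⟨fun c hc => h3 c ?_, fun c hc => h4 c ?_⟩
        · simp [hlami c hc]
        · simp [hlami c (List.mem_of_mem_dropLast hc)]
      · obtain ⟨c, hc, hc'⟩ := (hk i h1 h2).exists_finish_eq
        rw [← hc']
        exact h4 c (by simp [hlami c hc])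
    · rintro ⟨h1, h2, h3⟩
      by_contra hn
      obtain ⟨c, hc, hc'⟩ := h.f1.exists_notMem h1 hn
      rw [hdrop, List.mem_cons, List.mem_append] at hc
      have hP0 := h2 0 (by omega)
      have hx : ∀ i ≤ D.r, β ∈ (D.x o i).finish := by
        intro i hi
        rcases hi.lt_or_eq with hi | rfl
        · rw [hxfin i hi]; exact (h3 _ (by omega) hi).1
        · simpa [x] using hP0
      rcases hc with rfl | hc | hc
      · exact hc' hP0
      · obtain ⟨hr, rfl | ⟨i, h4, h5, h6 | rfl⟩⟩ := (D.mem_lambda o).1 hc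
        · exact hc' (hx 0 (by omega))
        · obtain ⟨-, h7, h8⟩ := h3 i h4 h5
          obtain ⟨hne, hpath, h9⟩ := composesTo_iff.1 (hk i h4 h5)
          rw [← List.dropLast_append_getLast hne, List.mem_append, List.mem_singleton] at h6
          rcases h6 with h6 | rfl
          · exact hc' (((h9 β).1 h7).2 c h6)
          · rw [← List.dropLast_append_getLast hne, isPath_append] at hpath
            obtain ⟨E, -, -, h10⟩ := hpath
            exact hc' (by rw [h10]; exact h8)
        · exact hc' (hx i h5)
      · obtain ⟨i, hi, rfl⟩ := (D.mem_mu o).1 hc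
        rcases hi.lt_or_eq with hi | rfl
        · rw [hyfin i hi] at hc'; exact hc' (h2 _ (by omega))
        · rw [hysfin] at hc'; exact hc' hP0

end Shuffle

/-! ### Soundness -/

theorem realizable_of_mem_compositionsFrom {φ : Formula Atom} {X : Set (Triple Atom)}
    (hX : ∀ m ∈ X, Realizable φ U S m) : ∀ m ∈ compositionsFrom φ X, Realizable φ U S m := by
  rintro m ⟨l, hl, hc⟩
  exact hc.realizable fun k hk => hX k (hl k hk).2

theorem realizable_of_mem_leadTrailStep {φ : Formula Atom} {X : Set (Triple Atom)}
    (hX : ∀ m ∈ X, Realizable φ U S m) : ∀ m ∈ leadTrailStep φ X, Realizable φ U S m := by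
  refine realizable_of_mem_compositionsFrom ?_
  rintro m (hm | ⟨σ, hσ, h | h⟩)
  · exact hX m hm
  · exact h.realizable fun k hk => hX k (hσ k hk)
  · exact h.realizable fun k hk => hX k (hσ k hk)

theorem realizable_of_mem_shuffleStep {φ : Formula Atom} {M X : Set (Triple Atom)}
    (hX : ∀ m ∈ X, Realizable φ U S m) : ∀ m ∈ shuffleStep φ M X, Realizable φ U S m := by
  rintro m ⟨-, hm⟩
  refine realizable_of_mem_compositionsFrom ?_ m hm
  rintro m (hm | ⟨D, hD, h⟩)
  · exact hX m hm
  · exact hD.realizable fun i h1 h2 k hk => hX k (h i h1 h2 k hk)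

theorem realizable_of_mem_level {φ : Formula Atom} {M : Set (Triple Atom)} (n : ℕ) :
    ∀ m ∈ level φ M n, Realizable φ U S m := by
  refine realizable_of_mem_shuffleStep ?_
  induction n with
  | zero => rintro m ⟨⟩
  | succ n ih =>
    exact realizable_of_mem_leadTrailStep (realizable_of_mem_leadTrailStep
      (realizable_of_mem_shuffleStep ih))

namespace Formula

theorem sat_orderIso {T T' : Type*} [LinearOrder T] [LinearOrder T'] (e : T ≃o T')
    (h : Atom → Set T') (χ : Formula Atom) (x : T) :
    Sat (fun p => e ⁻¹' h p) x χ ↔ Sat h (e x) χ := by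
  induction χ generalizing x with
  | atom p => rfl
  | neg α ih => simp [Sat, ih]
  | and α β ha hb => simp [Sat, ha, hb]
  | U α β ha hb => simp [Sat, ha, hb, e.surjective.exists, e.surjective.forall]
  | S α β ha hb => simp [Sat, ha, hb, e.surjective.exists, e.surjective.forall]

theorem exists_star_eq (q : Atom) (χ : Formula Atom) : ∃ γ, star q χ = and γ (atom q) := by
  cases χ <;> exact ⟨_, rfl⟩

theorem star_mem_subformulas {q : Atom} {φ χ : Formula Atom} (h : χ ∈ φ.subformulas) :
    star q χ ∈ (star q φ).subformulas := by
  induction φ with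
  | atom p =>
    rw [subformulas, Set.mem_singleton_iff] at h
    subst h; exact mem_subformulas_self _
  | neg α ih =>
    rcases h with h | h
    · rw [Set.mem_singleton_iff] at h; subst h; exact mem_subformulas_self _
    · exact Or.inr (Or.inl (Or.inr (ih h)))
  | and α β ha hb | U α β ha hb | S α β ha hb =>
    rcases h with h | h | h
    · rw [Set.mem_singleton_iff] at h; subst h; exact mem_subformulas_self _
    · exact Or.inr (Or.inl (Or.inr (Or.inl (ha h))))
    · exact Or.inr (Or.inl (Or.inr (Or.inr (hb h))))

theorem atom_mem_subformulas_star (q : Atom) (φ : Formula Atom) :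
    atom q ∈ (star q φ).subformulas := by
  obtain ⟨γ, h⟩ := exists_star_eq q φ
  have := mem_subformulas_self (star q φ)
  rw [h] at this ⊢
  exact (and_mem_Cl (mem_Cl_of_mem_subformulas this)).2

end Formula

theorem IsMPC.star_mem_iff {φ χ γ : Formula Atom} {q : Atom} {A : Set (Formula Atom)}
    (hA : IsMPC (star q φ) A) (hq : atom q ∈ A) (hχ : χ ∈ φ.subformulas)
    (h : star q χ = and γ (atom q)) :
    star q χ ∈ A ↔ γ ∈ A := by
  have h1 := star_mem_subformulas (q := q) hχ
  rw [h] at h1 ⊢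
  rw [hA.and_mem_iff (mem_Cl_of_mem_subformulas h1)]
  simp [hq]

/-- In a realization of a relativized mosaic, the labels of interior points describe the truth of
`φ` in the open interval. -/
theorem IsRelativized.star_mem_iff {φ : Formula Atom} {q : Atom} {m : Triple Atom}
    (hm : IsRelativized φ q m) {μ : ℝ → Set (Formula Atom)}
    (hμ : Realizes (star q φ) U S μ (-1) 1 m) (χ : Formula Atom) (hχ : χ ∈ φ.subformulas)
    (x : Set.Ioo (-1 : ℝ) 1) :
    star q χ ∈ μ x ↔ Sat (fun p => {x : Set.Ioo (-1 : ℝ) 1 | atom p ∈ μ x}) x χ := by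
  have hqin : ∀ z, -1 < z → z < 1 → atom q ∈ μ z := ((hμ.cover _).1 hm.q_cover).2
  have hqs := atom_mem_subformulas_star q φ
  have hql : ∀ χ ∈ φ.subformulas, ∀ z, -1 ≤ z → z ≤ 1 → star q χ ∈ μ z → atom q ∈ μ z := by
    intro χ hχ z h1 h2 h3
    obtain ⟨γ, hγ⟩ := exists_star_eq q χ
    have h4 := mem_Cl_of_mem_subformulas (star_mem_subformulas (q := q) hχ)
    rw [hγ] at h3 h4
    exact (((hμ.mpc z h1 h2).and_mem_iff h4).1 h3).2
  have hlt1 : ∀ χ ∈ φ.subformulas, ∀ z, -1 < z → z ≤ 1 → star q χ ∈ μ z → z < 1 := by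
    intro χ hχ z h1 h2 h3
    refine lt_of_le_of_ne h2 ?_
    rintro rfl
    have h4 := hm.neg_q_finish
    rw [← hμ.finish] at h4
    exact ((hμ.mpc 1 h1.le le_rfl).neg_mem_iff hqs).1 h4 (hql χ hχ 1 h1.le le_rfl h3)
  have hlt2 : ∀ χ ∈ φ.subformulas, ∀ z, -1 ≤ z → z < 1 → star q χ ∈ μ z → -1 < z := by
    intro χ hχ z h1 h2 h3
    refine lt_of_le_of_ne h1 ?_
    rintro rfl
    have h4 := hm.neg_q_start
    rw [← hμ.start] at h4
    exact ((hμ.mpc (-1) le_rfl h2.le).neg_mem_iff hqs).1 h4 (hql χ hχ (-1) le_rfl h2.le h3)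
  have hmpc := fun x : Set.Ioo (-1 : ℝ) 1 => hμ.mpc x x.2.1.le x.2.2.le
  have hunf : ∀ (x : Set.Ioo (-1 : ℝ) 1) {χ γ : Formula Atom}, χ ∈ φ.subformulas →
      star q χ = and γ (atom q) → (star q χ ∈ μ x ↔ γ ∈ μ x) :=
    fun x _ _ h1 h2 => (hmpc x).star_mem_iff (hqin x x.2.1 x.2.2) h1 h2
  induction χ generalizing x with
  | atom p => exact hunf x hχ rfl
  | neg α ih =>
    have hα : α ∈ φ.subformulas := subformulas_trans hχ (Or.inr (mem_subformulas_self _))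
    exact (hunf x hχ rfl).trans (((hmpc x).neg_mem_iff (star_mem_subformulas hα)).trans
      (not_congr (ih hα x)))
  | and α β iha ihb =>
    have hα : α ∈ φ.subformulas :=
      subformulas_trans hχ (Or.inr (Or.inl (mem_subformulas_self _)))
    have hβ : β ∈ φ.subformulas :=
      subformulas_trans hχ (Or.inr (Or.inr (mem_subformulas_self _)))
    have hCl : and (star q α) (star q β) ∈ (star q φ).Cl := mem_Cl_of_mem_subformulas
      (and_mem_Cl (mem_Cl_of_mem_subformulas (star_mem_subformulas (q := q) hχ))).1
    exact (hunf x hχ rfl).trans (((hmpc x).and_mem_iff hCl).trans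
      (and_congr (iha hα x) (ihb hβ x)))
  | U α β iha ihb =>
    have hα : α ∈ φ.subformulas :=
      subformulas_trans hχ (Or.inr (Or.inl (mem_subformulas_self _)))
    have hβ : β ∈ φ.subformulas :=
      subformulas_trans hχ (Or.inr (Or.inr (mem_subformulas_self _)))
    have hCl : U (star q α) (star q β) ∈ (star q φ).Cl := mem_Cl_of_mem_subformulas
      (and_mem_Cl (mem_Cl_of_mem_subformulas (star_mem_subformulas (q := q) hχ))).1
    have iha := iha hα
    have ihb := ihb hβ
    have hend : U (star q α) (star q β) ∉ μ 1 := by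
      rw [hμ.finish]; exact hm.no_until_finish _ _
    rw [hunf x hχ rfl, hμ.fwd _ _ hCl x x.2.1.le x.2.2]
    simp only [Reach, hend, and_false, or_false, Sat]
    constructor
    · rintro ⟨y, h1, h2, h3, h4⟩
      have h5 := hlt1 α hα y (x.2.1.trans h1) h2 h3
      exact ⟨⟨y, x.2.1.trans h1, h5⟩, h1, (iha _).1 h3, fun z hz1 hz2 =>
        (ihb z).1 (h4 z hz1 hz2)⟩
    · rintro ⟨y, h1, h2, h3⟩
      exact ⟨y, h1, y.2.2.le, (iha y).2 h2, fun z hz1 hz2 =>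
        (ihb ⟨z, x.2.1.trans hz1, hz2.trans y.2.2⟩).2 (h3 _ hz1 hz2)⟩
  | S α β iha ihb =>
    have hα : α ∈ φ.subformulas :=
      subformulas_trans hχ (Or.inr (Or.inl (mem_subformulas_self _)))
    have hβ : β ∈ φ.subformulas :=
      subformulas_trans hχ (Or.inr (Or.inr (mem_subformulas_self _)))
    have hCl : S (star q α) (star q β) ∈ (star q φ).Cl := mem_Cl_of_mem_subformulas
      (and_mem_Cl (mem_Cl_of_mem_subformulas (star_mem_subformulas (q := q) hχ))).1
    have iha := iha hα
    have ihb := ihb hβ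
    have hend : S (star q α) (star q β) ∉ μ (-1) := by
      rw [hμ.start]; exact hm.no_since_start _ _
    have h0 := hμ.bwd _ _ hCl (-x) (by linarith [x.2.2]) (by linarith [x.2.1])
    simp only [Reach, neg_neg, hend, and_false, or_false] at h0
    rw [hunf x hχ rfl, h0]
    simp only [Sat]
    constructor
    · rintro ⟨y, h1, h2, h3, h4⟩
      have h5 := hlt2 α hα (-y) (by linarith) (by linarith [x.2.2]) h3
      refine ⟨⟨-y, h5, by linarith [x.2.2]⟩, ?_, (iha _).1 h3, fun z hz1 hz2 => (ihb z).1 ?_⟩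
      · change -y < (x : ℝ); linarith
      · have hz1' : -y < (z : ℝ) := hz1
        have hz2' : (z : ℝ) < x := hz2
        simpa using h4 (-z) (by linarith) (by linarith)
    · rintro ⟨y, h1, h2, h3⟩
      have h1' : (y : ℝ) < x := h1
      refine ⟨-y, by linarith, by linarith [y.2.1], by simpa using (iha y).2 h2,
        fun z hz1 hz2 => (ihb ⟨-z, by linarith [y.2.1], by linarith [x.2.2]⟩).2 (h3 _ ?_ ?_)⟩
      · change (y : ℝ) < -z; linarith
      · change -z < (x : ℝ); linarith

theorem IsRelativized.realSatisfiable {φ : Formula Atom} {q : Atom} {m : Triple Atom}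
    (hm : IsRelativized φ q m) (h : Realizable (star q φ) U S m) : φ.RealSatisfiable := by
  obtain ⟨μ, hμ⟩ := h.exists_realizes (show (-1 : ℝ) < 1 by norm_num)
  have hself := mem_subformulas_self (star q φ)
  have h1 := hm.neg_star_cover
  rw [hμ.cover] at h1
  push Not at h1
  obtain ⟨z, h2, h3, h4⟩ := h1 (neg_mem_Cl_of_mem_subformulas hself)
  rw [(hμ.mpc z h2.le h3.le).neg_mem_iff hself, not_not] at h4
  have h5 := (hm.star_mem_iff hμ φ (mem_subformulas_self _) ⟨z, h2, h3⟩).1 h4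
  let e := orderIsoIooNegOneOne ℝ
  refine ⟨_, e.symm ⟨z, h2, h3⟩,
    (sat_orderIso e (fun p => {x : Set.Ioo (-1 : ℝ) 1 | atom p ∈ μ x}) φ _).2 ?_⟩
  rwa [e.apply_symm_apply]

/-! ### Mosaics of real structures -/

/-- The formulas of the closure of `φ` that are true at `x`. -/
def label (φ : Formula Atom) (h : Atom → Set ℝ) (x : ℝ) : Set (Formula Atom) :=
  {χ | χ ∈ φ.Cl ∧ Sat h x χ}

/-- The formulas of the closure of `φ` that are true everywhere strictly between `x` and `y`. -/
def coverOf (φ : Formula Atom) (h : Atom → Set ℝ) (x y : ℝ) : Set (Formula Atom) :=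
  {χ | χ ∈ φ.Cl ∧ ∀ z, x < z → z < y → Sat h z χ}

/-- The mosaic of the interval `[x, y]` of the structure `(ℝ, <, h)`. -/
def mos (φ : Formula Atom) (h : Atom → Set ℝ) (x y : ℝ) : Triple Atom :=
  ⟨label φ h x, coverOf φ h x y, label φ h y⟩

/-- The mosaics of intervals of real structures. -/
def satMosaics (φ : Formula Atom) : Set (Triple Atom) :=
  {m | ∃ h x y, x < y ∧ m = mos φ h x y}

section Mos

variable {φ : Formula Atom} {h : Atom → Set ℝ} {x y : ℝ}

theorem Formula.sat_sim {x : ℝ} {χ : Formula Atom} : Sat h x (sim χ) ↔ ¬ Sat h x χ := by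
  cases χ <;> simp [sim, Sat]

theorem label_isMPC (φ : Formula Atom) (h : Atom → Set ℝ) (x : ℝ) : IsMPC φ (label φ h x) := by
  have h1 : label φ h x = {χ | χ ∈ φ.Cl ∧ bval (Sat h x) χ} := by
    ext χ; simp only [label, bval_sat]
  exact h1 ▸ isMPC_bval φ (Sat h x)

theorem mem_label_of_mem_coverOf {χ : Formula Atom} {z : ℝ} (hχ : χ ∈ coverOf φ h x y)
    (h1 : x < z) (h2 : z < y) : χ ∈ label φ h z :=
  ⟨hχ.1, hχ.2 z h1 h2⟩

theorem coverOf_anti {x' y' : ℝ} (h1 : x ≤ x') (h2 : y' ≤ y) :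
    coverOf φ h x y ⊆ coverOf φ h x' y' :=
  fun _ hχ => ⟨hχ.1, fun z hz1 hz2 => hχ.2 z (h1.trans_lt hz1) (hz2.trans_le h2)⟩

theorem mos_isMosaic (φ : Formula Atom) (h : Atom → Set ℝ) (hxy : x < y) :
    IsMosaic φ (mos φ h x y) where
  start_mpc := label_isMPC φ h x
  finish_mpc := label_isMPC φ h y
  cover_subset _ hχ := hχ.1
  cover_neg β hβ hn := by
    simp only [mos, coverOf, Set.mem_ofPred_eq, hn, sim_mem_Cl hβ, true_and, sat_sim]
    rfl
  c1 α β h1 h2 := by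
    have hT := isTemporal_U φ
    have hCl : U α β ∈ φ.Cl := mem_Cl_of_mem_subformulas (neg_mem_Cl_iff.1 h1.1)
    have hα := neg_mem_Cl_of_mem_subformulas (hT.left_mem hCl)
    have hβ := neg_mem_Cl_of_mem_subformulas (hT.right_mem hCl)
    have hno : ∀ z, x < z → z ≤ y → ¬ Sat h z α := fun z hz1 hz2 hz =>
      h1.2 ⟨z, hz1, hz, fun w hw1 hw2 => h2.2 w hw1 (hw2.trans_le hz2)⟩
    have hUn : ∀ z, x < z → (z < y ∨ z = y ∧ Sat h y β) → ¬ Sat h z (U α β) := by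
      rintro z hz1 hz2 ⟨w, hw1, hw2, hw3⟩
      refine h1.2 ⟨w, hz1.trans hw1, hw2, fun v hv1 hv2 => ?_⟩
      rcases lt_trichotomy v z with hv | rfl | hv
      · refine h2.2 v hv1 (hv.trans_le ?_)
        rcases hz2 with hz2 | ⟨hz2, -⟩
        exacts [hz2.le, hz2.le]
      · rcases hz2 with hz2 | ⟨rfl, hz2⟩
        exacts [h2.2 v hz1 hz2, hz2]
      · exact hw3 v hv hv2
    refine ⟨⟨⟨hα, hno y hxy le_rfl⟩, ?_⟩, ⟨hα, fun z hz1 hz2 => hno z hz1 hz2.le⟩,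
      h1.1, fun z hz1 hz2 => hUn z hz1 (Or.inl hz2)⟩
    by_cases hyβ : Sat h y β
    · exact Or.inr ⟨h1.1, hUn y hxy (Or.inr ⟨rfl, hyβ⟩)⟩
    · exact Or.inl ⟨hβ, hyβ⟩
  c2 α β h1 h2 := by
    have hT := isTemporal_U φ
    have hα := mem_Cl_of_mem_subformulas (hT.left_mem h1.1)
    have hβ := mem_Cl_of_mem_subformulas (hT.right_mem h1.1)
    obtain ⟨w, hw1, hw2, hw3⟩ := h1.2
    have hw : y ≤ w := by
      by_contra hlt
      exact h2.2 w hw1 (not_le.1 hlt) hw2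
    refine ⟨?_, ⟨hβ, fun z hz1 hz2 => hw3 z hz1 (hz2.trans_le hw)⟩, h1.1, fun z hz1 hz2 =>
      ⟨w, hz2.trans_le hw, hw2, fun v hv1 hv2 => hw3 v (hz1.trans hv1) hv2⟩⟩
    rcases hw.eq_or_lt with rfl | hw
    · exact Or.inl ⟨hα, hw2⟩
    · exact Or.inr ⟨⟨hβ, hw3 y hxy hw⟩, h1.1, w, hw, hw2, fun v hv1 hv2 =>
        hw3 v (hxy.trans hv1) hv2⟩
  c3 α β h1 h2 := by
    have hT := isTemporal_S φ
    have hCl : S α β ∈ φ.Cl := mem_Cl_of_mem_subformulas (neg_mem_Cl_iff.1 h1.1)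
    have hα := neg_mem_Cl_of_mem_subformulas (hT.left_mem hCl)
    have hβ := neg_mem_Cl_of_mem_subformulas (hT.right_mem hCl)
    have hno : ∀ z, x ≤ z → z < y → ¬ Sat h z α := fun z hz1 hz2 hz =>
      h1.2 ⟨z, hz2, hz, fun w hw1 hw2 => h2.2 w (hz1.trans_lt hw1) hw2⟩
    have hSn : ∀ z, z < y → (x < z ∨ z = x ∧ Sat h x β) → ¬ Sat h z (S α β) := by
      rintro z hz1 hz2 ⟨w, hw1, hw2, hw3⟩
      refine h1.2 ⟨w, hw1.trans hz1, hw2, fun v hv1 hv2 => ?_⟩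
      rcases lt_trichotomy v z with hv | rfl | hv
      · exact hw3 v hv1 hv
      · rcases hz2 with hz2 | ⟨rfl, hz2⟩
        exacts [h2.2 v hz2 hz1, hz2]
      · refine h2.2 v (lt_of_le_of_lt ?_ hv) hv2
        rcases hz2 with hz2 | ⟨hz2, -⟩
        exacts [hz2.le, hz2.ge]
    refine ⟨⟨⟨hα, hno x le_rfl hxy⟩, ?_⟩, ⟨hα, fun z hz1 hz2 => hno z hz1.le hz2⟩,
      h1.1, fun z hz1 hz2 => hSn z hz2 (Or.inl hz1)⟩
    by_cases hxβ : Sat h x β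
    · exact Or.inr ⟨h1.1, hSn x hxy (Or.inr ⟨rfl, hxβ⟩)⟩
    · exact Or.inl ⟨hβ, hxβ⟩
  c4 α β h1 h2 := by
    have hT := isTemporal_S φ
    have hα := mem_Cl_of_mem_subformulas (hT.left_mem h1.1)
    have hβ := mem_Cl_of_mem_subformulas (hT.right_mem h1.1)
    obtain ⟨w, hw1, hw2, hw3⟩ := h1.2
    have hw : w ≤ x := by
      by_contra hlt
      exact h2.2 w (not_le.1 hlt) hw1 hw2
    refine ⟨?_, ⟨hβ, fun z hz1 hz2 => hw3 z (hw.trans_lt hz1) hz2⟩, h1.1, fun z hz1 hz2 =>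
      ⟨w, hw.trans_lt hz1, hw2, fun v hv1 hv2 => hw3 v hv1 (hv2.trans hz2)⟩⟩
    rcases hw.eq_or_lt with rfl | hw
    · exact Or.inl ⟨hα, hw2⟩
    · exact Or.inr ⟨⟨hβ, hw3 x hw hxy⟩, h1.1, w, hw, hw2, fun v hv1 hv2 =>
        hw3 v hv1 (hv2.trans hxy)⟩

theorem mos_comp {z : ℝ} (h1 : x < z) (h2 : z < y) :
    (mos φ h x z).comp (mos φ h z y) = mos φ h x y := by
  ext χ
  · rfl
  · simp only [Triple.comp, mos, coverOf, label, Set.mem_inter_iff, Set.mem_ofPred_eq]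
    constructor
    · rintro ⟨⟨⟨h3, h4⟩, -, h5⟩, -, h6⟩
      refine ⟨h3, fun w hw1 hw2 => ?_⟩
      rcases lt_trichotomy w z with hw | rfl | hw
      exacts [h4 w hw1 hw, h5, h6 w hw hw2]
    · rintro ⟨h3, h4⟩
      exact ⟨⟨⟨h3, fun w hw1 hw2 => h4 w hw1 (hw2.trans h2)⟩, h3, h4 z h1 h2⟩, h3,
        fun w hw1 hw2 => h4 w (h1.trans hw1) hw2⟩
  · rfl

/-- An interval can be cut at any finite number of its interior points. -/
theorem exists_cuts (φ : Formula Atom) (h : Atom → Set ℝ) (n : ℕ) :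
    ∀ (F : Finset ℝ), F.card ≤ n → ∀ u v : ℝ, u < v → ∃ σ, ComposesTo σ (mos φ h u v) ∧
      (∀ c ∈ σ, ∃ a b, u ≤ a ∧ a < b ∧ b ≤ v ∧ c = mos φ h a b) ∧
      ∀ w ∈ F, u < w → w < v → ∃ σ₁ σ₂, σ = σ₁ ++ σ₂ ∧ ComposesTo σ₁ (mos φ h u w) ∧
        ComposesTo σ₂ (mos φ h w v) := by
  classical
  induction n with
  | zero =>
    intro F hF u v huv
    rw [Nat.le_zero, Finset.card_eq_zero] at hF
    subst hF
    exact ⟨[mos φ h u v], .single _, by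
      simpa using ⟨u, le_rfl, v, huv, le_rfl, rfl⟩, by simp⟩
  | succ n ih =>
    intro F hF u v huv
    by_cases hne : ∃ w₀ ∈ F, u < w₀ ∧ w₀ < v
    · obtain ⟨w₀, hw₀, h1, h2⟩ := hne
      have hcard : (F.erase w₀).card ≤ n := by
        rw [Finset.card_erase_of_mem hw₀]; omega
      obtain ⟨σ, hσ1, hσ2, hσ3⟩ := ih _ hcard u w₀ h1
      obtain ⟨τ, hτ1, hτ2, hτ3⟩ := ih _ hcard w₀ v h2
      refine ⟨σ ++ τ, mos_comp h1 h2 ▸ hσ1.append hτ1 rfl, fun c hc => ?_, fun w hw hw1 hw2 => ?_⟩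
      · rcases List.mem_append.1 hc with hc | hc
        · obtain ⟨a, b, h3, h4, h5, h6⟩ := hσ2 c hc
          exact ⟨a, b, h3, h4, h5.trans h2.le, h6⟩
        · obtain ⟨a, b, h3, h4, h5, h6⟩ := hτ2 c hc
          exact ⟨a, b, h1.le.trans h3, h4, h5, h6⟩
      · rcases lt_trichotomy w w₀ with hlt | rfl | hlt
        · obtain ⟨σ₁, σ₂, rfl, h3, h4⟩ := hσ3 w (Finset.mem_erase.2 ⟨hlt.ne, hw⟩) hw1 hlt
          exact ⟨σ₁, σ₂ ++ τ, by simp, h3, mos_comp hlt h2 ▸ h4.append hτ1 rfl⟩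
        · exact ⟨σ, τ, rfl, hσ1, hτ1⟩
        · obtain ⟨τ₁, τ₂, rfl, h3, h4⟩ := hτ3 w (Finset.mem_erase.2 ⟨hlt.ne', hw⟩) hlt hw2
          exact ⟨σ ++ τ₁, τ₂, by simp, mos_comp h1 hlt ▸ hσ1.append h3 rfl, h4⟩
    · push Not at hne
      refine ⟨[mos φ h u v], .single _, ?_, fun w hw h1 h2 => absurd (hne w hw h1) (not_le.2 h2)⟩
      simpa using ⟨u, le_rfl, v, huv, le_rfl, rfl⟩

end Mos

theorem ComposesTo.exists_concat {l : List (Triple Atom)} {m : Triple Atom} (hc : ComposesTo l m)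
    {α β : Formula Atom} (hβ : β ∈ m.cover) (hα : α ∈ m.finish) :
    ∃ τ c, l = τ ++ [c] ∧ α ∈ c.finish ∧ β ∈ c.cover ∧ ∀ x ∈ τ, β ∈ x.cover ∧ β ∈ x.finish := by
  obtain ⟨hne, hp, hcov⟩ := composesTo_iff.1 hc
  obtain ⟨h1, h2⟩ := (hcov β).1 hβ
  have hl := List.dropLast_append_getLast hne
  refine ⟨l.dropLast, l.getLast hne, hl.symm, ?_, h1 _ (List.getLast_mem hne),
    fun x hx => ⟨h1 x (List.mem_of_mem_dropLast hx), h2 x hx⟩⟩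
  rw [← hl, isPath_append] at hp
  obtain ⟨D, -, -, h3⟩ := hp
  rw [h3]; exact hα

theorem ComposesTo.exists_cons {l : List (Triple Atom)} {m : Triple Atom} (hc : ComposesTo l m)
    {α β : Formula Atom} (hβ : β ∈ m.cover) (hα : α ∈ m.start) :
    ∃ c τ, l = c :: τ ∧ α ∈ c.start ∧ β ∈ c.cover ∧ ∀ x ∈ τ, β ∈ x.cover ∧ β ∈ x.start := by
  obtain ⟨hne, hp, hcov⟩ := composesTo_iff.1 hc
  obtain ⟨h1, h2⟩ := (hcov β).1 hβ
  obtain ⟨c, τ, rfl⟩ := List.exists_cons_of_ne_nil hne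
  refine ⟨c, τ, rfl, hp.1 ▸ hα, h1 c (by simp), fun x hx => ⟨h1 x (by simp [hx]), ?_⟩⟩
  obtain ⟨d, hd, hd'⟩ := hp.exists_finish_eq_start (x := x) (by simpa using hx)
  exact hd' ▸ h2 d hd

/-! ### Bad points of an interval -/

/-- Mosaics of subintervals of `[x, y]` whose cover is larger than that of `[x, y]` are in `X`, and
`X` is closed under composition of adjacent subintervals. -/
structure Reduction (φ : Formula Atom) (h : Atom → Set ℝ) (x y : ℝ) (X : Set (Triple Atom)) :
    Prop where
  mem_of_coverOf_ne : ∀ u v, x ≤ u → u < v → v ≤ y → coverOf φ h u v ≠ coverOf φ h x y →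
    mos φ h u v ∈ X
  mem_of_compositionsFrom : ∀ u v, x ≤ u → u < v → v ≤ y →
    mos φ h u v ∈ compositionsFrom φ X → mos φ h u v ∈ X

/-- `p` is right-bad in `[x, y]`: every interval of `[x, y]` that begins at `p` has the same cover
as `[x, y]`. -/
def RBad (φ : Formula Atom) (h : Atom → Set ℝ) (x y p : ℝ) : Prop :=
  x ≤ p ∧ p < y ∧ ∀ z, p < z → z ≤ y → coverOf φ h p z = coverOf φ h x y

/-- `p` is left-bad in `[x, y]`: every interval of `[x, y]` that ends at `p` has the same cover
as `[x, y]`. -/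
def LBad (φ : Formula Atom) (h : Atom → Set ℝ) (x y p : ℝ) : Prop :=
  x < p ∧ p ≤ y ∧ ∀ z, x ≤ z → z < p → coverOf φ h z p = coverOf φ h x y

/-- Bad points are those that are bad on some side. -/
def Bad (φ : Formula Atom) (h : Atom → Set ℝ) (x y p : ℝ) : Prop :=
  RBad φ h x y p ∨ LBad φ h x y p

section Bad

variable {φ : Formula Atom} {h : Atom → Set ℝ} {x y u v p z : ℝ} {X : Set (Triple Atom)}

theorem coverOf_eq_of_subset {u' v' : ℝ} (hu : x ≤ u') (huu : u' ≤ u) (hvv : v ≤ v') (hv : v' ≤ y)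
    (h1 : coverOf φ h u v = coverOf φ h x y) : coverOf φ h u' v' = coverOf φ h x y :=
  Set.Subset.antisymm ((coverOf_anti huu hvv).trans h1.le) (coverOf_anti hu hv)

/-- To the right of a point that is not right-bad there are no bad points nearby. -/
theorem exists_forall_not_bad_right (hp : ¬ RBad φ h x y p) :
    ∃ z, p < z ∧ ∀ q, p < q → q < z → ¬ Bad φ h x y q := by
  rcases lt_or_ge p x with h1 | h1
  · refine ⟨x, h1, fun q hq1 hq2 hq => ?_⟩
    rcases hq with hq | hq
    exacts [absurd hq.1 (not_le.2 hq2), absurd hq.1 hq2.not_gt]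
  rcases lt_or_ge p y with h2 | h2
  · simp only [RBad, h1, h2, true_and] at hp
    push Not at hp
    obtain ⟨z, h3, h4, h5⟩ := hp
    refine ⟨z, h3, fun q hq1 hq2 hq => h5 ?_⟩
    rcases hq with hq | hq
    · exact coverOf_eq_of_subset h1 hq1.le le_rfl h4 (hq.2.2 z hq2 h4)
    · exact coverOf_eq_of_subset h1 le_rfl hq2.le h4 (hq.2.2 p h1 hq1)
  · refine ⟨p + 1, by linarith, fun q hq1 _ hq => ?_⟩
    rcases hq with hq | hq
    exacts [absurd hq.2.1 (h2.trans hq1.le).not_gt, absurd hq.2.1 (not_le.2 (h2.trans_lt hq1))]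

theorem exists_forall_not_bad_left (hp : ¬ LBad φ h x y p) :
    ∃ z, z < p ∧ ∀ q, z < q → q < p → ¬ Bad φ h x y q := by
  rcases lt_or_ge y p with h2 | h2
  · refine ⟨y, h2, fun q hq1 hq2 hq => ?_⟩
    rcases hq with hq | hq
    exacts [absurd hq.2.1 hq1.not_gt, absurd hq.2.1 (not_le.2 hq1)]
  rcases lt_or_ge x p with h1 | h1
  · simp only [LBad, h1, h2, true_and] at hp
    push Not at hp
    obtain ⟨z, h3, h4, h5⟩ := hp
    refine ⟨z, h4, fun q hq1 hq2 hq => h5 ?_⟩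
    rcases hq with hq | hq
    · exact coverOf_eq_of_subset h3 hq1.le le_rfl h2 (hq.2.2 p hq2 h2)
    · exact coverOf_eq_of_subset h3 le_rfl hq2.le h2 (hq.2.2 z h3 hq1)
  · refine ⟨p - 1, by linarith, fun q _ hq2 hq => ?_⟩
    rcases hq with hq | hq
    exacts [absurd hq.1 (not_le.2 (hq2.trans_le h1)), absurd hq.1 (hq2.le.trans h1).not_gt]

theorem isClosed_bad (φ : Formula Atom) (h : Atom → Set ℝ) (x y : ℝ) :
    IsClosed {p | Bad φ h x y p} := by
  rw [← isOpen_compl_iff, isOpen_iff_mem_nhds]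
  intro p hp
  have hp' : ¬ Bad φ h x y p := hp
  obtain ⟨z, h1, h2⟩ := exists_forall_not_bad_right fun H => hp' (Or.inl H)
  obtain ⟨w, h3, h4⟩ := exists_forall_not_bad_left fun H => hp' (Or.inr H)
  filter_upwards [Ioo_mem_nhds h3 h1] with q hq
  rcases lt_trichotomy q p with hlt | rfl | hlt
  exacts [h4 q hq.1 hlt, hp', h2 q hlt hq.2]

/-- The next bad point to the right. -/
theorem exists_next_bad (hp : ¬ RBad φ h x y p) (hpv : p < v) (hv : Bad φ h x y v) :
    ∃ b, p < b ∧ b ≤ v ∧ Bad φ h x y b ∧ ∀ q, p < q → q < b → ¬ Bad φ h x y q := by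
  obtain ⟨z, h1, h2⟩ := exists_forall_not_bad_right hp
  have hzv : z ≤ v := by
    by_contra hlt
    exact h2 v hpv (not_le.1 hlt) hv
  obtain ⟨b, ⟨hb1, hb2⟩, hb3⟩ := ((isCompact_Icc (a := z) (b := v)).inter_left
    (isClosed_bad φ h x y)).exists_isLeast ⟨v, hv, hzv, le_rfl⟩
  refine ⟨b, h1.trans_le hb2.1, hb2.2, hb1, fun q hq1 hq2 hq => ?_⟩
  rcases lt_or_ge q z with hqz | hqz
  · exact h2 q hq1 hqz hq
  · exact absurd (hb3 ⟨hq, hqz, hq2.le.trans hb2.2⟩) (not_le.2 hq2)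

theorem exists_prev_bad (hp : ¬ LBad φ h x y p) (hup : u < p) (hu : Bad φ h x y u) :
    ∃ a, a < p ∧ u ≤ a ∧ Bad φ h x y a ∧ ∀ q, a < q → q < p → ¬ Bad φ h x y q := by
  obtain ⟨z, h1, h2⟩ := exists_forall_not_bad_left hp
  have huz : u ≤ z := by
    by_contra hlt
    exact h2 u (not_le.1 hlt) hup hu
  obtain ⟨a, ⟨ha1, ha2⟩, ha3⟩ := ((isCompact_Icc (a := u) (b := z)).inter_left
    (isClosed_bad φ h x y)).exists_isGreatest ⟨u, hu, le_rfl, huz⟩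
  refine ⟨a, ha2.2.trans_lt h1, ha2.1, ha1, fun q hq1 hq2 hq => ?_⟩
  rcases lt_or_ge z q with hqz | hqz
  · exact h2 q hqz hq2 hq
  · exact absurd (ha3 ⟨hq, ha2.1.trans hq1.le, hqz⟩) (not_le.2 hq1)

/-- The first right-bad point of an interval. -/
theorem exists_first_rBad (hp : RBad φ h x y p) (hup : u ≤ p) :
    ∃ b, u ≤ b ∧ b ≤ p ∧ RBad φ h x y b ∧ ∀ q, u ≤ q → q < b → ¬ RBad φ h x y q := by
  set T : Set ℝ := {q | u ≤ q ∧ RBad φ h x y q} with hT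
  have hb : BddBelow T := ⟨u, fun q hq => hq.1⟩
  have hpT : p ∈ T := ⟨hup, hp⟩
  have hmin : ∀ q, u ≤ q → q < sInf T → ¬ RBad φ h x y q := fun q h1 h2 h3 =>
    absurd (csInf_le hb ⟨h1, h3⟩) (not_le.2 h2)
  refine ⟨sInf T, le_csInf ⟨p, hpT⟩ fun q hq => hq.1, csInf_le hb hpT, ?_, hmin⟩
  by_contra hn
  obtain ⟨z, h1, h2⟩ := exists_forall_not_bad_right hn
  obtain ⟨q, hq, hqz⟩ := exists_lt_of_csInf_lt ⟨p, hpT⟩ h1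
  rcases (csInf_le hb hq).eq_or_lt with h3 | h3
  · exact hn (h3 ▸ hq.2)
  · exact h2 q h3 hqz (Or.inl hq.2)

theorem exists_last_lBad (hp : LBad φ h x y p) (hpv : p ≤ v) :
    ∃ b, b ≤ v ∧ p ≤ b ∧ LBad φ h x y b ∧ ∀ q, b < q → q ≤ v → ¬ LBad φ h x y q := by
  set T : Set ℝ := {q | q ≤ v ∧ LBad φ h x y q} with hT
  have hb : BddAbove T := ⟨v, fun q hq => hq.1⟩
  have hpT : p ∈ T := ⟨hpv, hp⟩
  have hmax : ∀ q, sSup T < q → q ≤ v → ¬ LBad φ h x y q := fun q h1 h2 h3 =>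
    absurd (le_csSup hb ⟨h2, h3⟩) (not_le.2 h1)
  refine ⟨sSup T, csSup_le ⟨p, hpT⟩ fun q hq => hq.1, le_csSup hb hpT, ?_, hmax⟩
  by_contra hn
  obtain ⟨z, h1, h2⟩ := exists_forall_not_bad_left hn
  obtain ⟨q, hq, hqz⟩ := exists_lt_of_lt_csSup ⟨p, hpT⟩ h1
  rcases (le_csSup hb hq).eq_or_lt with h3 | h3
  · exact hn (h3 ▸ hq.2)
  · exact h2 q hqz h3 (Or.inr hq.2)

theorem RBad.mem_of_until (hp : RBad φ h x y p) {α β : Formula Atom}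
    (hU : U α β ∈ label φ h p) : β ∈ coverOf φ h x y := by
  obtain ⟨hCl, w, h1, -, h2⟩ := hU
  rw [← hp.2.2 (min w y) (lt_min h1 hp.2.1) (min_le_right _ _)]
  exact ⟨mem_Cl_of_mem_subformulas ((isTemporal_U φ).right_mem hCl), fun z hz1 hz2 =>
    h2 z hz1 (hz2.trans_le (min_le_left _ _))⟩

theorem LBad.mem_of_since (hp : LBad φ h x y p) {α β : Formula Atom}
    (hS : S α β ∈ label φ h p) : β ∈ coverOf φ h x y := by
  obtain ⟨hCl, w, h1, -, h2⟩ := hS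
  rw [← hp.2.2 (max w x) (le_max_right _ _) (max_lt h1 hp.1)]
  exact ⟨mem_Cl_of_mem_subformulas ((isTemporal_S φ).right_mem hCl), fun z hz1 hz2 =>
    h2 z (lt_of_le_of_lt (le_max_left _ _) hz1) hz2⟩

theorem Reduction.join (hX : Reduction φ h x y X) (hu : x ≤ u) (huz : u < z) (hzv : z < v)
    (hv : v ≤ y) (h1 : mos φ h u z ∈ X) (h2 : mos φ h z v ∈ X) : mos φ h u v ∈ X := by
  refine hX.mem_of_compositionsFrom u v hu (huz.trans hzv) hv ?_
  rw [← mos_comp huz hzv]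
  exact comp_mem_compositionsFrom (subset_compositionsFrom (mos_isMosaic φ h huz) h1)
    (subset_compositionsFrom (mos_isMosaic φ h hzv) h2) rfl

/-- An interval without bad points can be cut into finitely many pieces with larger covers. -/
theorem Reduction.mos_mem (hX : Reduction φ h x y X) (hu : x ≤ u) (huv : u < v) (hv : v ≤ y)
    (hR : ∀ p, u ≤ p → p < v → ¬ RBad φ h x y p) (hL : ∀ p, u < p → p ≤ v → ¬ LBad φ h x y p) :
    mos φ h u v ∈ X := by
  -- the set of points that can be reached from `u`; its supremum belongs to it since it is not
  -- left-bad, and equals `v` since it would otherwise have to be right-bad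
  set T : Set ℝ := {t | u ≤ t ∧ t ≤ v ∧ (t = u ∨ mos φ h u t ∈ X)} with hT
  have huT : u ∈ T := ⟨le_rfl, huv.le, Or.inl rfl⟩
  have hb : BddAbove T := ⟨v, fun q hq => hq.2.1⟩
  have hus : u ≤ sSup T := le_csSup hb huT
  have hsv : sSup T ≤ v := csSup_le ⟨u, huT⟩ fun q hq => hq.2.1
  have hmem : sSup T ∈ T := by
    rcases hus.eq_or_lt with h1 | h1
    · rw [← h1]; exact huT
    have h2 := hL _ h1 hsv
    simp only [LBad, hu.trans_lt h1, hsv.trans hv, true_and] at h2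
    push Not at h2
    obtain ⟨z, h3, h4, h5⟩ := h2
    obtain ⟨t, ht, htz⟩ := exists_lt_of_lt_csSup ⟨u, huT⟩ (max_lt h1 h4)
    have hut : u < t := (le_max_left _ _).trans_lt htz
    have hzt : z < t := (le_max_right _ _).trans_lt htz
    rcases (le_csSup hb ht).eq_or_lt with h6 | h6
    · rw [← h6]; exact ht
    have h7 : mos φ h t (sSup T) ∈ X := by
      refine hX.mem_of_coverOf_ne _ _ (hu.trans hut.le) h6 (hsv.trans hv) fun h8 => h5 ?_
      exact coverOf_eq_of_subset h3 hzt.le le_rfl (hsv.trans hv) h8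
    have h8 : mos φ h u t ∈ X := ht.2.2.resolve_left hut.ne'
    exact ⟨hus, hsv, Or.inr (hX.join hu hut h6 (hsv.trans hv) h8 h7)⟩
  rcases hsv.eq_or_lt with h1 | h1
  · rw [h1] at hmem
    exact hmem.2.2.resolve_left huv.ne'
  · exfalso
    have h2 := hR _ hus h1
    simp only [RBad, hu.trans hus, h1.trans_le hv, true_and] at h2
    push Not at h2
    obtain ⟨z, h3, h4, h5⟩ := h2
    have h6 : sSup T < min z v := lt_min h3 h1
    have h7 : mos φ h (sSup T) (min z v) ∈ X := by
      refine hX.mem_of_coverOf_ne _ _ (hu.trans hus) h6 ((min_le_left _ _).trans h4)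
        fun h8 => h5 ?_
      exact coverOf_eq_of_subset (hu.trans hus) le_rfl (min_le_left _ _) h4 h8
    have h8 : min z v ∈ T := by
      refine ⟨hus.trans h6.le, min_le_right _ _, Or.inr ?_⟩
      rcases hmem.2.2 with h9 | h9
      · rwa [h9] at h7
      · rcases hus.eq_or_lt with h10 | h10
        · rwa [← h10] at h7
        · exact hX.join hu h10 h6 ((min_le_left _ _).trans h4) h9 h7
    exact absurd (le_csSup hb h8) (not_le.2 h6)

end Bad

/-! ### Loops -/

/-- A subinterval `[e, e']` of `[x, y]` with equal labels at its ends that has the cover of `[x, y]`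
and all of whose subintervals have mosaics in `X`. -/
structure Loop (φ : Formula Atom) (h : Atom → Set ℝ) (x y : ℝ) (X : Set (Triple Atom))
    (e e' : ℝ) : Prop where
  left : x < e
  lt : e < e'
  right : e' < y
  label_eq : label φ h e = label φ h e'
  cover_eq : coverOf φ h e e' = coverOf φ h x y
  mem : ∀ a b, e ≤ a → a < b → b ≤ e' → mos φ h a b ∈ X

section Loop

variable {φ : Formula Atom} {h : Atom → Set ℝ} {x y u v p e e' : ℝ} {X : Set (Triple Atom)}

theorem finite_range_label (φ : Formula Atom) (h : Atom → Set ℝ) :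
    (Set.range (label φ h)).Finite :=
  φ.Cl_finite.finite_subsets.subset fun _ ⟨_, hx⟩ => hx ▸ fun _ hχ => hχ.1

open Filter Topology in
/-- The finitely many defects of the cover that occur between `u` and a left-bad point already occur
before some earlier point. -/
theorem LBad.exists_coverOf_eq (hp : LBad φ h x y p) (hu : x ≤ u) (hup : u < p) :
    ∃ v, u < v ∧ v < p ∧ coverOf φ h u v = coverOf φ h x y := by
  have h1 := hp.2.2 u hu hup
  have hfin : (φ.Cl \ coverOf φ h x y).Finite := φ.Cl_finite.subset Set.sdiff_subset
  have h2 : ∀ᶠ v in 𝓝[<] p, ∀ β ∈ φ.Cl \ coverOf φ h x y, ∃ z, u < z ∧ z < v ∧ ¬ Sat h z β := by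
    rw [hfin.eventually_all]
    rintro β ⟨h3, h4⟩
    rw [← h1] at h4
    simp only [coverOf, Set.mem_ofPred_eq, h3, true_and] at h4
    push Not at h4
    obtain ⟨z, h5, h6, h7⟩ := h4
    filter_upwards [mem_nhdsWithin_of_mem_nhds (lt_mem_nhds h6)] with v hv
    exact ⟨z, h5, hv, h7⟩
  obtain ⟨v, h3, h4, h5⟩ := (h2.and ((eventually_nhdsWithin_of_eventually_nhds
    (eventually_gt_nhds hup)).and eventually_mem_nhdsWithin)).exists
  refine ⟨v, h4, h5, Set.Subset.antisymm (fun β hβ => ?_)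
    (coverOf_anti hu (h5.le.trans hp.2.1))⟩
  by_contra hn
  obtain ⟨z, h6, h7, h8⟩ := h3 β ⟨hβ.1, hn⟩
  exact h8 (hβ.2 z h6 h7)

open Filter Topology in
theorem RBad.exists_coverOf_eq (hp : RBad φ h x y p) (hv : v ≤ y) (hpv : p < v) :
    ∃ u, p < u ∧ u < v ∧ coverOf φ h u v = coverOf φ h x y := by
  have h1 := hp.2.2 v hpv hv
  have hfin : (φ.Cl \ coverOf φ h x y).Finite := φ.Cl_finite.subset Set.sdiff_subset
  have h2 : ∀ᶠ u in 𝓝[>] p, ∀ β ∈ φ.Cl \ coverOf φ h x y, ∃ z, u < z ∧ z < v ∧ ¬ Sat h z β := by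
    rw [hfin.eventually_all]
    rintro β ⟨h3, h4⟩
    rw [← h1] at h4
    simp only [coverOf, Set.mem_ofPred_eq, h3, true_and] at h4
    push Not at h4
    obtain ⟨z, h5, h6, h7⟩ := h4
    filter_upwards [mem_nhdsWithin_of_mem_nhds (gt_mem_nhds h5)] with u hu
    exact ⟨z, hu, h6, h7⟩
  obtain ⟨u, h3, h4, h5⟩ := (h2.and ((eventually_nhdsWithin_of_eventually_nhds
    (eventually_lt_nhds hpv)).and eventually_mem_nhdsWithin)).exists
  refine ⟨u, h5, h4, Set.Subset.antisymm (fun β hβ => ?_)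
    (coverOf_anti (hp.1.trans h5.le) hv)⟩
  by_contra hn
  obtain ⟨z, h6, h7, h8⟩ := h3 β ⟨hβ.1, hn⟩
  exact h8 (hβ.2 z h6 h7)

/-- A left-bad point that is not a limit of bad points from the left is preceded by loops: among
infinitely many points between which everything recurs, two have the same label. -/
theorem Reduction.exists_loop_left (hX : Reduction φ h x y X) (hp : LBad φ h x y p) (hu : x ≤ u)
    (hup : u < p) (hfree : ∀ q, u < q → q < p → ¬ Bad φ h x y q) :
    ∃ e e', u < e ∧ e' < p ∧ Loop φ h x y X e e' := by
  have hstep : ∀ t : Set.Ioo u p, ∃ t' : Set.Ioo u p, t < t' ∧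
      coverOf φ h t t' = coverOf φ h x y := by
    rintro ⟨t, h1, h2⟩
    obtain ⟨v, h3, h4, h5⟩ := hp.exists_coverOf_eq (hu.trans h1.le) h2
    exact ⟨⟨v, h1.trans h3, h4⟩, h3, h5⟩
  choose f hf1 hf2 using hstep
  obtain ⟨t₀, h1, h2⟩ := exists_between hup
  set g : ℕ → Set.Ioo u p := fun n => f^[n] ⟨t₀, h1, h2⟩ with hg
  have hgs : ∀ n, g (n + 1) = f (g n) := fun n => Function.iterate_succ_apply' f n _
  have hmono : StrictMono g := strictMono_nat_of_lt_succ fun n => by rw [hgs]; exact hf1 _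
  have : Finite (Set.range (label φ h)) := (finite_range_label φ h).to_subtype
  obtain ⟨i, j, hij, heq⟩ := Finite.exists_ne_map_eq_of_infinite
    fun n => (⟨label φ h (g n), Set.mem_range_self _⟩ : Set.range (label φ h))
  wlog hlt : i < j generalizing i j
  · exact this j i hij.symm heq.symm (lt_of_le_of_ne (not_lt.1 hlt) hij.symm)
  have hgi := (g i).2
  have hgj := (g j).2
  refine ⟨g i, g j, hgi.1, hgj.2, hu.trans_lt hgi.1, hmono hlt, hgj.2.trans_le hp.2.1,
    congrArg Subtype.val heq, ?_, fun a b h3 h4 h5 => ?_⟩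
  · refine coverOf_eq_of_subset (hu.trans hgi.1.le) le_rfl ?_ (hgj.2.le.trans hp.2.1)
      (hf2 (g i))
    rw [← hgs]
    exact hmono.monotone (Nat.succ_le_of_lt hlt)
  · exact hX.mos_mem (hu.trans (hgi.1.le.trans h3)) h4 (h5.trans (hgj.2.le.trans hp.2.1))
      (fun q hq1 hq2 hq => hfree q (hgi.1.trans_le (h3.trans hq1))
        (hq2.trans_le (h5.trans hgj.2.le)) (Or.inl hq))
      (fun q hq1 hq2 hq => hfree q (hgi.1.trans_le (h3.trans hq1.le))
        (lt_of_le_of_lt (hq2.trans h5) hgj.2) (Or.inr hq))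

theorem Reduction.exists_loop_right (hX : Reduction φ h x y X) (hp : RBad φ h x y p) (hv : v ≤ y)
    (hpv : p < v) (hfree : ∀ q, p < q → q < v → ¬ Bad φ h x y q) :
    ∃ e e', p < e ∧ e' < v ∧ Loop φ h x y X e e' := by
  have hstep : ∀ t : Set.Ioo p v, ∃ t' : Set.Ioo p v, t' < t ∧
      coverOf φ h t' t = coverOf φ h x y := by
    rintro ⟨t, h1, h2⟩
    obtain ⟨u, h3, h4, h5⟩ := hp.exists_coverOf_eq (h2.le.trans hv) h1
    exact ⟨⟨u, h3, h4.trans h2⟩, h4, h5⟩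
  choose f hf1 hf2 using hstep
  obtain ⟨t₀, h1, h2⟩ := exists_between hpv
  set g : ℕ → Set.Ioo p v := fun n => f^[n] ⟨t₀, h1, h2⟩ with hg
  have hgs : ∀ n, g (n + 1) = f (g n) := fun n => Function.iterate_succ_apply' f n _
  have hanti : StrictAnti g := strictAnti_nat_of_succ_lt fun n => by rw [hgs]; exact hf1 _
  have : Finite (Set.range (label φ h)) := (finite_range_label φ h).to_subtype
  obtain ⟨i, j, hij, heq⟩ := Finite.exists_ne_map_eq_of_infinite
    fun n => (⟨label φ h (g n), Set.mem_range_self _⟩ : Set.range (label φ h))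
  wlog hlt : i < j generalizing i j
  · exact this j i hij.symm heq.symm (lt_of_le_of_ne (not_lt.1 hlt) hij.symm)
  have hgi := (g i).2
  have hgj := (g j).2
  refine ⟨g j, g i, hgj.1, hgi.2, hp.1.trans_lt hgj.1, hanti hlt, hgi.2.trans_le hv,
    (congrArg Subtype.val heq).symm, ?_, fun a b h3 h4 h5 => ?_⟩
  · refine coverOf_eq_of_subset (hp.1.trans hgj.1.le) ?_ le_rfl (hgi.2.le.trans hv)
      (hf2 (g i))
    rw [← hgs]
    exact hanti.antitone (Nat.succ_le_of_lt hlt)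
  · exact hX.mos_mem (hp.1.trans (hgj.1.le.trans h3)) h4 (h5.trans (hgi.2.le.trans hv))
      (fun q hq1 hq2 hq => hfree q (hgj.1.trans_le (h3.trans hq1))
        (hq2.trans_le (h5.trans hgi.2.le)) (Or.inl hq))
      (fun q hq1 hq2 hq => hfree q (hgj.1.trans_le (h3.trans hq1.le))
        (lt_of_le_of_lt (hq2.trans h5) hgi.2) (Or.inr hq))

/-- Labels of points of `[x, y]` can be combined into mosaics irrespective of the order of the
points, as long as everything recurs after the first and before the second. -/
theorem mixed_isMosaic (hxy : x < y) (hu : x ≤ u) (huy : u < y) (hv : v ≤ y) (hxv : x < v)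
    (h1 : coverOf φ h u y = coverOf φ h x y) (h2 : coverOf φ h x v = coverOf φ h x y) :
    IsMosaic φ ⟨label φ h u, coverOf φ h x y, label φ h v⟩ := by
  have hxym := mos_isMosaic φ h hxy
  have hU : Coh U (label φ h u) (coverOf φ h x y) (label φ h v) := by
    have := (mos_isMosaic φ h huy).coh_U
    simp only [mos, h1] at this
    rcases hv.eq_or_lt with rfl | hv
    · exact this
    · exact this.of_subset fun β hβ => mem_label_of_mem_coverOf hβ hxv hv
  have hS : Coh S (label φ h v) (coverOf φ h x y) (label φ h u) := by
    have := (mos_isMosaic φ h hxv).coh_S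
    simp only [mos, h2] at this
    rcases hu.eq_or_lt with rfl | hu
    · exact this
    · exact this.of_subset fun β hβ => mem_label_of_mem_coverOf hβ hu huy
  exact ⟨label_isMPC φ h u, label_isMPC φ h v, fun _ hβ => hβ.1, hxym.cover_neg, hU.neg_mem,
    hU.mem, hS.neg_mem, hS.mem⟩

/-- A loop can be cut into a sequence that visits all that is not excluded by the cover and that
cures the formulas of its end label not to be dealt with by means of the cover. -/
theorem Loop.exists_cuts (hl : Loop φ h x y X e e') : ∃ σ, ComposesTo σ (mos φ h e e') ∧
    (∀ c ∈ σ, ∃ a b, e ≤ a ∧ a < b ∧ b ≤ e' ∧ c = mos φ h a b) ∧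
    (∀ β ∈ φ.Cl, sim β ∉ coverOf φ h x y → ∃ c ∈ σ.dropLast, β ∈ c.finish) ∧
    (∀ α β, U α β ∈ label φ h e → β ∈ coverOf φ h x y ∨
      ∃ l₁ c l₂, σ = l₁ ++ c :: l₂ ∧ α ∈ c.finish ∧ β ∈ c.cover ∧
        ∀ z ∈ l₁, β ∈ z.cover ∧ β ∈ z.finish) ∧
    (∀ α β, S α β ∈ label φ h e' → β ∈ coverOf φ h x y ∨
      ∃ l₁ c l₂, σ = l₁ ++ c :: l₂ ∧ α ∈ c.start ∧ β ∈ c.cover ∧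
        ∀ z ∈ l₂, β ∈ z.cover ∧ β ∈ z.start) := by
  classical
  -- cut at a witness for each formula not excluded by the cover, and at witnesses in the loop for
  -- the formulas `U α β` of its start and `S α β` of its end
  have hf : ∀ β, ∃ w, β ∈ φ.Cl → sim β ∉ coverOf φ h x y → e < w ∧ w < e' ∧ Sat h w β := by
    intro β
    by_cases hβ : β ∈ φ.Cl ∧ sim β ∉ coverOf φ h x y
    · have h1 := hβ.2
      rw [← hl.cover_eq] at h1
      simp only [coverOf, Set.mem_ofPred_eq, sim_mem_Cl hβ.1, true_and, sat_sim] at h1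
      push Not at h1
      obtain ⟨w, h2, h3, h4⟩ := h1
      exact ⟨w, fun _ _ => ⟨h2, h3, h4⟩⟩
    · exact ⟨0, fun h1 h2 => absurd ⟨h1, h2⟩ hβ⟩
  have hg : ∀ χ, ∃ w, ∀ α β, χ = U α β →
      (∃ w, e < w ∧ w < e' ∧ Sat h w α ∧ ∀ z, e < z → z < w → Sat h z β) →
      e < w ∧ w < e' ∧ Sat h w α ∧ ∀ z, e < z → z < w → Sat h z β := by
    intro χ
    by_cases hχ : ∃ α β, χ = U α β ∧
        ∃ w, e < w ∧ w < e' ∧ Sat h w α ∧ ∀ z, e < z → z < w → Sat h z β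
    · obtain ⟨α, β, rfl, w, hw⟩ := hχ
      refine ⟨w, fun α' β' h1 _ => ?_⟩
      cases h1; exact hw
    · exact ⟨0, fun α β h1 h2 => absurd ⟨α, β, h1, h2⟩ hχ⟩
  have hk : ∀ χ, ∃ w, ∀ α β, χ = S α β →
      (∃ w, e < w ∧ w < e' ∧ Sat h w α ∧ ∀ z, w < z → z < e' → Sat h z β) →
      e < w ∧ w < e' ∧ Sat h w α ∧ ∀ z, w < z → z < e' → Sat h z β := by
    intro χ
    by_cases hχ : ∃ α β, χ = S α β ∧
        ∃ w, e < w ∧ w < e' ∧ Sat h w α ∧ ∀ z, w < z → z < e' → Sat h z β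
    · obtain ⟨α, β, rfl, w, hw⟩ := hχ
      refine ⟨w, fun α' β' h1 _ => ?_⟩
      cases h1; exact hw
    · exact ⟨0, fun α β h1 h2 => absurd ⟨α, β, h1, h2⟩ hχ⟩
  choose f hf using hf
  choose g hg using hg
  choose k hk using hk
  set C := φ.Cl_finite.toFinset with hC
  obtain ⟨σ, h1, h2, h3⟩ := RTL.exists_cuts φ h _ (C.image f ∪ (C.image g ∪ C.image k)) le_rfl
    e e' hl.lt
  refine ⟨σ, h1, h2, fun β hβ hn => ?_, fun α β hU => ?_, fun α β hS => ?_⟩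
  · obtain ⟨h4, h5, h6⟩ := hf β hβ hn
    obtain ⟨σ₁, σ₂, rfl, h7, h8⟩ := h3 (f β) (Finset.mem_union_left _
      (Finset.mem_image_of_mem f (by simpa [hC] using hβ))) h4 h5
    have h9 := (composesTo_iff.1 h7).1
    have hp := (composesTo_iff.1 h7).2.1
    rw [← List.dropLast_append_getLast h9, isPath_append] at hp
    obtain ⟨D, -, -, hD⟩ := hp
    refine ⟨σ₁.getLast h9, ?_, hD ▸ ⟨hβ, h6⟩⟩
    rw [List.dropLast_append_of_ne_nil (composesTo_iff.1 h8).1]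
    exact List.mem_append_left _ (List.getLast_mem h9)
  · have hβ := mem_Cl_of_mem_subformulas ((isTemporal_U φ).right_mem hU.1)
    have hα := mem_Cl_of_mem_subformulas ((isTemporal_U φ).left_mem hU.1)
    obtain ⟨w, h4, h5, h6⟩ := hU.2
    rcases lt_trichotomy w e' with hw | rfl | hw
    · obtain ⟨h7, h8, h9, h10⟩ := hg (U α β) α β rfl ⟨w, h4, hw, h5, h6⟩
      obtain ⟨σ₁, σ₂, rfl, h11, -⟩ := h3 (g (U α β)) (Finset.mem_union_right _
        (Finset.mem_union_left _ (Finset.mem_image_of_mem g (by simpa [hC] using hU.1)))) h7 h8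
      obtain ⟨τ, c, rfl, h12, h13, h14⟩ := h11.exists_concat (α := α) (β := β) ⟨hβ, h10⟩ ⟨hα, h9⟩
      exact Or.inr ⟨τ, c, σ₂, by simp, h12, h13, h14⟩
    · obtain ⟨τ, c, rfl, h12, h13, h14⟩ := h1.exists_concat (α := α) (β := β) ⟨hβ, h6⟩ ⟨hα, h5⟩
      exact Or.inr ⟨τ, c, [], by simp, h12, h13, h14⟩
    · left
      rw [← hl.cover_eq]
      exact ⟨hβ, fun z hz1 hz2 => h6 z hz1 (hz2.trans hw)⟩
  · have hβ := mem_Cl_of_mem_subformulas ((isTemporal_S φ).right_mem hS.1)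
    have hα := mem_Cl_of_mem_subformulas ((isTemporal_S φ).left_mem hS.1)
    obtain ⟨w, h4, h5, h6⟩ := hS.2
    rcases lt_trichotomy w e with hw | rfl | hw
    · left
      rw [← hl.cover_eq]
      exact ⟨hβ, fun z hz1 hz2 => h6 z (hw.trans hz1) hz2⟩
    · obtain ⟨c, τ, rfl, h12, h13, h14⟩ := h1.exists_cons (α := α) (β := β) ⟨hβ, h6⟩ ⟨hα, h5⟩
      exact Or.inr ⟨[], c, τ, by simp, h12, h13, h14⟩
    · obtain ⟨h7, h8, h9, h10⟩ := hk (S α β) α β rfl ⟨w, hw, h4, h5, h6⟩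
      obtain ⟨σ₁, σ₂, rfl, -, h11⟩ := h3 (k (S α β)) (Finset.mem_union_right _
        (Finset.mem_union_right _ (Finset.mem_image_of_mem k (by simpa [hC] using hS.1)))) h7 h8
      obtain ⟨c, τ, rfl, h12, h13, h14⟩ := h11.exists_cons (α := α) (β := β) ⟨hβ, h10⟩ ⟨hα, h9⟩
      exact Or.inr ⟨σ₁, c, τ, by simp, h12, h13, h14⟩

/-- A mosaic from the label of a loop to a left-bad point can be decomposed by the tactic trail,
with the loop as the sequence that is repeated. -/
theorem Loop.trail_mem (hl : Loop φ h x y X e e') (hv : LBad φ h x y v) :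
    (⟨label φ h e, coverOf φ h x y, label φ h v⟩ : Triple Atom) ∈ leadTrailStep φ X := by
  have hxy := hl.left.trans (hl.lt.trans hl.right)
  have hm : IsMosaic φ ⟨label φ h e, coverOf φ h x y, label φ h v⟩ :=
    mixed_isMosaic hxy hl.left.le (hl.lt.trans hl.right) hv.2.1 hv.1
      (coverOf_eq_of_subset hl.left.le le_rfl hl.right.le le_rfl hl.cover_eq)
      (hv.2.2 x le_rfl hv.1)
  obtain ⟨σ, h1, h2, h3, h4, h5⟩ := hl.exists_cuts
  obtain ⟨hne, hpath, -⟩ := composesTo_iff.1 h1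
  refine subset_compositionsFrom hm (Or.inr ⟨σ, fun c hc => ?_, Or.inr ⟨hne, ?_⟩⟩)
  · obtain ⟨a, b, h6, h7, h8, rfl⟩ := h2 c hc
    exact hl.mem a b h6 h7 h8
  refine isFullDecomposition_of_visits hm (fun c hc => ?_) ?_ (fun α β hU => ?_)
    (fun α β hS => Or.inl (hv.mem_of_since hS)) (fun β hβ hn => ?_)
  · rcases List.mem_append.1 hc with hc | hc
    · obtain ⟨a, b, h6, h7, h8, rfl⟩ := h2 c hc
      exact mos_isMosaic φ h h7
    · rw [List.mem_singleton.1 hc]; exact hm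
  · refine IsPath.composesTo (IsPath.append hpath (isPath_singleton.2 ⟨hl.label_eq, rfl⟩))
      (fun c hc => ?_) (fun c hc => ?_) ⟨_, List.mem_append_right _ (List.mem_singleton_self _), rfl⟩
    · rcases List.mem_append.1 hc with hc | hc
      · obtain ⟨a, b, h6, h7, h8, rfl⟩ := h2 c hc
        exact coverOf_anti (hl.left.le.trans h6) (h8.trans hl.right.le)
      · rw [List.mem_singleton.1 hc]
    · rw [List.dropLast_concat] at hc
      obtain ⟨a, b, h6, h7, h8, rfl⟩ := h2 c hc
      exact fun β hβ => mem_label_of_mem_coverOf hβ ((hl.left.trans_le h6).trans h7)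
        (h8.trans_lt hl.right)
  · rcases h4 α β hU with h6 | ⟨l₁, c, l₂, rfl, h6, h7, h8⟩
    · exact Or.inl h6
    · exact Or.inr ⟨l₁, c, _, by rw [List.append_assoc]; rfl, by simp, h6, h7, h8⟩
  · rw [List.dropLast_concat]
    obtain ⟨c, hc, hc'⟩ := h3 β hβ hn
    exact ⟨c, List.mem_of_mem_dropLast hc, hc'⟩

/-- The mirror image of `Loop.trail_mem`: the loop is repeated by the tactic lead. -/
theorem Loop.lead_mem (hl : Loop φ h x y X e e') (hu : RBad φ h x y u) :
    (⟨label φ h u, coverOf φ h x y, label φ h e'⟩ : Triple Atom) ∈ leadTrailStep φ X := by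
  have hxy := hl.left.trans (hl.lt.trans hl.right)
  have hm : IsMosaic φ ⟨label φ h u, coverOf φ h x y, label φ h e'⟩ :=
    mixed_isMosaic hxy hu.1 hu.2.1 hl.right.le (hl.left.trans hl.lt) (hu.2.2 y hu.2.1 le_rfl)
      (coverOf_eq_of_subset le_rfl hl.left.le le_rfl hl.right.le hl.cover_eq)
  obtain ⟨σ, h1, h2, h3, h4, h5⟩ := hl.exists_cuts
  obtain ⟨hne, hpath, -⟩ := composesTo_iff.1 h1
  have hpath' : IsPath (label φ h e') σ (label φ h e') := by
    simpa only [mos, hl.label_eq] using hpath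
  refine subset_compositionsFrom hm (Or.inr ⟨σ, fun c hc => ?_, Or.inl ⟨hne, ?_⟩⟩)
  · obtain ⟨a, b, h6, h7, h8, rfl⟩ := h2 c hc
    exact hl.mem a b h6 h7 h8
  refine isFullDecomposition_of_visits hm (fun c hc => ?_) ?_
    (fun α β hU => Or.inl (hu.mem_of_until hU)) (fun α β hS => ?_) (fun β hβ hn => ?_)
  · rcases List.mem_cons.1 hc with rfl | hc
    · exact hm
    · obtain ⟨a, b, h6, h7, h8, rfl⟩ := h2 c hc
      exact mos_isMosaic φ h h7
  · refine IsPath.composesTo ⟨rfl, hpath'⟩ (fun c hc => ?_) (fun c hc => ?_)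
      ⟨_, List.mem_cons_self, rfl⟩
    · rcases List.mem_cons.1 hc with rfl | hc
      · exact subset_rfl
      · obtain ⟨a, b, h6, h7, h8, rfl⟩ := h2 c hc
        exact coverOf_anti (hl.left.le.trans h6) (h8.trans hl.right.le)
    · rw [List.dropLast_cons_of_ne_nil hne, List.mem_cons] at hc
      rcases hc with rfl | hc
      · exact fun β hβ => mem_label_of_mem_coverOf hβ (hl.left.trans hl.lt) hl.right
      · obtain ⟨a, b, h6, h7, h8, rfl⟩ := h2 c (List.mem_of_mem_dropLast hc)
        exact fun β hβ => mem_label_of_mem_coverOf hβ ((hl.left.trans_le h6).trans h7)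
          (h8.trans_lt hl.right)
  · rcases h5 α β hS with h6 | ⟨l₁, c, l₂, rfl, h6, h7, h8⟩
    · exact Or.inl h6
    · exact Or.inr ⟨_ :: l₁, c, l₂, rfl, by simp, h6, h7, h8⟩
  · rw [List.dropLast_cons_of_ne_nil hne]
    obtain ⟨c, hc, hc'⟩ := h3 β hβ hn
    exact ⟨c, List.mem_cons_of_mem _ hc, hc'⟩

/-- An interval without right-bad points: up to its last left-bad point it is obtained by the
tactic trail from a loop before the first left-bad point. -/
theorem Reduction.mos_mem_of_not_rBad (hX : Reduction φ h x y X) (hu : x ≤ u) (huv : u < v)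
    (hv : v ≤ y) (hR : ∀ p, u ≤ p → p < v → ¬ RBad φ h x y p) :
    mos φ h u v ∈ leadTrailStep φ X := by
  by_cases hL : ∃ p, u < p ∧ p ≤ v ∧ LBad φ h x y p
  · obtain ⟨p, hp1, hp2, hp⟩ := hL
    obtain ⟨w, hw1, hw2, hw, hw3⟩ := exists_last_lBad hp hp2
    have huw := hp1.trans_le hw2
    obtain ⟨k, hk1, hk2, hk, hk3⟩ := exists_next_bad (hR u le_rfl huv) huw (Or.inr hw)
    have hkL : LBad φ h x y k := by
      rcases hk2.eq_or_lt with rfl | hlt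
      · exact hw
      · exact hk.resolve_left (hR k hk1.le (hlt.trans_le hw1))
    obtain ⟨e, e', he, he', hl⟩ := hX.exists_loop_left hkL hu hk1 hk3
    have hek : e < k := hl.lt.trans he'
    have h1 : mos φ h u e ∈ X := hX.mos_mem hu he (hl.lt.le.trans hl.right.le)
      (fun q hq1 hq2 => hR q hq1 (hq2.trans (hek.trans_le (hk2.trans hw1))))
      (fun q hq1 hq2 hq => hk3 q hq1 (hq2.trans_lt hek) (Or.inr hq))
    have h2 : mos φ h u w = (mos φ h u e).comp ⟨label φ h e, coverOf φ h x y, label φ h w⟩ := by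
      ext β
      · rfl
      · simp only [mos, Triple.comp, hw.2.2 u hu huw, Set.mem_inter_iff]
        refine ⟨fun hβ => ⟨⟨?_, ?_⟩, hβ⟩, fun hβ => hβ.2⟩
        · exact coverOf_anti hu (hl.lt.le.trans hl.right.le) hβ
        · exact mem_label_of_mem_coverOf hβ hl.left (hl.lt.trans hl.right)
      · rfl
    have h3 : mos φ h u w ∈ leadTrailStep φ X := by
      rw [h2]
      exact comp_mem_compositionsFrom (subset_leadTrailStep (mos_isMosaic φ h he) h1)
        (hl.trail_mem hw) rfl
    rcases hw1.eq_or_lt with rfl | hw1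
    · exact h3
    · rw [← mos_comp huw hw1]
      exact comp_mem_compositionsFrom h3 (subset_leadTrailStep (mos_isMosaic φ h hw1)
        (hX.mos_mem (hu.trans huw.le) hw1 hv (fun q hq1 => hR q (huw.le.trans hq1)) hw3)) rfl
  · push Not at hL
    exact subset_leadTrailStep (mos_isMosaic φ h huv) (hX.mos_mem hu huv hv hR hL)

theorem Reduction.mos_mem_of_not_lBad (hX : Reduction φ h x y X) (hu : x ≤ u) (huv : u < v)
    (hv : v ≤ y) (hL : ∀ p, u < p → p ≤ v → ¬ LBad φ h x y p) :
    mos φ h u v ∈ leadTrailStep φ X := by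
  by_cases hR : ∃ p, u ≤ p ∧ p < v ∧ RBad φ h x y p
  · obtain ⟨p, hp1, hp2, hp⟩ := hR
    obtain ⟨w, hw1, hw2, hw, hw3⟩ := exists_first_rBad hp hp1
    have hwv := hw2.trans_lt hp2
    obtain ⟨k, hk1, hk2, hk, hk3⟩ := exists_prev_bad (hL v huv le_rfl) hwv (Or.inl hw)
    have hkR : RBad φ h x y k := by
      rcases hk2.eq_or_lt with rfl | hlt
      · exact hw
      · exact hk.resolve_right (hL k (hw1.trans_lt hlt) hk1.le)
    obtain ⟨e, e', he, he', hl⟩ := hX.exists_loop_right hkR hv hk1 hk3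
    have hek : k < e' := he.trans hl.lt
    have h1 : mos φ h e' v ∈ X := hX.mos_mem (hl.left.le.trans hl.lt.le) he' hv
      (fun q hq1 hq2 hq => hk3 q (hek.trans_le hq1) hq2 (Or.inl hq))
      (fun q hq1 hq2 => hL q (((hw1.trans hk2).trans_lt hek).trans hq1) hq2)
    have h2 : mos φ h w v = (⟨label φ h w, coverOf φ h x y, label φ h e'⟩ : Triple Atom).comp
        (mos φ h e' v) := by
      ext β
      · rfl
      · simp only [mos, Triple.comp, hw.2.2 v hwv hv, Set.mem_inter_iff]
        refine ⟨fun hβ => ⟨⟨hβ, ?_⟩, ?_⟩, fun hβ => hβ.1.1⟩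
        · exact mem_label_of_mem_coverOf hβ (hl.left.trans hl.lt) hl.right
        · exact coverOf_anti (hl.left.le.trans hl.lt.le) hv hβ
      · rfl
    have h3 : mos φ h w v ∈ leadTrailStep φ X := by
      rw [h2]
      exact comp_mem_compositionsFrom (hl.lead_mem hw)
        (subset_leadTrailStep (mos_isMosaic φ h he') h1) rfl
    rcases hw1.eq_or_lt with rfl | hw1
    · exact h3
    · rw [← mos_comp hw1 hwv]
      exact comp_mem_compositionsFrom (subset_leadTrailStep (mos_isMosaic φ h hw1)
        (hX.mos_mem hu hw1 (hwv.le.trans hv) hw3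
          fun q hq1 hq2 => hL q hq1 (hq2.trans hwv.le))) h3 rfl
  · push Not at hR
    exact subset_leadTrailStep (mos_isMosaic φ h huv) (hX.mos_mem hu huv hv hR hL)

end Loop

/-! ### Points that are bad on both sides -/

open Topology in
/-- A non-empty closed set of reals without isolated points has a point that is a limit of the set
from both sides: the set is uncountable, but only countably many of its points are limits from
one side only. -/
theorem exists_bilateral_limit {C : Set ℝ} (hC : IsClosed C) (hne : C.Nonempty)
    (hlim : ∀ p ∈ C, (∀ z, p < z → ∃ k ∈ C, p < k ∧ k < z) ∨
      ∀ z, z < p → ∃ k ∈ C, z < k ∧ k < p) :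
    ∃ p ∈ C, (∀ z, p < z → ∃ k ∈ C, p < k ∧ k < z) ∧ ∀ z, z < p → ∃ k ∈ C, z < k ∧ k < p := by
  by_contra hn
  have hcount : C.Countable := by
    refine ((countable_setOfPred_isolated_right_within (s := C)).union
      (countable_setOfPred_isolated_left_within (s := C))).mono fun p hp => ?_
    by_cases h1 : ∀ z, p < z → ∃ k ∈ C, p < k ∧ k < z
    · have h2 : ¬ ∀ z, z < p → ∃ k ∈ C, z < k ∧ k < p := fun h2 => hn ⟨p, hp, h1, h2⟩
      push Not at h2
      obtain ⟨z, hz, h3⟩ := h2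
      refine Or.inr ⟨hp, Filter.empty_mem_iff_bot.1
        (mem_nhdsWithin.2 ⟨Set.Ioi z, isOpen_Ioi, hz, ?_⟩)⟩
      rintro k ⟨hk1, hk2, hk3⟩
      exact absurd hk3 (not_lt.2 (h3 k hk2 hk1))
    · push Not at h1
      obtain ⟨z, hz, h3⟩ := h1
      refine Or.inl ⟨hp, Filter.empty_mem_iff_bot.1
        (mem_nhdsWithin.2 ⟨Set.Iio z, isOpen_Iio, hz, ?_⟩)⟩
      rintro k ⟨hk1, hk2, hk3⟩
      exact absurd hk1 (not_lt.2 (h3 k hk2 hk3))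
  have hperf : Perfect C := by
    refine ⟨hC, preperfect_iff_nhds.2 fun p hp V hV => ?_⟩
    obtain ⟨l, r, hlr, hsub⟩ := mem_nhds_iff_exists_Ioo_subset.1 hV
    rcases hlim p hp with h1 | h1
    · obtain ⟨k, hk, h2, h3⟩ := h1 r hlr.2
      exact ⟨k, ⟨hsub ⟨hlr.1.trans h2, h3⟩, hk⟩, h2.ne'⟩
    · obtain ⟨k, hk, h2, h3⟩ := h1 l hlr.1
      exact ⟨k, ⟨hsub ⟨h2, h3.trans hlr.2⟩, hk⟩, h3.ne⟩
  -- a countable perfect set would make the Cantor space countable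
  obtain ⟨f, hf, -, hinj⟩ := hperf.exists_nat_bool_injection hne
  have : Countable C := hcount.to_subtype
  have hinj' : Function.Injective fun g => (⟨f g, hf ⟨g, rfl⟩⟩ : C) := fun g g' hgg =>
    hinj (congrArg Subtype.val hgg)
  have : Countable (ℕ → Bool) := hinj'.countable
  obtain ⟨g, hg⟩ := exists_surjective_nat (ℕ → Bool)
  obtain ⟨n, hn⟩ := hg fun n => !g n n
  have := congrFun hn n
  simp at this

section TwoSided

variable {φ : Formula Atom} {h : Atom → Set ℝ} {x y u v p z : ℝ} {X : Set (Triple Atom)}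

/-- In the absence of loops, right-bad points are limits of bad points from the right, and left-bad
points are limits of bad points from the left. Hence there is a limit from both sides, and such a
limit is bad on both sides. -/
theorem Reduction.exists_rBad_lBad (hX : Reduction φ h x y X)
    (hno : ∀ e e', ¬ Loop φ h x y X e e') (hu : RBad φ h x y u) (hv : LBad φ h x y v)
    (huv : u < v) : ∃ p, u < p ∧ p < v ∧ RBad φ h x y p ∧ LBad φ h x y p := by
  obtain ⟨p, hp, h1, h2⟩ := exists_bilateral_limit
    (C := {p | Bad φ h x y p} ∩ Set.Icc u v) ((isClosed_bad φ h x y).inter isClosed_Icc)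
    ⟨u, Or.inl hu, le_rfl, huv.le⟩ (by
      have hright : ∀ p, u ≤ p → p < v → RBad φ h x y p → ∀ z, p < z →
          ∃ k ∈ {p | Bad φ h x y p} ∩ Set.Icc u v, p < k ∧ k < z := by
        intro p h1 h2 hp z hz
        by_contra hn
        push Not at hn
        obtain ⟨e, e', -, -, hl⟩ := hX.exists_loop_right hp ((min_le_right z v).trans hv.2.1)
          (lt_min hz h2) fun q hq1 hq2 hq => absurd (hn q ⟨hq, h1.trans hq1.le,
            hq2.le.trans (min_le_right _ _)⟩ hq1) (not_le.2 (hq2.trans_le (min_le_left _ _)))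
        exact hno e e' hl
      have hleft : ∀ p, u < p → p ≤ v → LBad φ h x y p → ∀ z, z < p →
          ∃ k ∈ {p | Bad φ h x y p} ∩ Set.Icc u v, z < k ∧ k < p := by
        intro p h1 h2 hp z hz
        by_contra hn
        push Not at hn
        obtain ⟨e, e', -, -, hl⟩ := hX.exists_loop_left hp (hu.1.trans (le_max_right z u))
          (max_lt hz h1) fun q hq1 hq2 hq => absurd (hn q ⟨hq, (le_max_right _ _).trans hq1.le,
            hq2.le.trans h2⟩ ((le_max_left _ _).trans_lt hq1)) (not_le.2 hq2)
        exact hno e e' hl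
      rintro p ⟨hp, h1, h2⟩
      rcases h1.eq_or_lt with rfl | h1
      · exact Or.inl (hright _ le_rfl huv hu)
      rcases h2.eq_or_lt with rfl | h2
      · exact Or.inr (hleft _ huv le_rfl hv)
      rcases hp with hp | hp
      · exact Or.inl (hright p h1.le h2 hp)
      · exact Or.inr (hleft p h1 h2.le hp))
  obtain ⟨k, ⟨-, hk⟩, -, hk'⟩ := h2 (p - 1) (by linarith)
  obtain ⟨k₂, ⟨-, hk₂⟩, hk₂', -⟩ := h1 (p + 1) (by linarith)
  refine ⟨p, hk.1.trans_lt hk', hk₂'.trans_le hk₂.2, ?_, ?_⟩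
  · by_contra hn
    obtain ⟨z, h3, h4⟩ := exists_forall_not_bad_right hn
    obtain ⟨k, ⟨hk, -⟩, h5, h6⟩ := h1 z h3
    exact h4 k h5 h6 hk
  · by_contra hn
    obtain ⟨z, h3, h4⟩ := exists_forall_not_bad_left hn
    obtain ⟨k, ⟨hk, -⟩, h5, h6⟩ := h2 z h3
    exact h4 k h5 h6 hk

/-- In the absence of loops, the next bad point is not left-bad, so it is right-bad. -/
theorem Reduction.exists_next_rBad (hX : Reduction φ h x y X)
    (hno : ∀ e e', ¬ Loop φ h x y X e e') (hz : ¬ RBad φ h x y z) (hxz : x ≤ z)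
    (hv : LBad φ h x y v) (hzv : z < v) :
    ∃ b, z < b ∧ b < v ∧ RBad φ h x y b ∧ mos φ h z b ∈ X := by
  obtain ⟨b, h1, h2, h3, h4⟩ := exists_next_bad hz hzv (Or.inr hv)
  have hL : ¬ LBad φ h x y b := fun hL => by
    obtain ⟨e, e', -, -, hl⟩ := hX.exists_loop_left hL hxz h1 h4
    exact hno e e' hl
  have h5 : b < v := lt_of_le_of_ne h2 fun hbv => hL (hbv ▸ hv)
  refine ⟨b, h1, h5, h3.resolve_right hL, hX.mos_mem hxz h1 (h2.trans hv.2.1) ?_ ?_⟩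
  · intro q hq1 hq2 hq
    rcases hq1.eq_or_lt with rfl | hq1
    exacts [hz hq, h4 q hq1 hq2 (Or.inl hq)]
  · intro q hq1 hq2 hq
    rcases hq2.eq_or_lt with rfl | hq2
    exacts [hL hq, h4 q hq1 hq2 (Or.inr hq)]

theorem Reduction.exists_prev_lBad (hX : Reduction φ h x y X)
    (hno : ∀ e e', ¬ Loop φ h x y X e e') (hz : ¬ LBad φ h x y z) (hzy : z ≤ y)
    (hu : RBad φ h x y u) (huz : u < z) :
    ∃ a, u < a ∧ a < z ∧ LBad φ h x y a ∧ mos φ h a z ∈ X := by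
  obtain ⟨a, h1, h2, h3, h4⟩ := exists_prev_bad hz huz (Or.inl hu)
  have hR : ¬ RBad φ h x y a := fun hR => by
    obtain ⟨e, e', -, -, hl⟩ := hX.exists_loop_right hR hzy h1 h4
    exact hno e e' hl
  have h5 : u < a := lt_of_le_of_ne h2 fun hua => hR (hua ▸ hu)
  refine ⟨a, h5, h1, h3.resolve_left hR, hX.mos_mem (hu.1.trans h2) h1 hzy ?_ ?_⟩
  · intro q hq1 hq2 hq
    rcases hq1.eq_or_lt with rfl | hq1
    exacts [hR hq, h4 q hq1 hq2 (Or.inl hq)]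
  · intro q hq1 hq2 hq
    rcases hq2.eq_or_lt with rfl | hq2
    exacts [hz hq, h4 q hq1 hq2 (Or.inr hq)]

/-- A sequence of mosaics from `X` that leads through an interval `[a, b]` in the interior of
`[x, y]`, whose left end is left-bad and whose right end is right-bad. -/
structure Gap (φ : Formula Atom) (h : Atom → Set ℝ) (x y : ℝ) (X : Set (Triple Atom))
    (l : List (Triple Atom)) (a b : ℝ) : Prop where
  left : x < a
  lt : a < b
  right : b < y
  lBad : LBad φ h x y a
  rBad : RBad φ h x y b
  composesTo : ComposesTo l (mos φ h a b)
  mem : ∀ c ∈ l, c ∈ X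
  mos : ∀ c ∈ l, ∃ s t, a ≤ s ∧ s < t ∧ t ≤ b ∧ c = mos φ h s t

/-- In the absence of loops, a point that is not bad on both sides is in a gap. -/
theorem Reduction.exists_gap (hX : Reduction φ h x y X)
    (hno : ∀ e e', ¬ Loop φ h x y X e e') (hu : RBad φ h x y u) (hv : LBad φ h x y v)
    (huz : u < z) (hzv : z < v) (hz : ¬ (RBad φ h x y z ∧ LBad φ h x y z)) :
    ∃ l a b, Gap φ h x y X l a b ∧ (z = a ∨ ∃ c ∈ l, c.finish = label φ h z) := by
  have hxz : x ≤ z := hu.1.trans huz.le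
  have hzy : z ≤ y := hzv.le.trans hv.2.1
  by_cases hR : RBad φ h x y z
  · have hL : ¬ LBad φ h x y z := fun hL => hz ⟨hR, hL⟩
    obtain ⟨a, h1, h2, h3, h4⟩ := hX.exists_prev_lBad hno hL hzy hu huz
    refine ⟨[RTL.mos φ h a z], a, z, ⟨h3.1, h2, hR.2.1, h3, hR, .single _, by simpa using h4, ?_⟩,
      Or.inr ⟨_, List.mem_singleton_self _, rfl⟩⟩
    intro c hc
    exact ⟨a, z, le_rfl, h2, le_rfl, List.mem_singleton.1 hc⟩
  obtain ⟨b, h1, h2, h3, h4⟩ := hX.exists_next_rBad hno hR hxz hv hzv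
  by_cases hL : LBad φ h x y z
  · refine ⟨[RTL.mos φ h z b], z, b, ⟨hL.1, h1, h3.2.1, hL, h3, .single _, by simpa using h4, ?_⟩,
      Or.inl rfl⟩
    intro c hc
    exact ⟨z, b, le_rfl, h1, le_rfl, List.mem_singleton.1 hc⟩
  obtain ⟨a, h5, h6, h7, h8⟩ := hX.exists_prev_lBad hno hL hzy hu huz
  refine ⟨[RTL.mos φ h a z, RTL.mos φ h z b], a, b, ⟨h7.1, h6.trans h1, h3.2.1, h7, h3, ?_, ?_, ?_⟩,
      Or.inr ⟨RTL.mos φ h a z, by simp, rfl⟩⟩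
  · rw [← mos_comp h6 h1]
    exact .cons _ _ _ (.single _) rfl
  · simp [h4, h8]
  · intro c hc
    simp only [List.mem_cons, List.not_mem_nil, or_false] at hc
    rcases hc with rfl | rfl
    exacts [⟨a, z, le_rfl, h6, h1.le, rfl⟩, ⟨z, b, h6.le, h1, le_rfl, rfl⟩]

end TwoSided

/-! ### A criterion for shuffles -/

namespace Shuffle

/-- Sets `R` and `L` of possible starts and ends of mosaics with cover `B` that makes the
conditions on temporal formulas in the definition of full decompositions hold trivially. -/
structure IsFrame (φ : Formula Atom) (B : Set (Formula Atom))
    (R L : Set (Set (Formula Atom))) : Prop where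
  isMosaic : ∀ A ∈ R, ∀ C ∈ L, IsMosaic φ ⟨A, B, C⟩
  until_mem : ∀ A ∈ R, ∀ α β, U α β ∈ A → β ∈ B
  since_mem : ∀ C ∈ L, ∀ α β, S α β ∈ C → β ∈ B

variable {φ : Formula Atom} {B : Set (Formula Atom)} {R L : Set (Set (Formula Atom))}

theorem IsFrame.isFullDecomposition (hF : IsFrame φ B R L) {A A' C : Set (Formula Atom)}
    (hA : A ∈ R) (hA' : A' ∈ R) (hC : C ∈ L) {l : List (Triple Atom)} (hl : IsPath A l A')
    (hm : ∀ c ∈ l, IsMosaic φ c ∧ B ⊆ c.cover ∧ B ⊆ c.finish)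
    (hv : ∀ β ∈ φ.Cl, sim β ∉ B → ∃ c ∈ l, β ∈ c.finish) :
    IsFullDecomposition φ (l ++ [⟨A', B, C⟩]) ⟨A, B, C⟩ := by
  refine isFullDecomposition_of_visits (hF.isMosaic A hA C hC) (fun c hc => ?_) ?_
    (fun α β hU => Or.inl (hF.until_mem A hA α β hU))
    (fun α β hS => Or.inl (hF.since_mem C hC α β hS)) (by simpa using hv)
  · rcases List.mem_append.1 hc with hc | hc
    · exact (hm c hc).1
    · rw [List.mem_singleton.1 hc]; exact hF.isMosaic A' hA' C hC
  · refine (hl.append (isPath_singleton.2 ⟨rfl, rfl⟩)).composesTo (fun c hc => ?_)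
      (fun c hc => ?_) ⟨_, List.mem_append_right _ (List.mem_singleton_self _), rfl⟩
    · rcases List.mem_append.1 hc with hc | hc
      · exact (hm c hc).2.1
      · rw [List.mem_singleton.1 hc]
    · rw [List.dropLast_concat] at hc
      exact (hm c hc).2.2

/-- The members of a cyclic sequence are fully decomposed by the sequence read from there. -/
theorem IsFrame.rotate (hF : IsFrame φ B R L) {P : Set (Formula Atom)}
    {l l₁ l₂ : List (Triple Atom)} {c : Triple Atom} (hlc : l = l₁ ++ c :: l₂) (hl : IsPath P l P)
    (hm : ∀ c ∈ l, IsMosaic φ c ∧ B ⊆ c.cover ∧ B ⊆ c.finish)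
    (hv : ∀ β ∈ φ.Cl, sim β ∉ B → ∃ c ∈ l, β ∈ c.finish)
    (hA : c.start ∈ R) (hB : c.cover = B) (hC : c.finish ∈ L) :
    IsFullDecomposition φ (c :: l₂ ++ l₁ ++ [c]) c := by
  subst hlc
  obtain ⟨Q, h1, h2, h3⟩ := isPath_append.1 hl
  subst hB h2
  have hmem : ∀ d, d ∈ c :: l₂ ++ l₁ ↔ d ∈ l₁ ++ c :: l₂ := fun d => by
    simp only [List.mem_append]; exact Or.comm
  refine hF.isFullDecomposition (A := c.start) (A' := c.start) (C := c.finish) hA hA hC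
    ⟨rfl, h3.append h1⟩ (fun d hd => hm d ((hmem d).1 hd)) fun β hβ hn => ?_
  obtain ⟨d, hd, hd'⟩ := hv β hβ hn
  exact ⟨d, (hmem d).2 hd, hd'⟩

variable {D : Shuffle Atom}

theorem isPath_mu (D : Shuffle Atom) (o : Triple Atom) : IsPath (D.P 0) (D.mu o) (D.P 0) := by
  have h : ∀ n ≤ D.s, IsPath (D.P 0) (D.ySeg o 0 n) (D.P n) := by
    intro n hn
    induction n with
    | zero => exact rfl
    | succ n ih =>
      rw [ySeg_concat]
      refine (ih (by omega)).append (isPath_singleton.2 ⟨by simp [y], ?_⟩)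
      simp [y, (show n ≠ D.s by omega)]
  rw [mu, ySeg_concat]
  exact (h D.s le_rfl).append (isPath_singleton.2 ⟨by simp [y], by simp [y]⟩)

theorem isPath_lambda (D : Shuffle Atom) (o : Triple Atom)
    (hlam : ∀ i, 1 ≤ i → i ≤ D.r → ∃ k, ComposesTo (D.lam i) k) :
    IsPath (D.P 0) (D.lambda o) (D.P 0) := by
  rw [lambda]
  split_ifs with hr
  · exact rfl
  have h : ∀ n ≤ D.r, IsPath (D.P 0) ([D.x o 0] ++ D.lamSeg o 1 n) (D.x o n).finish := by
    intro n hn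
    induction n with
    | zero => exact ⟨rfl, rfl⟩
    | succ n ih =>
      obtain ⟨k, hk⟩ := hlam (n + 1) (by omega) hn
      rw [lamSeg_concat, add_comm 1 n, ← List.append_assoc, ← List.append_assoc]
      have h1 : (D.x o n).finish = k.start := by
        simp only [x, if_neg (show n ≠ D.r by omega), hk.firstStart_eq]
      have h2 : (D.x o (n + 1)).start = k.finish := by
        simp [x, hk.lastFinish_eq]
      exact ((ih (by omega)).append (h1 ▸ (composesTo_iff.1 hk).2.1)).append
        (isPath_singleton.2 ⟨h2, rfl⟩)
  simpa [x] using h D.r le_rfl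

/-- A shuffle whose sets `P i` and sequences `lam i` fit a frame fully decomposes the mosaic as
soon as everything not excluded by the cover occurs in it. -/
theorem IsFrame.fullyDecomposes (hF : IsFrame φ B R L) {A C : Set (Formula Atom)}
    (hA : A ∈ R) (hC : C ∈ L) (hP : ∀ i ≤ D.s, D.P i ∈ R ∧ D.P i ∈ L ∧ B ⊆ D.P i)
    (hlam : ∀ i, 1 ≤ i → i ≤ D.r → ∃ k, ComposesTo (D.lam i) k ∧ k.start ∈ L ∧ k.finish ∈ R ∧
      B ⊆ k.start ∧ ∀ c ∈ D.lam i, IsMosaic φ c ∧ B ⊆ c.cover ∧ B ⊆ c.finish)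
    (hv : ∀ β ∈ φ.Cl, sim β ∉ B → (∃ i ≤ D.s, β ∈ D.P i) ∨
      ∃ i, 1 ≤ i ∧ i ≤ D.r ∧ (β ∈ firstStart (D.lam i) ∨ ∃ c ∈ D.lam i, β ∈ c.finish)) :
    D.FullyDecomposes ⟨A, B, C⟩ φ := by
  set o : Triple Atom := ⟨A, B, C⟩ with ho
  obtain ⟨hP1, hP2, hP3⟩ := hP 0 (Nat.zero_le _)
  have hystart : ∀ i ≤ D.s, (D.y o i).start ∈ R := fun i hi => (hP i hi).1
  have hyfin : ∀ i ≤ D.s, (D.y o i).finish ∈ L ∧ B ⊆ (D.y o i).finish := by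
    intro i hi
    simp only [y]
    split_ifs with h
    exacts [⟨hP2, hP3⟩, (hP (i + 1) (by omega)).2]
  have hxstart : ∀ i ≤ D.r, (D.x o i).start ∈ R := by
    intro i hi
    simp only [x]
    split_ifs with h
    · exact hP1
    · obtain ⟨k, hk, -, h1, -⟩ := hlam i (by omega) hi
      rwa [hk.lastFinish_eq]
  have hxfin : ∀ i ≤ D.r, (D.x o i).finish ∈ L ∧ B ⊆ (D.x o i).finish := by
    intro i hi
    simp only [x]
    split_ifs with h
    · exact ⟨hP2, hP3⟩
    · obtain ⟨k, hk, h1, -, h2, -⟩ := hlam (i + 1) (by omega) (by omega)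
      rw [hk.firstStart_eq]
      exact ⟨h1, h2⟩
  have hy : ∀ i ≤ D.s, IsMosaic φ (D.y o i) := fun i hi =>
    hF.isMosaic _ (hystart i hi) _ (hyfin i hi).1
  have hx : ∀ i ≤ D.r, IsMosaic φ (D.x o i) := fun i hi =>
    hF.isMosaic _ (hxstart i hi) _ (hxfin i hi).1
  have hm' : IsMosaic φ (D.m' o) := hF.isMosaic A hA _ hP2
  have hm'' : IsMosaic φ (D.m'' o) := hF.isMosaic _ hP1 C hC
  have hpath : IsPath (D.P 0) (D.lambda o ++ D.mu o) (D.P 0) :=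
    (isPath_lambda D o fun i h1 h2 => (hlam i h1 h2).imp fun _ hk => hk.1).append (isPath_mu D o)
  have hmem : ∀ c ∈ D.lambda o ++ D.mu o, IsMosaic φ c ∧ B ⊆ c.cover ∧ B ⊆ c.finish := by
    intro c hc
    rw [List.mem_append, mem_lambda, mem_mu] at hc
    rcases hc with ⟨-, rfl | ⟨i, h1, h2, hc | rfl⟩⟩ | ⟨i, hi, rfl⟩
    · exact ⟨hx 0 (Nat.zero_le _), subset_rfl, (hxfin 0 (Nat.zero_le _)).2⟩
    · obtain ⟨k, -, -, -, -, h3⟩ := hlam i h1 h2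
      exact h3 c hc
    · exact ⟨hx i h2, subset_rfl, (hxfin i h2).2⟩
    · exact ⟨hy i hi, subset_rfl, (hyfin i hi).2⟩
  have hvis : ∀ β ∈ φ.Cl, sim β ∉ B → ∃ c ∈ D.lambda o ++ D.mu o, β ∈ c.finish := by
    intro β hβ hn
    simp only [List.mem_append, mem_lambda, mem_mu]
    rcases hv β hβ hn with ⟨i, hi, h1⟩ | ⟨i, hi, hi', h1 | ⟨c, hc, h1⟩⟩
    · cases i with
      | zero => exact ⟨D.y o D.s, Or.inr ⟨D.s, le_rfl, rfl⟩, by simpa [y] using h1⟩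
      | succ i =>
        exact ⟨D.y o i, Or.inr ⟨i, by omega, rfl⟩, by
          simpa [y, (show i ≠ D.s by omega)] using h1⟩
    · refine ⟨D.x o (i - 1), Or.inl ⟨by omega, ?_⟩, ?_⟩
      · rcases Nat.eq_or_lt_of_le hi with rfl | hlt
        · exact Or.inl rfl
        · exact Or.inr ⟨i - 1, by omega, by omega, Or.inr rfl⟩
      · simpa [x, (show i - 1 ≠ D.r by omega), Nat.sub_add_cancel hi] using h1
    · exact ⟨c, Or.inl ⟨by omega, Or.inr ⟨i, hi, hi', Or.inl hc⟩⟩, h1⟩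
  have hrot : ∀ {l₁ l₂ : List (Triple Atom)} {c : Triple Atom},
      D.lambda o ++ D.mu o = l₁ ++ c :: l₂ → c.start ∈ R → c.cover = B → c.finish ∈ L →
      IsFullDecomposition φ (c :: l₂ ++ l₁ ++ [c]) c := fun hlc =>
    hF.rotate hlc hpath hmem hvis
  have hlambda : 0 < D.r → D.lambda o = [D.x o 0] ++ D.lamSeg o 1 D.r := fun hr => by
    rw [lambda, if_neg hr.ne']
  have hlamSeg : ∀ i, 0 < i → D.lamSeg o 1 i =
      D.lamSeg o 1 (i - 1) ++ D.lam i ++ [D.x o i] := fun i hi => by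
    obtain ⟨i, rfl⟩ := Nat.exists_eq_add_of_lt hi
    simp only [zero_add, lamSeg_concat, Nat.add_sub_cancel, add_comm 1 i]
  refine ⟨hF.isMosaic A hA C hC, fun i h1 h2 c hc => ?_, fun i h1 h2 => ?_, fun i hi => ?_, hm',
    hm'', hy, fun _ => hx, ?_, fun hr => ?_, fun i hi hir => ?_, fun hr => ?_, fun i hi => ?_, ?_⟩
  · obtain ⟨k, -, -, -, -, h3⟩ := hlam i h1 h2
    exact (h3 c hc).1
  · exact (hlam i h1 h2).imp fun _ hk => hk.1
  · exact (hy i hi).start_mpc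
  · have : IsFullDecomposition φ (D.m' o :: (D.lambda o ++ D.mu o) ++ [D.m'' o]) o :=
      hF.isFullDecomposition hA hP1 hC ⟨rfl, hpath⟩ (by
        simp only [List.forall_mem_cons]
        exact ⟨⟨hm', subset_rfl, hP3⟩, hmem⟩) fun β hβ hn => by
          obtain ⟨c, hc, hc'⟩ := hvis β hβ hn
          exact ⟨c, List.mem_cons_of_mem _ hc, hc'⟩
    simpa using this
  · have := hrot (l₁ := []) (c := D.x o 0) (l₂ := D.lamSeg o 1 D.r ++ D.mu o)
      (by simp [hlambda hr]) (hxstart 0 hr.le) rfl (hxfin 0 hr.le).1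
    simpa [hlambda hr] using this
  · have hsplit : D.lamSeg o 1 D.r = D.lamSeg o 1 i ++ D.lamSeg o (i + 1) (D.r - i) := by
      have : List.range' 1 D.r = List.range' 1 i ++ List.range' (i + 1) (D.r - i) := by
        rw [add_comm i 1, List.range'_append_1, Nat.add_sub_cancel' hir.le]
      simp only [lamSeg, this, List.flatMap_append]
    have := hrot (l₁ := [D.x o 0] ++ D.lamSeg o 1 (i - 1) ++ D.lam i) (c := D.x o i)
      (l₂ := D.lamSeg o (i + 1) (D.r - i) ++ D.mu o)
      (by simp [hlambda (hi.trans hir), hsplit, hlamSeg i hi]) (hxstart i hir.le) rfl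
      (hxfin i hir.le).1
    simpa [hlamSeg i hi] using this
  · have := hrot (l₁ := [D.x o 0] ++ D.lamSeg o 1 (D.r - 1) ++ D.lam D.r) (c := D.x o D.r)
      (l₂ := D.mu o) (by simp [hlambda hr, hlamSeg D.r hr]) (hxstart _ le_rfl) rfl
      (hxfin _ le_rfl).1
    simpa [hlambda hr, hlamSeg D.r hr] using this
  · have hsplit : D.mu o = D.ySeg o 0 i ++ D.y o i :: D.ySeg o (i + 1) (D.s - i) := by
      have : List.range' 0 (D.s + 1) = List.range' 0 i ++ List.range' i (D.s - i + 1) := by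
        have h1 := List.range'_append_1 (s := 0) (m := i) (n := D.s - i + 1)
        rw [zero_add] at h1
        rw [h1]; congr 1; omega
      rw [← ySeg_succ]
      simp only [mu, ySeg, this, List.map_append]
    have := hrot (l₁ := D.lambda o ++ D.ySeg o 0 i) (c := D.y o i)
      (l₂ := D.ySeg o (i + 1) (D.s - i)) (by simp [hsplit]) (hystart i hi.le) rfl
      (hyfin i hi.le).1
    rw [show D.s + 1 - i = (D.s - i) + 1 by omega, ySeg_succ, ySeg_concat, zero_add]
    simpa using this
  · have := hrot (l₁ := D.lambda o ++ D.ySeg o 0 D.s) (c := D.y o D.s) (l₂ := [])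
      (by simp [mu, ySeg_concat]) (hystart _ le_rfl) rfl (hyfin _ le_rfl).1
    simpa [mu, ySeg_concat] using this

end Shuffle

/-! ### Every mosaic of a real structure has a level -/

section MainStep

variable {φ : Formula Atom} {h : Atom → Set ℝ} {x y u v : ℝ} {X : Set (Triple Atom)}

/-- In the absence of loops, the part of the interval between a right-bad point and a left-bad
point is decomposed by a shuffle of labels of points that are bad on both sides and of gaps. -/
theorem Reduction.exists_shuffle (hX : Reduction φ h x y X)
    (hno : ∀ e e', ¬ Loop φ h x y X e e') (hu : RBad φ h x y u) (hv : LBad φ h x y v)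
    (huv : u < v) : ∃ D : Shuffle Atom, D.FullyDecomposes (mos φ h u v) φ ∧
      ∀ i, 1 ≤ i → i ≤ D.r → ∀ c ∈ D.lam i, c ∈ X ∧ IsMosaic φ c := by
  have hxy : x < y := hu.1.trans_lt (huv.trans_le hv.2.1)
  have hB := hu.2.2 v huv hv.2.1
  have hlab : ∀ p, x < p → p < y → coverOf φ h x y ⊆ label φ h p := fun p h1 h2 β hβ =>
    mem_label_of_mem_coverOf hβ h1 h2
  obtain ⟨p₀, -, -, hp₀⟩ := hX.exists_rBad_lBad hno hu hv huv
  have hlists : ∀ F : List (Formula Atom), (∀ β ∈ F, β ∈ φ.Cl ∧ sim β ∉ coverOf φ h x y) →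
      ∃ (Q : List ℝ) (Λ : List (List (Triple Atom))),
        (∀ p ∈ Q, RBad φ h x y p ∧ LBad φ h x y p) ∧ (∀ l ∈ Λ, ∃ a b, Gap φ h x y X l a b) ∧
        ∀ β ∈ F, (∃ p ∈ Q, β ∈ label φ h p) ∨
          ∃ l ∈ Λ, β ∈ Shuffle.firstStart l ∨ ∃ c ∈ l, β ∈ c.finish := by
    intro F hF
    induction F with
    | nil => exact ⟨[], [], by simp, by simp, by simp⟩
    | cons β F ih =>
      obtain ⟨Q, Λ, h1, h2, h3⟩ := ih fun β' hβ' => hF β' (List.mem_cons_of_mem _ hβ')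
      obtain ⟨hβ, hn⟩ := hF β List.mem_cons_self
      rw [← hB] at hn
      simp only [coverOf, Set.mem_ofPred_eq, sim_mem_Cl hβ, true_and, sat_sim] at hn
      push Not at hn
      obtain ⟨z, huz, hzv, hz⟩ := hn
      have hβz : β ∈ label φ h z := ⟨hβ, hz⟩
      by_cases hz2 : RBad φ h x y z ∧ LBad φ h x y z
      · refine ⟨z :: Q, Λ, by simpa [hz2] using h1, h2, ?_⟩
        intro β' hβ'
        rcases List.mem_cons.1 hβ' with rfl | hβ'
        · exact Or.inl ⟨z, List.mem_cons_self, hβz⟩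
        · exact (h3 β' hβ').imp_left fun ⟨p, hp, hp'⟩ => ⟨p, List.mem_cons_of_mem _ hp, hp'⟩
      · obtain ⟨l, a, b, hg, hza⟩ := hX.exists_gap hno hu hv huz hzv hz2
        refine ⟨Q, l :: Λ, h1, ?_, ?_⟩
        · intro l' hl'
          rcases List.mem_cons.1 hl' with rfl | hl'
          exacts [⟨a, b, hg⟩, h2 l' hl']
        · intro β' hβ'
          rcases List.mem_cons.1 hβ' with rfl | hβ'
          · refine Or.inr ⟨l, List.mem_cons_self, ?_⟩
            rcases hza with rfl | ⟨c, hc, hcz⟩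
            · left
              rw [hg.composesTo.firstStart_eq]; exact hβz
            · exact Or.inr ⟨c, hc, hcz ▸ hβz⟩
          · exact (h3 β' hβ').imp_right fun ⟨p, hp, hp'⟩ => ⟨p, List.mem_cons_of_mem _ hp, hp'⟩
  have hfin : (φ.Cl ∩ {β | sim β ∉ coverOf φ h x y}).Finite :=
    φ.Cl_finite.subset Set.inter_subset_left
  obtain ⟨Q, Λ, hQ, hΛ, hvis⟩ := hlists hfin.toFinset.toList fun β hβ => by simpa using hβ
  have hQ' : ∀ i, RBad φ h x y ((p₀ :: Q).getD i p₀) ∧ LBad φ h x y ((p₀ :: Q).getD i p₀) := by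
    intro i
    rcases lt_or_ge i (p₀ :: Q).length with hi | hi
    · rw [List.getD_eq_getElem _ _ hi]
      rcases List.mem_cons.1 (List.getElem_mem hi) with heq | hmem
      · rw [heq]; exact hp₀
      · exact hQ _ hmem
    · rw [List.getD_eq_default _ _ hi]; exact hp₀
  have hΛ' : ∀ i, 1 ≤ i → i ≤ Λ.length → ∃ a b, Gap φ h x y X (Λ.getD (i - 1) []) a b := by
    intro i h1 h2
    have hi : i - 1 < Λ.length := by omega
    rw [List.getD_eq_getElem _ _ hi]
    exact hΛ _ (List.getElem_mem hi)
  have hframe : Shuffle.IsFrame φ (coverOf φ h x y) (label φ h '' {p | RBad φ h x y p})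
      (label φ h '' {p | LBad φ h x y p}) := by
    refine ⟨?_, ?_, ?_⟩
    · rintro _ ⟨p, hp, rfl⟩ _ ⟨p', hp', rfl⟩
      exact mixed_isMosaic hxy hp.1 hp.2.1 hp'.2.1 hp'.1 (hp.2.2 y hp.2.1 le_rfl)
        (hp'.2.2 x le_rfl hp'.1)
    · rintro _ ⟨p, hp, rfl⟩ α β
      exact hp.mem_of_until
    · rintro _ ⟨p, hp, rfl⟩ α β
      exact hp.mem_of_since
  have hpieces : ∀ {l a b}, Gap φ h x y X l a b → ∀ c ∈ l, IsMosaic φ c ∧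
      coverOf φ h x y ⊆ c.cover ∧ coverOf φ h x y ⊆ c.finish := by
    intro l a b hg c hc
    obtain ⟨s, t, h1, h2, h3, rfl⟩ := hg.mos c hc
    exact ⟨mos_isMosaic φ h h2, coverOf_anti (hg.left.le.trans h1) (h3.trans hg.right.le),
      hlab t (hg.left.trans_le (h1.trans h2.le)) (h3.trans_lt hg.right)⟩
  -- the point `p₀` is there to make the list of points non-empty
  refine ⟨⟨Q.length, Λ.length, fun i => label φ h ((p₀ :: Q).getD i p₀),
    fun i => Λ.getD (i - 1) []⟩, ?_, ?_⟩
  · rw [mos, hB]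
    refine hframe.fullyDecomposes ⟨u, hu, rfl⟩ ⟨v, hv, rfl⟩ (fun i _ => ?_) (fun i h1 h2 => ?_)
      (fun β hβ hn => ?_)
    · obtain ⟨h1, h2⟩ := hQ' i
      exact ⟨⟨_, h1, rfl⟩, ⟨_, h2, rfl⟩, hlab _ h2.1 h1.2.1⟩
    · obtain ⟨a, b, hg⟩ := hΛ' i h1 h2
      exact ⟨_, hg.composesTo, ⟨a, hg.lBad, rfl⟩, ⟨b, hg.rBad, rfl⟩,
        hlab a hg.left (hg.lt.trans hg.right), hpieces hg⟩
    · rcases hvis β (by simpa using ⟨hβ, hn⟩) with ⟨p, hp, hβp⟩ | ⟨l, hl, hβl⟩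
      · obtain ⟨i, hi, rfl⟩ := List.getElem_of_mem hp
        refine Or.inl ⟨i + 1, hi, ?_⟩
        simpa [List.getElem?_eq_getElem hi] using hβp
      · obtain ⟨i, hi, rfl⟩ := List.getElem_of_mem hl
        refine Or.inr ⟨i + 1, by omega, hi, ?_⟩
        simpa [List.getElem?_eq_getElem hi] using hβl
  · intro i h1 h2 c hc
    obtain ⟨a, b, hg⟩ := hΛ' i h1 h2
    exact ⟨hg.mem c hc, (hpieces hg c hc).1⟩

/-- The interval is cut at its first right-bad and at its last left-bad point. The part in between
is obtained from a loop by the tactics lead and trail, or by a shuffle if there is no loop. -/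
theorem Reduction.mos_mem_compositionsFrom (hX : Reduction φ h x y X) (hxy : x < y) :
    mos φ h x y ∈ compositionsFrom φ (leadTrailStep φ (leadTrailStep φ X) ∪
      {o | ∃ D : Shuffle Atom, D.FullyDecomposes o φ ∧
        ∀ i, 1 ≤ i → i ≤ D.r → ∀ k ∈ D.lam i, k ∈ leadTrailStep φ (leadTrailStep φ X)}) := by
  set T := compositionsFrom φ (leadTrailStep φ (leadTrailStep φ X) ∪
      {o | ∃ D : Shuffle Atom, D.FullyDecomposes o φ ∧
        ∀ i, 1 ≤ i → i ≤ D.r → ∀ k ∈ D.lam i, k ∈ leadTrailStep φ (leadTrailStep φ X)}) with hT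
  have hstep : ∀ a b, a < b → mos φ h a b ∈ leadTrailStep φ X → mos φ h a b ∈ T :=
    fun a b hab hm => subset_compositionsFrom (mos_isMosaic φ h hab)
      (Or.inl (subset_leadTrailStep (mos_isMosaic φ h hab) hm))
  have hjoin : ∀ a b c, a ≤ b → b ≤ c → a < c → (a < b → mos φ h a b ∈ T) →
      (b < c → mos φ h b c ∈ T) → mos φ h a c ∈ T := by
    intro a b c h1 h2 h3 h4 h5
    rcases h1.eq_or_lt with rfl | h1
    · exact h5 h3
    rcases h2.eq_or_lt with rfl | h2
    · exact h4 h1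
    rw [← mos_comp h1 h2]
    exact comp_mem_compositionsFrom (h4 h1) (h5 h2) rfl
  by_cases hR : ∃ p, x ≤ p ∧ p < y ∧ RBad φ h x y p
  swap
  · push Not at hR
    exact hstep x y hxy (hX.mos_mem_of_not_rBad le_rfl hxy le_rfl hR)
  by_cases hL : ∃ p, x < p ∧ p ≤ y ∧ LBad φ h x y p
  swap
  · push Not at hL
    exact hstep x y hxy (hX.mos_mem_of_not_lBad le_rfl hxy le_rfl hL)
  obtain ⟨p, hp1, -, hp⟩ := hR
  obtain ⟨u, hxu, -, hu, hu'⟩ := exists_first_rBad hp hp1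
  obtain ⟨p', -, hp2, hp'⟩ := hL
  obtain ⟨v, hvy, -, hv, hv'⟩ := exists_last_lBad hp' hp2
  have hleft : x < u → mos φ h x u ∈ T := fun hlt =>
    hstep x u hlt (hX.mos_mem_of_not_rBad le_rfl hlt hu.2.1.le hu')
  have hright : ∀ w, v ≤ w → x ≤ w → w < y → mos φ h w y ∈ T := fun w hw hxw hlt =>
    hstep w y hlt (hX.mos_mem_of_not_lBad hxw hlt le_rfl fun q hq =>
      hv' q (hw.trans_lt hq))
  rcases le_or_gt v u with hvu | huv
  · exact hjoin x u y hxu hu.2.1.le hxy hleft (hright u hvu hxu)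
  have hB := hu.2.2 v huv hv.2.1
  have hmid : mos φ h u v ∈ T := by
    by_cases hl : ∃ e e', Loop φ h x y X e e'
    · obtain ⟨e, e', hl⟩ := hl
      have h1 : mos φ h u v = (⟨label φ h u, coverOf φ h x y, label φ h e'⟩ : Triple Atom).comp
          ⟨label φ h e, coverOf φ h x y, label φ h v⟩ := by
        ext β
        · rfl
        · simp only [mos, Triple.comp, hB, Set.mem_inter_iff]
          exact ⟨fun hβ => ⟨⟨hβ, mem_label_of_mem_coverOf hβ (hl.left.trans hl.lt) hl.right⟩, hβ⟩,
            fun hβ => hβ.2⟩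
        · rfl
      refine hstep u v huv ?_
      rw [h1]
      exact comp_mem_compositionsFrom (hl.lead_mem hu) (hl.trail_mem hv) hl.label_eq.symm
    · push Not at hl
      obtain ⟨D, hD, hlam⟩ := hX.exists_shuffle hl hu hv huv
      refine subset_compositionsFrom (mos_isMosaic φ h huv) (Or.inr ⟨D, hD, ?_⟩)
      intro i h1 h2 k hk
      obtain ⟨h3, h4⟩ := hlam i h1 h2 k hk
      exact subset_leadTrailStep h4 (subset_leadTrailStep h4 h3)
  exact hjoin x v y hv.1.le hvy hxy (fun _ => hjoin x u v hxu huv.le hv.1 hleft fun _ => hmid)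
    (hright v le_rfl hv.1.le)

end MainStep

/-- The level of the mosaic of an interval is bounded by the number of formulas of the closure that
are not in its cover. -/
theorem mos_mem_level (φ : Formula Atom) (h : Atom → Set ℝ) (j : ℕ) :
    ∀ x y, x < y → (φ.Cl \ coverOf φ h x y).ncard ≤ j → mos φ h x y ∈ level φ (satMosaics φ) j := by
  induction j with
  -- no cover contains both `φ` and `¬φ`
  | zero =>
    intro x y hxy hj
    exfalso
    rw [Nat.le_zero, Set.ncard_eq_zero (φ.Cl_finite.subset Set.sdiff_subset),
      Set.sdiff_eq_empty] at hj
    obtain ⟨z, h1, h2⟩ := exists_between hxy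
    have hself := mem_subformulas_self φ
    exact (hj (neg_mem_Cl_of_mem_subformulas hself)).2 z h1 h2
      ((hj (mem_Cl_of_mem_subformulas hself)).2 z h1 h2)
  | succ j ih =>
    intro x y hxy hj
    have hX : Reduction φ h x y (level φ (satMosaics φ) j) := by
      refine ⟨fun u v hu huv hv hne => ih u v huv (Nat.le_of_lt_succ (lt_of_lt_of_le ?_ hj)),
        fun u v _ huv _ hm => mem_level_of_compositionsFrom ⟨h, u, v, huv, rfl⟩ hm⟩
      have hss : coverOf φ h x y ⊂ coverOf φ h u v :=
        (coverOf_anti hu hv).ssubset_of_ne hne.symm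
      obtain ⟨β, hβ1, hβ2⟩ := Set.exists_of_ssubset hss
      refine Set.ncard_lt_ncard ⟨Set.sdiff_subset_sdiff_right hss.1, fun hle => ?_⟩
        (φ.Cl_finite.subset Set.sdiff_subset)
      exact (hle ⟨hβ1.1, hβ2⟩).2 hβ1
    exact ⟨⟨h, x, y, hxy, rfl⟩, hX.mos_mem_compositionsFrom hxy⟩

theorem mem_level_of_mem_satMosaics {φ : Formula Atom} {m : Triple Atom} (hm : m ∈ satMosaics φ) :
    m ∈ level φ (satMosaics φ) (2 * φ.length) := by
  obtain ⟨h, x, y, hxy, rfl⟩ := hm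
  exact mos_mem_level φ h _ x y hxy
    ((Set.ncard_le_ncard Set.sdiff_subset φ.Cl_finite).trans φ.ncard_Cl_le)

theorem isRealMosaicSystem_satMosaics (φ : Formula Atom) :
    IsRealMosaicSystem φ (satMosaics φ) where
  mosaic := by
    rintro _ ⟨h, x, y, hxy, rfl⟩
    exact mos_isMosaic φ h hxy
  exists_level m hm := ⟨_, mem_level_of_mem_satMosaics hm⟩

theorem satMosaics_subset_RMS (φ : Formula Atom) : satMosaics φ ⊆ RMS φ := fun _ hm =>
  ⟨_, isRealMosaicSystem_satMosaics φ, hm⟩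

/-! ### Relativized mosaics from models -/

namespace Formula

variable {q : Atom} {φ α β : Formula Atom}

theorem exists_star_of_U_mem_subformulas (h : U α β ∈ (star q φ).subformulas) :
    ∃ α', α = star q α' := by
  induction φ with
  | atom p => simp [star, subformulas] at h
  | neg χ ih => exact ih (by simpa [star, subformulas] using h)
  | and χ₁ χ₂ ih₁ ih₂ =>
    have : U α β ∈ (star q χ₁).subformulas ∨ U α β ∈ (star q χ₂).subformulas := by
      simpa [star, subformulas] using h
    exact this.elim ih₁ ih₂
  | U χ₁ χ₂ ih₁ ih₂ =>
    have : (α = star q χ₁ ∧ β = star q χ₂) ∨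
        U α β ∈ (star q χ₁).subformulas ∨ U α β ∈ (star q χ₂).subformulas := by
      simpa [star, subformulas] using h
    rcases this with h | h | h
    exacts [⟨χ₁, h.1⟩, ih₁ h, ih₂ h]
  | S χ₁ χ₂ ih₁ ih₂ =>
    have : U α β ∈ (star q χ₁).subformulas ∨ U α β ∈ (star q χ₂).subformulas := by
      simpa [star, subformulas] using h
    exact this.elim ih₁ ih₂

theorem exists_star_of_S_mem_subformulas (h : S α β ∈ (star q φ).subformulas) :
    ∃ α', α = star q α' := by
  induction φ with
  | atom p => simp [star, subformulas] at h
  | neg χ ih => exact ih (by simpa [star, subformulas] using h)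
  | and χ₁ χ₂ ih₁ ih₂ =>
    have : S α β ∈ (star q χ₁).subformulas ∨ S α β ∈ (star q χ₂).subformulas := by
      simpa [star, subformulas] using h
    exact this.elim ih₁ ih₂
  | U χ₁ χ₂ ih₁ ih₂ =>
    have : S α β ∈ (star q χ₁).subformulas ∨ S α β ∈ (star q χ₂).subformulas := by
      simpa [star, subformulas] using h
    exact this.elim ih₁ ih₂
  | S χ₁ χ₂ ih₁ ih₂ =>
    have : (α = star q χ₁ ∧ β = star q χ₂) ∨
        S α β ∈ (star q χ₁).subformulas ∨ S α β ∈ (star q χ₂).subformulas := by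
      simpa [star, subformulas] using h
    rcases this with h | h | h
    exacts [⟨χ₁, h.1⟩, ih₁ h, ih₂ h]

theorem Sat.of_star {T : Type*} [LinearOrder T] {h : Atom → Set T} {x : T}
    (hx : Sat h x (star q φ)) : x ∈ h q := by
  obtain ⟨γ, hγ⟩ := exists_star_eq q φ
  rw [hγ] at hx
  exact hx.2

/-- If the atom `q` holds exactly in an interval of the line that is order isomorphic to `T`, then
`star q` expresses truth in the structure on `T`. -/
theorem sat_star_iff {T : Type*} [LinearOrder T] {a b : ℝ} (e : T ≃o Set.Ioo a b)
    {h : Atom → Set T} {h' : Atom → Set ℝ} (hq : h' q = Set.Ioo a b) (φ : Formula Atom)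
    (hφ : ∀ p ∈ φ.atoms, ∀ x, (e x : ℝ) ∈ h' p ↔ x ∈ h p) (x : T) :
    Sat h' (e x) (star q φ) ↔ Sat h x φ := by
  have hin : ∀ x : T, (e x : ℝ) ∈ h' q := fun x => by rw [hq]; exact (e x).2
  have hout : ∀ {χ : Formula Atom} {y : ℝ}, Sat h' y (star q χ) → ∃ z : T, y = e z := by
    intro χ y hy
    have h1 : y ∈ Set.Ioo a b := hq ▸ hy.of_star
    exact ⟨e.symm ⟨y, h1⟩, by simp⟩
  have hlt : ∀ x y : T, (e x : ℝ) < e y ↔ x < y := fun x y => by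
    rw [Subtype.coe_lt_coe, e.lt_iff_lt]
  have hbetween : ∀ x y : T, ∀ z : ℝ, (e x : ℝ) < z → z < e y → ∃ w : T, z = e w :=
    fun x y z h1 h2 => ⟨e.symm ⟨z, (e x).2.1.trans h1, h2.trans (e y).2.2⟩, by simp⟩
  induction φ generalizing x with
  | atom p => exact ⟨fun h1 => (hφ p rfl x).1 h1.1, fun h1 => ⟨(hφ p rfl x).2 h1, hin x⟩⟩
  | neg α ih => exact ⟨fun h1 h2 => h1.1 ((ih hφ x).2 h2), fun h1 =>
      ⟨fun h2 => h1 ((ih hφ x).1 h2), hin x⟩⟩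
  | and α β iha ihb =>
    have iha := iha (fun p hp => hφ p (Or.inl hp)) x
    have ihb := ihb (fun p hp => hφ p (Or.inr hp)) x
    exact ⟨fun h1 => ⟨iha.1 h1.1.1, ihb.1 h1.1.2⟩, fun h1 => ⟨⟨iha.2 h1.1, ihb.2 h1.2⟩, hin x⟩⟩
  | U α β iha ihb =>
    have iha := iha (fun p hp => hφ p (Or.inl hp))
    have ihb := ihb (fun p hp => hφ p (Or.inr hp))
    constructor
    · rintro ⟨⟨y, h1, h2, h3⟩, -⟩
      obtain ⟨y, rfl⟩ := hout h2
      exact ⟨y, (hlt x y).1 h1, (iha y).1 h2, fun z hz1 hz2 =>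
        (ihb z).1 (h3 _ ((hlt x z).2 hz1) ((hlt z y).2 hz2))⟩
    · rintro ⟨y, h1, h2, h3⟩
      refine ⟨⟨e y, (hlt x y).2 h1, (iha y).2 h2, fun z hz1 hz2 => ?_⟩, hin x⟩
      obtain ⟨z, rfl⟩ := hbetween x y z hz1 hz2
      exact (ihb z).2 (h3 z ((hlt x z).1 hz1) ((hlt z y).1 hz2))
  | S α β iha ihb =>
    have iha := iha (fun p hp => hφ p (Or.inl hp))
    have ihb := ihb (fun p hp => hφ p (Or.inr hp))
    constructor
    · rintro ⟨⟨y, h1, h2, h3⟩, -⟩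
      obtain ⟨y, rfl⟩ := hout h2
      exact ⟨y, (hlt y x).1 h1, (iha y).1 h2, fun z hz1 hz2 =>
        (ihb z).1 (h3 _ ((hlt y z).2 hz1) ((hlt z x).2 hz2))⟩
    · rintro ⟨y, h1, h2, h3⟩
      refine ⟨⟨e y, (hlt y x).2 h1, (iha y).2 h2, fun z hz1 hz2 => ?_⟩, hin x⟩
      obtain ⟨z, rfl⟩ := hbetween y x z hz1 hz2
      exact (ihb z).2 (h3 z ((hlt y z).1 hz1) ((hlt z x).1 hz2))

end Formula

/-- A model of `φ` on the line is squeezed into the interval `(-1, 1)`, which is marked by `q`. -/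
theorem exists_isRelativized {φ : Formula Atom} {q : Atom} (hq : q ∉ φ.atoms)
    (hφ : φ.RealSatisfiable) : ∃ m, IsRelativized φ q m ∧ m ∈ satMosaics (star q φ) := by
  obtain ⟨h, x₀, hx₀⟩ := hφ
  set e := orderIsoIooNegOneOne ℝ
  set h' : Atom → Set ℝ := fun p => {y | ∃ hy : y ∈ Set.Ioo (-1 : ℝ) 1,
    p = q ∨ e.symm ⟨y, hy⟩ ∈ h p} with hh'
  have hh'q : h' q = Set.Ioo (-1 : ℝ) 1 := by
    ext y; simp [hh']
  have hsat : Sat h' (e x₀) (star q φ) := by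
    refine (sat_star_iff e hh'q φ (fun p hp x => ?_) x₀).2 hx₀
    have hpq : p ≠ q := fun hpq => hq (hpq ▸ hp)
    have := (e x).2
    simp only [Set.mem_Ioo] at this
    simp [hh', hpq, this.1, this.2]
  have hqs := atom_mem_subformulas_star q φ
  have hlt : (-1 : ℝ) < 1 := by norm_num
  refine ⟨mos (star q φ) h' (-1) 1, ⟨mos_isMosaic _ h' hlt, ?_, ?_, ?_, ?_, ?_, ?_⟩,
    h', -1, 1, hlt, rfl⟩
  · refine ⟨neg_mem_Cl_of_mem_subformulas hqs, fun hs => ?_⟩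
    have hs' : (-1 : ℝ) ∈ h' q := hs
    rw [hh'q] at hs'
    exact lt_irrefl _ hs'.1
  · rintro α β ⟨⟨γ, hγ, rfl | hγ'⟩, y, hy, hs, -⟩
    · obtain ⟨α', rfl⟩ := exists_star_of_S_mem_subformulas hγ
      have hs' := hs.of_star
      rw [hh'q] at hs'
      exact lt_asymm hs'.1 hy
    · cases hγ'
  · refine ⟨mem_Cl_of_mem_subformulas hqs, fun z h1 h2 => ?_⟩
    change z ∈ h' q
    rw [hh'q]
    exact ⟨h1, h2⟩
  · exact fun hn => hn.2 (e x₀) (e x₀).2.1 (e x₀).2.2 hsat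
  · refine ⟨neg_mem_Cl_of_mem_subformulas hqs, fun hs => ?_⟩
    have hs' : (1 : ℝ) ∈ h' q := hs
    rw [hh'q] at hs'
    exact lt_irrefl _ hs'.2
  · rintro α β ⟨⟨γ, hγ, rfl | hγ'⟩, y, hy, hs, -⟩
    · obtain ⟨α', rfl⟩ := exists_star_of_U_mem_subformulas hγ
      have hs' := hs.of_star
      rw [hh'q] at hs'
      exact lt_asymm hs'.2 hy
    · cases hγ'

end RTL

theorem mainTheorem2 {Atom : Type*} (φ : RTL.Formula Atom) (q : Atom) (hq : q ∉ φ.atoms)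
    (ψ : RTL.Formula Atom) (hψ : ψ = RTL.Formula.star q φ) (N : ℕ) (hN : ψ.length = N) :
    List.TFAE
      [φ.RealSatisfiable,
        ∃ m, RTL.IsRelativized φ q m ∧
          ∃ S : Set (RTL.Triple Atom), RTL.IsRealMosaicSystem ψ S ∧ m ∈ S,
        ∃ m, RTL.IsRelativized φ q m ∧ m ∈ RTL.level ψ (RTL.RMS ψ) (2 * N)] := by
  subst hψ hN
  tfae_have 1 → 3 := fun h => by
    obtain ⟨m, hm, hs⟩ := RTL.exists_isRelativized hq h
    exact ⟨m, hm, RTL.level_mono (RTL.satMosaics_subset_RMS _) _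
      (RTL.mem_level_of_mem_satMosaics hs)⟩
  tfae_have 3 → 2 := fun ⟨m, hm, h⟩ => ⟨m, hm, h.1⟩
  tfae_have 2 → 1 := fun ⟨m, hm, S, hS, hmS⟩ => by
    obtain ⟨n, hn⟩ := hS.exists_level m hmS
    exact hm.realSatisfiable (RTL.realizable_of_mem_level n m hn)
  tfae_finish
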